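/- Let $k\ge 2$. A finite hypergraph $G$ (with no repeated edges) is $k$-uniform if each of its edges has exactly $k$ vertices; $d_G(v)$ is the number of edges containing the vertex $v$. A path in $G$ is a sequence $(v_0,e_1,v_1,\dots,e_s,v_s)$ of distinct vertices $v_i$ and distinct edges $e_i$ with $v_{i-1},v_i\in e_i$; a cycle is such a sequence with $s\ge 2$ in which all $e_i$ are distinct and all $v_i$ are distinct except that $v_0=v_s$. A hypertree is a connected hypergraph (any two vertices are joined by a path) with no cycles. A pendant path of length $s\ge 1$ at $v_0$ is a path $(v_0,e_1,v_1,\dots,e_s,v_s)$ with $d_G(v_0)\ge 2$, $d_G(v_i)=2$ for $1\le i\le s-1$, $d_G(v_s)=1$, and $d_G(v)=1$ for all $v\in e_i\setminus\{v_{i-1},v_i\}$, $1\le i\le s$. A pendant edge is the edge of a pendant path of length $1$. For a $k$-uniform hypergraph $G$ on $[n]$, let $\mathcal{A}(G)$ be the tensor of order $k$ and dimension $n$ whose $(i_1,\dots,i_k)$-entry is $\frac{1}{(k-1)!}$ if $\{i_1,\dots,i_k\}\in E(G)$ and $0$ otherwise, let $\mathcal{D}(G)$ be the diagonal tensor of order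 $k$ whose $(i,\dots,i)$-entry is $d_G(i)$, and for $0\le\alpha<1$ let $\mathcal{A}_\alpha(G)=\alpha\mathcal{D}(G)+(1-\alpha)\mathcal{A}(G)$. A number $\lambda\in\mathbb{C}$ is an eigenvalue of a tensor $\mathcal{T}$ of order $k$ and dimension $n$ if there is a nonzero $x\in\mathbb{C}^n$ with $\sum_{i_2,\dots,i_k=1}^n\mathcal{T}_{ii_2\dots i_k}x_{i_2}\cdots x_{i_k}=\lambda x_i^{k-1}$ for all $i\in[n]$. The $\alpha$-spectral radius $\rho_\alpha(G)$ is the largest modulus of the eigenvalues of $\mathcal{A}_\alpha(G)$. For $2\le t\le m$, let $T_{m,t,k}$ be the $k$-uniform hypertree with $m$ edges consisting of $t$ pendant paths at a common vertex, otherwise disjoint, of which $m-t\lfloor m/t\rfloor$ have length $\lfloor m/t\rfloor+1$ and the other $t-(m-t\lfloor m/t\rfloor)$ have length $\lfloor m/t\rfloor$. **Theorem.** Let $G$ be a $k$-uniform hypertree with $m$ edges and exactly $t\ge 2$ pendant edges, and let $0\le\alpha<1$. Then $T_{m,t,k}$ is itself a $k$-uniform hypertree with $m$ edges and exactly $t$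 pendant edges, and $$\rho_\alpha(G)\le\rho_\alpha(T_{m,t,k}),$$ with equality if and only if $G\cong T_{m,t,k}$. -/

import Mathlib

noncomputable section

/-- A tensor of order `k` (used for `k ≥ 2`) and dimension `|ι|`, with complex entries. The first
index is split off: the entry `𝒯_{i i₂ … i_k}` is `𝒯 i (i₂, …, i_k)`. -/
def OrderTensor (k : ℕ) (ι : Type*) : Type _ := ι → (Fin (k - 1) → ι) → ℂ

namespace OrderTensor

variable {k : ℕ} {ι : Type*} [Fintype ι]

/-- `(𝒯 x)_i = ∑_{i₂, …, i_k} 𝒯_{i i₂ … i_k} x_{i₂} ⋯ x_{i_k}`. -/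
def apply (T : OrderTensor k ι) (x : ι → ℂ) : ι → ℂ :=
  fun i => ∑ j : Fin (k - 1) → ι, T i j * ∏ l, x (j l)

/-- `μ` is an eigenvalue of `𝒯`: there is a nonzero vector `x` with `𝒯 x = μ x^{[k-1]}`. -/
def IsEigenvalue (T : OrderTensor k ι) (μ : ℂ) : Prop :=
  ∃ x : ι → ℂ, x ≠ 0 ∧ ∀ i, T.apply x i = μ * x i ^ (k - 1)

/-- The spectral radius: the largest modulus of the eigenvalues. -/
def spectralRadius (T : OrderTensor k ι) : ℝ :=
  sSup {r : ℝ | ∃ μ : ℂ, T.IsEigenvalue μ ∧ r = ‖μ‖}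

end OrderTensor

namespace Hypergraph

variable {α β : Type*}

/-- Every edge has exactly `k` vertices. -/
def IsUniform (G : Hypergraph α) (k : ℕ) : Prop := ∀ e ∈ G.edgeSet, e.ncard = k

/-- The degree of `v`: the number of edges containing `v`. -/
def degree (G : Hypergraph α) (v : α) : ℕ := {e ∈ G.edgeSet | v ∈ e}.ncard

/-- `(v₀, e₁, v₁, …, e_s, v_s)` is a walk; `e_{i+1}` is `e i`. -/
def IsWalk (G : Hypergraph α) (s : ℕ) (v : Fin (s + 1) → α) (e : Fin s → Set α) : Prop :=
  (∀ i, v i ∈ G.vertexSet) ∧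
    ∀ i : Fin s, e i ∈ G.edgeSet ∧ v i.castSucc ∈ e i ∧ v i.succ ∈ e i ∧ v i.castSucc ≠ v i.succ

/-- A path: a walk with distinct vertices and distinct edges. -/
def IsPath (G : Hypergraph α) (s : ℕ) (v : Fin (s + 1) → α) (e : Fin s → Set α) : Prop :=
  G.IsWalk s v e ∧ Function.Injective v ∧ Function.Injective e

/-- A cycle: a walk with at least two edges, whose edges are distinct and whose vertices are
distinct except that `v₀ = v_s`. -/
def IsCycle (G : Hypergraph α) (s : ℕ) (v : Fin (s + 1) → α) (e : Fin s → Set α) : Prop :=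
  G.IsWalk s v e ∧ 2 ≤ s ∧ Function.Injective e ∧
    Function.Injective (fun i : Fin s => v i.castSucc) ∧ v 0 = v (Fin.last s)

/-- Any two vertices are joined by a path. -/
def IsConnected (G : Hypergraph α) : Prop :=
  G.vertexSet.Nonempty ∧ ∀ u ∈ G.vertexSet, ∀ w ∈ G.vertexSet,
    ∃ (s : ℕ) (v : Fin (s + 1) → α) (e : Fin s → Set α),
      G.IsPath s v e ∧ v 0 = u ∧ v (Fin.last s) = w

/-- A hypertree: a connected hypergraph with no cycles. -/
def IsHypertree (G : Hypergraph α) : Prop :=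
  G.IsConnected ∧ ∀ (s : ℕ) (v : Fin (s + 1) → α) (e : Fin s → Set α), ¬ G.IsCycle s v e

/-- A pendant path of positive length `s` at `v 0`: `v 0` has degree at least `2`, the inner path
vertices have degree `2`, the last one has degree `1`, and so do all vertices of the edges that are
not on the path. -/
def IsPendantPath (G : Hypergraph α) (s : ℕ) (v : Fin (s + 1) → α) (e : Fin s → Set α) : Prop :=
  1 ≤ s ∧ G.IsPath s v e ∧ 2 ≤ G.degree (v 0) ∧
    (∀ i, i ≠ 0 → i ≠ Fin.last s → G.degree (v i) = 2) ∧
    (∀ i : Fin s, ∀ w ∈ e i, w ≠ v i.castSucc → w ≠ v i.succ → G.degree w = 1) ∧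
    G.degree (v (Fin.last s)) = 1

/-- A pendant edge: the edge of a pendant path of length one. -/
def IsPendantEdge (G : Hypergraph α) (f : Set α) : Prop :=
  ∃ (v : Fin 2 → α) (e : Fin 1 → Set α), G.IsPendantPath 1 v e ∧ f = e 0

/-- `G` is a `k`-uniform hypertree with exactly `m` edges and exactly `t` pendant edges. -/
def IsHypertreeWith (G : Hypergraph α) (k m t : ℕ) : Prop :=
  G.IsUniform k ∧ G.IsHypertree ∧ G.edgeSet.ncard = m ∧ {f | G.IsPendantEdge f}.ncard = t

/-- Isomorphism: a bijection of the vertex sets that carries edges to edges in both directions. -/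
def Isomorphic (G : Hypergraph α) (H : Hypergraph β) : Prop :=
  ∃ φ : G.vertexSet ≃ H.vertexSet, ∀ s : Set G.vertexSet,
    Subtype.val '' s ∈ G.edgeSet ↔ Subtype.val '' (φ '' s) ∈ H.edgeSet

open Classical in
/-- The adjacency tensor of order `k`: the entry at `(i₁, …, i_k)` is `1 / (k-1)!` if
`{i₁, …, i_k}` is an edge and `0` otherwise. -/
def adjacencyTensor (G : Hypergraph α) (k : ℕ) : OrderTensor k G.vertexSet :=
  fun i j => if insert (i : α) (Set.range fun l => (j l : α)) ∈ G.edgeSet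
    then 1 / ((k - 1).factorial : ℂ) else 0

open Classical in
/-- The diagonal tensor of order `k` of the degrees. -/
def degreeTensor (G : Hypergraph α) (k : ℕ) : OrderTensor k G.vertexSet :=
  fun i j => if ∀ l, j l = i then (G.degree (i : α) : ℂ) else 0

/-- `𝒜_a(G) = a 𝒟(G) + (1 - a) 𝒜(G)`. -/
def alphaTensor (G : Hypergraph α) (k : ℕ) (a : ℝ) : OrderTensor k G.vertexSet :=
  fun i j => (a : ℂ) * G.degreeTensor k i j + (1 - (a : ℂ)) * G.adjacencyTensor k i j

/-- The `a`-spectral radius `ρ_a(G)` of a `k`-uniform hypergraph. -/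
def alphaSpectralRadius (G : Hypergraph α) [Fintype G.vertexSet] (k : ℕ) (a : ℝ) : ℝ :=
  (G.alphaTensor k a).spectralRadius

/-- Vertices of a union of `t` loose paths of lengths `len i` with `k` vertices in each edge, glued
at one end: the common vertex `none`, and on the `j`-th edge of the `i`-th path (counted from the
common vertex, starting with `j = 0`) the `k - 1` vertices `some ⟨i, j, a⟩` that are not on earlier
edges. -/
abbrev SpiderVertex (k t : ℕ) (len : Fin t → ℕ) : Type :=
  Option ((i : Fin t) × Fin (len i) × Fin (k - 1))

/-- The `j`-th edge of the `i`-th path: its `k - 1` own vertices, together with the common vertex if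
`j = 0`, and with the vertex `a = 0` of the previous edge if `j > 0`. -/
def spiderEdge (k t : ℕ) (len : Fin t → ℕ) (i : Fin t) (j : Fin (len i)) :
    Set (SpiderVertex k t len) :=
  {w | (w = none ∧ (j : ℕ) = 0) ∨ ∃ (j' : Fin (len i)) (a : Fin (k - 1)),
    w = some ⟨i, j', a⟩ ∧ (j' = j ∨ ((j' : ℕ) + 1 = (j : ℕ) ∧ (a : ℕ) = 0))}

/-- The `k`-uniform hypergraph (`k ≥ 2`) consisting of `t` loose paths with lengths `len i` that
start at a common vertex and are otherwise disjoint. -/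
def spider (k t : ℕ) (len : Fin t → ℕ) : Hypergraph (SpiderVertex k t len) where
  vertexSet := Set.univ
  edgeSet := {e | ∃ (i : Fin t) (j : Fin (len i)), e = spiderEdge k t len i j}
  subset_vertexSet_of_mem_edgeSet' := fun _ _ => Set.subset_univ _

instance (k t : ℕ) (len : Fin t → ℕ) : Fintype (spider k t len).vertexSet :=
  inferInstanceAs (Fintype (Set.univ : Set (SpiderVertex k t len)))

/-- Almost equal lengths with sum `m`: `m - t ⌊m/t⌋ = m % t` of them are `⌊m/t⌋ + 1`, the other ones
are `⌊m/t⌋`. -/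
def balancedLength (m t : ℕ) (i : Fin t) : ℕ := if (i : ℕ) < m % t then m / t + 1 else m / t

/-- The hypertree `T_{m,t,k}` (`2 ≤ t ≤ m`, `k ≥ 2`). -/
abbrev balancedSpider (m t k : ℕ) : Hypergraph (SpiderVertex k t (balancedLength m t)) :=
  spider k t (balancedLength m t)

end Hypergraph

end

/-! Let `lam` be the `a`-spectral radius of the balanced spider, `A = lam - a` and `C = (1 - a) ^ k
/ A ^ (k - 2)`. Multiply the eigenvalue equation of a positive eigenvector `x` at each vertex by the
value there. Solved along a pendant path from its free end, these equations show that the first edge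
contributes `σ s * x v ^ k` at the first vertex `v`, where `s` is the length, `σ 0 = 0` and `σ (s +
1) = a + C / (A - σ s)`. At the centre of the spider this says that the loads `σ` of its legs add up
to `lam` (`spider_eigenvalue`).

By Perron's theorem the spectral radius of a hypertree is the maximum of the form `∑ e, (a ∑ x v ^ k
+ (1 - a) k ∏ x v)` on nonnegative vectors with `∑ x v ^ k = 1`. To bound it by `lam`, pendant edges
are removed one at a time, and the removed part is remembered only as a multiset `Λ v` of leg
lengths at each remaining vertex (`LegState`); the number `m` of edges and the number `t` of pendant
edges, legs included, are preserved. The form of the remaining edges is at most `∑ v, (lam - ∑ s ∈ Λ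
v, σ s) x v ^ k` (`LegState.alphaForm_le`). With no legs this is the desired bound.

Let a removed edge hang at `u` and let its other vertices carry the legs `X`. One of these legs is
lengthened by one, and the resulting legs `Y` move to `u`. Weighted AM-GM on the edge, with a
Weierstrass product inequality, needs `a + C / (A - σ(X)) ≤ σ(Y)` for the total loads
(`edgeForm_le`). This reduces to `(z - σ s) (lam - z - σ (s + 1)) ≥ 0` with `z = σ(X)`
(`LegBound.load_step`). When only one vertex is left, it carries `t` legs of total length `m`, and
the claim is that their loads sum to at most `lam`.

Both inequalities follow from concavity. Successive increments of `σ` have ratio `(σ - a) / (A -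
σ)`, at most one while `2 σ ≤ lam`, and this holds for lengths up to `m / 2`; so `σ` lies below a
supporting line at `m / t`, and balanced lengths maximise the sum (`pathLoad_legBound`). A removable
edge with short enough legs always exists (`LegState.exists_removable`).

For equality every removal must be tight. This allows at most one leg on the removed edge, so the
recorded legs are actual paths (`Realized`), and strict concavity forces their lengths to be `m / t`
or `m / t + 1` (`LegBound.mem_of_sum_eq`). -/

namespace Finset

/-! ### Weighted AM-GM on an edge -/

variable {V : Type*}

/-- The arithmetic-geometric mean inequality for the values `y v ^ k` with weights `b v`. -/
theorem mul_prod_le_sum_mul_pow (s : Finset V) {k : ℕ} (hs : s.card = k) (hk : 0 < k)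
    {b x : V → ℝ} {q : ℝ} (hb : ∀ v ∈ s, 0 ≤ b v) (hx : ∀ v ∈ s, 0 ≤ x v)
    (hq : q ^ k ≤ ∏ v ∈ s, b v) :
    q * k * ∏ v ∈ s, x v ≤ ∑ v ∈ s, b v * x v ^ k := by
  have hk' : (0 : ℝ) < k := by exact_mod_cast hk
  have h := Real.geom_mean_le_arith_mean s (fun _ => (1 : ℝ)) (fun v => b v * x v ^ k)
    (by simp) (by simp [hs, hk']) (fun v hv => mul_nonneg (hb v hv) (pow_nonneg (hx v hv) _))
  simp only [Real.rpow_one, sum_const, hs, nsmul_eq_mul, mul_one, one_mul] at h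
  rw [le_div_iff₀ hk'] at h
  have hP : 0 ≤ ∏ v ∈ s, x v := prod_nonneg hx
  have h2 : q * ∏ v ∈ s, x v ≤ (∏ v ∈ s, b v * x v ^ k) ^ (k : ℝ)⁻¹ := by
    have hnn : 0 ≤ ∏ v ∈ s, b v * x v ^ k :=
      prod_nonneg fun v hv => mul_nonneg (hb v hv) (pow_nonneg (hx v hv) _)
    refine le_of_pow_le_pow_left₀ hk.ne' (Real.rpow_nonneg hnn _) ?_
    rw [Real.rpow_inv_natCast_pow hnn hk.ne', mul_pow, prod_mul_distrib, prod_pow]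
    exact mul_le_mul_of_nonneg_right hq (pow_nonneg hP _)
  nlinarith

/-- The strict hypothesis leaves room to enlarge `q` slightly and still apply the weak inequality;
the product of the `x v` is positive, so this is a gain. -/
theorem mul_prod_lt_sum_mul_pow (s : Finset V) {k : ℕ} (hs : s.card = k) (hk : 0 < k)
    {b x : V → ℝ} {q : ℝ} (hb : ∀ v ∈ s, 0 ≤ b v) (hx : ∀ v ∈ s, 0 < x v)
    (hq : q ^ k < ∏ v ∈ s, b v) :
    q * k * ∏ v ∈ s, x v < ∑ v ∈ s, b v * x v ^ k := by
  have hc : Filter.Tendsto (fun r : ℝ => r ^ k) (nhdsWithin q (Set.Ioi q)) (nhds (q ^ k)) :=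
    ((continuous_pow k).tendsto q).mono_left nhdsWithin_le_nhds
  obtain ⟨r, hr1, hr2⟩ :=
    ((hc.eventually (gt_mem_nhds hq)).and self_mem_nhdsWithin).exists
  refine lt_of_lt_of_le ?_
    (mul_prod_le_sum_mul_pow s hs hk hb (fun v hv => (hx v hv).le) hr1.le)
  have hk' : (0 : ℝ) < k := by exact_mod_cast hk
  have hP : 0 < ∏ v ∈ s, x v := prod_pos hx
  have : q < r := hr2
  gcongr

end Finset

/-! ### The form of the tensor and Perron's theorem -/

namespace UniformFamily

variable {V : Type*}

/-- Two vertices are adjacent if they lie in a common edge. -/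
def Adj (E : Finset (Finset V)) (u w : V) : Prop := ∃ e ∈ E, u ∈ e ∧ w ∈ e

variable (k : ℕ) (a : ℝ)

/-- The contribution of the edge `e` to the form of the `a`-tensor. -/
def edgeForm (e : Finset V) (x : V → ℝ) : ℝ :=
  a * ∑ v ∈ e, x v ^ k + (1 - a) * k * ∏ v ∈ e, x v

/-- The form of the `a`-tensor of the family `E` of `k`-sets. -/
def alphaForm (E : Finset (Finset V)) (x : V → ℝ) : ℝ := ∑ e ∈ E, edgeForm k a e x

theorem alphaForm_smul (E : Finset (Finset V)) (hE : ∀ e ∈ E, e.card = k) (r : ℝ) (x : V → ℝ) :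
    alphaForm k a E (fun v => r * x v) = r ^ k * alphaForm k a E x := by
  simp only [alphaForm, edgeForm, Finset.mul_sum]
  refine Finset.sum_congr rfl fun e he => ?_
  simp only [mul_pow, Finset.prod_mul_distrib, Finset.prod_const, hE e he, mul_add, Finset.mul_sum]
  congr 1
  · exact Finset.sum_congr rfl fun v _ => by ring
  · ring

theorem hasDerivAt_edgeForm_update [DecidableEq V] (e : Finset V) (x : V → ℝ) (i : V) :
    HasDerivAt (fun y => edgeForm k a e (Function.update x i y))
      (if i ∈ e then k * (a * x i ^ (k - 1) + (1 - a) * ∏ v ∈ e.erase i, x v) else 0) (x i) := by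
  unfold edgeForm
  split_ifs with hi
  · have h : (fun y => a * ∑ v ∈ e, Function.update x i y v ^ k
        + (1 - a) * k * ∏ v ∈ e, Function.update x i y v) =
        fun y => a * (y ^ k + ∑ v ∈ e.erase i, x v ^ k)
          + (1 - a) * k * (y * ∏ v ∈ e.erase i, x v) := by
      funext y
      rw [← Finset.add_sum_erase _ _ hi, ← Finset.mul_prod_erase _ _ hi]
      simp only [Function.update_self]
      have hA : ∑ v ∈ e.erase i, Function.update x i y v ^ k = ∑ v ∈ e.erase i, x v ^ k :=
        Finset.sum_congr rfl fun v hv => by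
          rw [Function.update_of_ne (Finset.ne_of_mem_erase hv)]
      have hB : ∏ v ∈ e.erase i, Function.update x i y v = ∏ v ∈ e.erase i, x v :=
        Finset.prod_congr rfl fun v hv => by
          rw [Function.update_of_ne (Finset.ne_of_mem_erase hv)]
      rw [hA, hB]
    rw [h]
    have h1 := (((hasDerivAt_pow k (x i)).add_const (∑ v ∈ e.erase i, x v ^ k)).const_mul a).add
      (((hasDerivAt_id (x i)).mul_const (∏ v ∈ e.erase i, x v)).const_mul ((1 - a) * k))
    exact h1.congr_deriv (by ring)
  · have h : (fun y => a * ∑ v ∈ e, Function.update x i y v ^ k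
        + (1 - a) * k * ∏ v ∈ e, Function.update x i y v) =
        fun _ => a * ∑ v ∈ e, x v ^ k + (1 - a) * k * ∏ v ∈ e, x v := by
      funext y
      have : ∀ v ∈ e, Function.update x i y v = x v := fun v hv =>
        Function.update_of_ne (by rintro rfl; exact hi hv) _ _
      congr 2
      · exact Finset.sum_congr rfl fun v hv => by rw [this v hv]
      · exact Finset.prod_congr rfl this
    rw [h]
    exact hasDerivAt_const _ _

variable [Fintype V]

theorem exists_maximizer [Nonempty V] (hk : 0 < k) (E : Finset (Finset V))
    (hE : ∀ e ∈ E, e.card = k) :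
    ∃ (ρ : ℝ) (x : V → ℝ), (∀ v, 0 ≤ x v) ∧ ∑ v, x v ^ k = 1 ∧ alphaForm k a E x = ρ ∧
      ∀ y : V → ℝ, (∀ v, 0 ≤ y v) → alphaForm k a E y ≤ ρ * ∑ v, y v ^ k := by
  classical
  set K : Set (V → ℝ) := {x | (∀ v, 0 ≤ x v) ∧ ∑ v, x v ^ k = 1} with hK
  have hclosed : IsClosed K := by
    have h1 : IsClosed {x : V → ℝ | ∀ v, 0 ≤ x v} := by
      simp only [Set.ofPred_forall]
      exact isClosed_iInter fun v => isClosed_le continuous_const (continuous_apply v)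
    have h2 : IsClosed {x : V → ℝ | ∑ v, x v ^ k = 1} :=
      isClosed_eq (by fun_prop) continuous_const
    exact h1.inter h2
  have hsub : K ⊆ Set.Icc (fun _ => 0) (fun _ => 1) := by
    rintro x ⟨h0, h1⟩
    refine ⟨h0, fun v => ?_⟩
    have : x v ^ k ≤ 1 := by
      rw [← h1]
      exact Finset.single_le_sum (f := fun v => x v ^ k) (fun w _ => pow_nonneg (h0 w) k)
        (Finset.mem_univ v)
    exact (pow_le_one_iff_of_nonneg (h0 v) hk.ne').1 this
  have hcomp : IsCompact K := isCompact_Icc.of_isClosed_subset hclosed hsub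
  have hne : K.Nonempty := by
    obtain ⟨v0⟩ := ‹Nonempty V›
    refine ⟨fun v => if v = v0 then 1 else 0, fun v => by dsimp only; split_ifs <;> simp, ?_⟩
    simp [ite_pow, hk.ne']
  have hcont : Continuous (alphaForm k a E) := by
    unfold alphaForm edgeForm
    fun_prop
  obtain ⟨x, hxK, hx⟩ := hcomp.exists_isMaxOn hne hcont.continuousOn
  refine ⟨alphaForm k a E x, x, hxK.1, hxK.2, rfl, fun y hy => ?_⟩
  set s := ∑ v, y v ^ k with hs
  have hs0 : 0 ≤ s := Finset.sum_nonneg fun v _ => pow_nonneg (hy v) k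
  rcases hs0.eq_or_lt with h0 | h0
  · have hy0 : y = fun v => 0 * y v := by
      funext v
      have := (Finset.sum_eq_zero_iff_of_nonneg (fun v _ => pow_nonneg (hy v) k)).1 h0.symm v
        (Finset.mem_univ v)
      simp [eq_zero_of_pow_eq_zero this]
    rw [← h0, mul_zero, hy0, alphaForm_smul k a E hE, zero_pow hk.ne', zero_mul]
  · set r := s ^ ((k : ℝ)⁻¹) with hr
    have hrk : r ^ k = s := Real.rpow_inv_natCast_pow hs0 hk.ne'
    have hr0 : 0 < r := Real.rpow_pos_of_pos h0 _
    have hz : (fun v => r⁻¹ * y v) ∈ K := by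
      refine ⟨fun v => mul_nonneg (inv_nonneg.2 hr0.le) (hy v), ?_⟩
      simp only [mul_pow, ← Finset.mul_sum, inv_pow, hrk]
      exact inv_mul_cancel₀ h0.ne'
    have h := hx hz
    simp only [Set.mem_ofPred_eq] at h
    rw [alphaForm_smul k a E hE, inv_pow, hrk, inv_mul_le_iff₀ h0] at h
    linarith

/-- If a coordinate vanishes, connectedness gives an edge with both zero and nonzero coordinates.
Raising all zeros to `ε` adds at least a multiple of `ε ^ (k - 1)` to the form, because that edge
has at most `k - 1` zeros, while `∑ x v ^ k` grows only by a multiple of `ε ^ k`. -/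
theorem maximizer_pos (hk : 0 < k) (ha0 : 0 ≤ a) (ha1 : a < 1) (E : Finset (Finset V))
    (hE : ∀ e ∈ E, e.card = k) (hconn : ∀ u w, Relation.ReflTransGen (Adj E) u w) {ρ : ℝ}
    {x : V → ℝ} (hx0 : ∀ v, 0 ≤ x v) (hx1 : ∑ v, x v ^ k = 1) (hx : alphaForm k a E x = ρ)
    (hmax : ∀ y : V → ℝ, (∀ v, 0 ≤ y v) → alphaForm k a E y ≤ ρ * ∑ v, y v ^ k) (v : V) :
    0 < x v := by
  classical
  by_contra hv
  have hv0 : x v = 0 := le_antisymm (not_lt.1 hv) (hx0 v)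
  have ha1' : 0 < 1 - a := by linarith
  have hk' : (0 : ℝ) < k := by exact_mod_cast hk
  obtain ⟨e, he, ⟨u, hu, hu0⟩, ⟨w, hw, hw0⟩⟩ :
      ∃ e ∈ E, (∃ u ∈ e, x u = 0) ∧ ∃ w ∈ e, x w ≠ 0 := by
    by_contra hcon
    push Not at hcon
    have hall : ∀ w, x w = 0 := by
      intro w
      induction hconn v w with
      | refl => exact hv0
      | tail _ h ih =>
        obtain ⟨e, he, h1, h2⟩ := h
        exact hcon e he ⟨_, h1, ih⟩ _ h2
    simp [hall, hk.ne'] at hx1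
  set Z := Finset.univ.filter fun v => x v = 0 with hZ
  let y : ℝ → V → ℝ := fun ε v => if x v = 0 then ε else x v
  set P := ∏ v ∈ e.filter (fun v => x v ≠ 0), x v with hP
  have hP0 : 0 < P := Finset.prod_pos fun v hv =>
    lt_of_le_of_ne (hx0 v) (Finset.mem_filter.1 hv).2.symm
  have hkey : ∀ ε : ℝ, 0 < ε → ε ≤ 1 → (1 - a) * k * P ≤ ρ * Z.card * ε := by
    intro ε h0 h1
    have hy0 : ∀ v, 0 ≤ y ε v := fun v => by
      simp only [y]; split_ifs; exacts [h0.le, hx0 v]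
    have hxy : ∀ v, x v ≤ y ε v := fun v => by
      simp only [y]; split_ifs with h; exacts [h ▸ h0.le, le_rfl]
    have hsum : ∑ v, y ε v ^ k = 1 + Z.card * ε ^ k := by
      rw [← hx1, hZ, ← nsmul_eq_mul, ← Finset.sum_const, Finset.sum_filter,
        ← Finset.sum_add_distrib]
      refine Finset.sum_congr rfl fun v _ => ?_
      simp only [y]; split_ifs with h <;> simp [h, hk.ne']
    have hedge : ∀ f, edgeForm k a f x ≤ edgeForm k a f (y ε) := by
      intro f
      unfold edgeForm
      have hA : ∑ v ∈ f, x v ^ k ≤ ∑ v ∈ f, y ε v ^ k :=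
        Finset.sum_le_sum fun v _ => pow_le_pow_left₀ (hx0 v) (hxy v) k
      have hB : ∏ v ∈ f, x v ≤ ∏ v ∈ f, y ε v :=
        Finset.prod_le_prod (fun v _ => hx0 v) (fun v _ => hxy v)
      gcongr
    have hprod : ε ^ (k - 1) * P ≤ ∏ v ∈ e, y ε v := by
      rw [← Finset.prod_filter_mul_prod_filter_not e (fun v => x v = 0)]
      have e1 : ∏ v ∈ e with x v = 0, y ε v = ε ^ (e.filter fun v => x v = 0).card := by
        rw [← Finset.prod_const]
        exact Finset.prod_congr rfl fun v hv => by simp [y, (Finset.mem_filter.1 hv).2]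
      have e2 : ∏ v ∈ e with ¬ x v = 0, y ε v = P :=
        Finset.prod_congr rfl fun v hv => by simp [y, (Finset.mem_filter.1 hv).2]
      rw [e1, e2]
      refine mul_le_mul_of_nonneg_right (pow_le_pow_of_le_one h0.le h1 ?_) hP0.le
      have hlt : (e.filter fun v => x v = 0).card < e.card :=
        Finset.card_lt_card (Finset.filter_ssubset.2 ⟨w, hw, hw0⟩)
      have := hE e he
      omega
    have hgain : alphaForm k a E x + (1 - a) * k * (ε ^ (k - 1) * P) ≤ alphaForm k a E (y ε) := by
      unfold alphaForm
      rw [← Finset.add_sum_erase _ _ he, ← Finset.add_sum_erase _ _ he]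
      have h1 : ∑ f ∈ E.erase e, edgeForm k a f x ≤ ∑ f ∈ E.erase e, edgeForm k a f (y ε) :=
        Finset.sum_le_sum fun f _ => hedge f
      have h2 : edgeForm k a e x + (1 - a) * k * (ε ^ (k - 1) * P) ≤ edgeForm k a e (y ε) := by
        unfold edgeForm
        rw [Finset.prod_eq_zero hu hu0]
        have hA : ∑ v ∈ e, x v ^ k ≤ ∑ v ∈ e, y ε v ^ k :=
          Finset.sum_le_sum fun v _ => pow_le_pow_left₀ (hx0 v) (hxy v) k
        have hA' := mul_le_mul_of_nonneg_left hA ha0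
        have hB := mul_le_mul_of_nonneg_left hprod (mul_nonneg ha1'.le hk'.le)
        linarith
      linarith
    have h := hmax (y ε) hy0
    rw [hsum] at h
    have h3 : (1 - a) * k * P * ε ^ (k - 1) ≤ ρ * Z.card * ε * ε ^ (k - 1) := by
      have : ε ^ k = ε * ε ^ (k - 1) := by
        rw [← pow_succ']; congr 1; omega
      rw [this] at h
      linarith
    exact le_of_mul_le_mul_right h3 (pow_pos h0 _)
  set κ := (1 - a) * k * P with hκ
  have hκ0 : 0 < κ := by positivity
  set R := |ρ * Z.card| with hR
  have hR0 : 0 ≤ R := abs_nonneg _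
  have hden : 0 < R + κ := by linarith
  -- This `ε` is at most one and satisfies `R * ε < κ`, against `hkey`.
  have h := hkey (κ / (2 * (R + κ))) (by positivity) (by rw [div_le_one (by positivity)]; linarith)
  have h2 : ρ * Z.card * (κ / (2 * (R + κ))) ≤ R * (κ / (2 * (R + κ))) :=
    mul_le_mul_of_nonneg_right (le_abs_self _) (by positivity)
  have h3 : R * (κ / (2 * (R + κ))) < κ := by
    rw [mul_div_assoc', div_lt_iff₀ (by positivity)]
    nlinarith
  linarith

/-- The eigenvalue equation of the `a`-tensor at the vertex `i`, with values in a ring. -/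
def tensorApply [DecidableEq V] {R : Type*} [CommRing R] (a : R) (E : Finset (Finset V))
    (x : V → R) (i : V) : R :=
  ∑ e ∈ E with i ∈ e, (a * x i ^ (k - 1) + (1 - a) * ∏ v ∈ e.erase i, x v)

theorem sum_tensorApply_mul [DecidableEq V] (hk : 0 < k) (E : Finset (Finset V))
    (hE : ∀ e ∈ E, e.card = k) (x : V → ℝ) :
    ∑ i, tensorApply k a E x i * x i = alphaForm k a E x := by
  simp only [tensorApply, alphaForm, Finset.sum_filter, Finset.sum_mul]
  rw [Finset.sum_comm]
  refine Finset.sum_congr rfl fun e he => ?_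
  have : ∀ i, (if i ∈ e then a * x i ^ (k - 1) + (1 - a) * ∏ v ∈ e.erase i, x v else 0) * x i
      = if i ∈ e then a * x i ^ k + (1 - a) * ∏ v ∈ e, x v else 0 := by
    intro i
    split_ifs with hi
    · rw [← Finset.mul_prod_erase e x hi]
      have : x i ^ k = x i ^ (k - 1) * x i := by rw [← pow_succ]; congr 1; omega
      rw [this]; ring
    · exact zero_mul _
  simp only [this, edgeForm, Finset.sum_ite_mem, Finset.univ_inter, Finset.sum_add_distrib,
    Finset.mul_sum, Finset.sum_const, nsmul_eq_mul, hE e he]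
  ring

/-- A positive maximizer is interior, so each partial derivative of the form minus `ρ ∑ x v ^ k`
vanishes there; it is `k` times the defect in the eigenvalue equation. -/
theorem maximizer_eigen [DecidableEq V] (hk : 0 < k) (E : Finset (Finset V)) {ρ : ℝ}
    {x : V → ℝ} (hx0 : ∀ v, 0 < x v) (hx : alphaForm k a E x = ρ * ∑ v, x v ^ k)
    (hmax : ∀ y : V → ℝ, (∀ v, 0 ≤ y v) → alphaForm k a E y ≤ ρ * ∑ v, y v ^ k) (i : V) :
    tensorApply k a E x i = ρ * x i ^ (k - 1) := by
  have hk' : (0 : ℝ) < k := by exact_mod_cast hk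
  have hd1 : HasDerivAt (fun y => alphaForm k a E (Function.update x i y))
      (k * tensorApply k a E x i) (x i) := by
    have := HasDerivAt.fun_sum (u := E) fun e _ => hasDerivAt_edgeForm_update k a e x i
    refine this.congr_deriv ?_
    simp only [tensorApply, Finset.sum_filter, Finset.mul_sum]
    exact Finset.sum_congr rfl fun e _ => by split_ifs <;> simp
  have hd2 : HasDerivAt (fun y => ρ * ∑ v, Function.update x i y v ^ k)
      (ρ * (k * x i ^ (k - 1))) (x i) := by
    have h : (fun y => ρ * ∑ v, Function.update x i y v ^ k) =
        fun y => ρ * (y ^ k + ∑ v ∈ Finset.univ.erase i, x v ^ k) := by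
      funext y
      rw [← Finset.add_sum_erase _ _ (Finset.mem_univ i)]
      simp only [Function.update_self]
      congr 2
      exact Finset.sum_congr rfl fun v hv => by
        rw [Function.update_of_ne (Finset.ne_of_mem_erase hv)]
    rw [h]
    exact ((hasDerivAt_pow k (x i)).add_const _).const_mul ρ
  have hd := hd1.sub hd2
  have hloc : IsLocalMax ((fun y => alphaForm k a E (Function.update x i y)) -
      fun y => ρ * ∑ v, Function.update x i y v ^ k) (x i) := by
    filter_upwards [lt_mem_nhds (hx0 i)] with y hy
    have h1 := hmax (Function.update x i y) (fun v => by
      rcases eq_or_ne v i with rfl | h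
      · simpa using hy.le
      · simpa [h] using (hx0 v).le)
    simp only [Pi.sub_apply, Function.update_eq_self]
    linarith
  have h0 := hloc.hasDerivAt_eq_zero hd
  have : (k : ℝ) * (tensorApply k a E x i - ρ * x i ^ (k - 1)) = 0 := by linarith
  rcases mul_eq_zero.1 this with h | h
  · exact absurd h hk'.ne'
  · linarith

/-- The set of moduli of the eigenvalues of the `a`-tensor. -/
def eigenModuli [DecidableEq V] (E : Finset (Finset V)) : Set ℝ :=
  {r | ∃ μ : ℂ, (∃ x : V → ℂ, x ≠ 0 ∧ ∀ i, tensorApply k (a : ℂ) E x i = μ * x i ^ (k - 1)) ∧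
    r = ‖μ‖}

/-- The largest modulus of the eigenvalues of the `a`-tensor. -/
noncomputable def rho [DecidableEq V] (E : Finset (Finset V)) : ℝ := sSup (eigenModuli k a E)

/-- The moduli of an eigenvector satisfy the eigenvalue equation as an inequality; multiplied by `‖x
i‖` and summed over `i`, this compares with the form. Only an upper bound on the form is assumed of
`ρ`, so the lemma also serves with the spectral radius of the spider in place of `ρ`. -/
theorem norm_eigenvalue_le [DecidableEq V] (hk : 0 < k) (ha0 : 0 ≤ a) (ha1 : a < 1)
    (E : Finset (Finset V)) (hE : ∀ e ∈ E, e.card = k) {ρ : ℝ}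
    (hmax : ∀ y : V → ℝ, (∀ v, 0 ≤ y v) → alphaForm k a E y ≤ ρ * ∑ v, y v ^ k) {r : ℝ}
    (hr : r ∈ eigenModuli k a E) : r ≤ ρ := by
  obtain ⟨μ, ⟨x, hx, hμ⟩, rfl⟩ := hr
  set y : V → ℝ := fun v => ‖x v‖ with hy
  have hpos : 0 < ∑ v, y v ^ k := by
    obtain ⟨v, hv⟩ := Function.ne_iff.1 hx
    exact Finset.sum_pos' (fun v _ => pow_nonneg (norm_nonneg _) _)
      ⟨v, Finset.mem_univ v, pow_pos (norm_pos_iff.2 hv) _⟩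
  have hle : ∀ i, ‖μ‖ * y i ^ (k - 1) ≤ tensorApply k a E y i := by
    intro i
    rw [hy, ← norm_pow, ← norm_mul, ← hμ i, tensorApply, tensorApply]
    refine (norm_sum_le _ _).trans (Finset.sum_le_sum fun e _ => (norm_add_le _ _).trans ?_)
    have h1 : ‖(1 : ℂ) - (a : ℂ)‖ = 1 - a := by
      rw [← Complex.ofReal_one, ← Complex.ofReal_sub, Complex.norm_real, Real.norm_of_nonneg]
      linarith
    rw [norm_mul, norm_mul, norm_pow, norm_prod, h1, Complex.norm_real, Real.norm_of_nonneg ha0]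
  have h2 : ‖μ‖ * ∑ v, y v ^ k ≤ alphaForm k a E y := by
    rw [← sum_tensorApply_mul k a hk E hE, Finset.mul_sum]
    refine Finset.sum_le_sum fun i _ => ?_
    have : y i ^ k = y i ^ (k - 1) * y i := by rw [← pow_succ]; congr 1; omega
    rw [this, ← mul_assoc]
    exact mul_le_mul_of_nonneg_right (hle i) (norm_nonneg _)
  exact le_of_mul_le_mul_right (h2.trans (hmax y fun v => norm_nonneg _)) hpos

/-- Perron's theorem for the `a`-tensor of a connected family of `k`-sets. -/
theorem exists_perron [Nonempty V] [DecidableEq V] (hk : 0 < k) (ha0 : 0 ≤ a) (ha1 : a < 1)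
    (E : Finset (Finset V)) (hE : ∀ e ∈ E, e.card = k)
    (hconn : ∀ u w, Relation.ReflTransGen (Adj E) u w) :
    IsGreatest (eigenModuli k a E) (rho k a E) ∧ ∃ x : V → ℝ, (∀ v, 0 < x v) ∧
      ∀ i, tensorApply k a E x i = rho k a E * x i ^ (k - 1) := by
  obtain ⟨ρ, x, hx0, hx1, hx, hmax⟩ := exists_maximizer k a hk E hE
  have hpos := maximizer_pos k a hk ha0 ha1 E hE hconn hx0 hx1 hx hmax
  have heig := maximizer_eigen k a hk E hpos (by rw [hx, hx1, mul_one]) hmax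
  have hρ0 : 0 ≤ ρ := by
    rw [← hx]
    refine Finset.sum_nonneg fun e _ => add_nonneg
      (mul_nonneg ha0 (Finset.sum_nonneg fun v _ => pow_nonneg (hx0 v) _))
      (mul_nonneg (mul_nonneg (by linarith) (Nat.cast_nonneg k)) (Finset.prod_nonneg fun v _ => hx0 v))
  have hg : IsGreatest (eigenModuli k a E) ρ := by
    refine ⟨⟨(ρ : ℂ), ⟨fun v => (x v : ℂ), ?_, fun i => ?_⟩, ?_⟩, fun r hr =>
      norm_eigenvalue_le k a hk ha0 ha1 E hE hmax hr⟩
    · obtain ⟨v⟩ := ‹Nonempty V›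
      exact fun h => (hpos v).ne' (by simpa using congrFun h v)
    · have := congrArg (fun r : ℝ => (r : ℂ)) (heig i)
      simpa [tensorApply] using this
    · rw [Complex.norm_real, Real.norm_of_nonneg hρ0]
  have hrho : rho k a E = ρ := hg.csSup_eq
  rw [hrho]
  exact ⟨hg, x, hpos, heig⟩

/-! ### Paths, hypertrees and pendant edges -/

variable {V : Type*}

/-- `v 0, e 0, v 1, …, e (s - 1), v s` is a path in the family `E`. -/
structure PathIn (E : Finset (Finset V)) (s : ℕ) (v : ℕ → V) (e : ℕ → Finset V) : Prop where
  mem : ∀ i < s, e i ∈ E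
  left : ∀ i < s, v i ∈ e i
  right : ∀ i < s, v (i + 1) ∈ e i
  injV : ∀ i ≤ s, ∀ j ≤ s, v i = v j → i = j
  injE : ∀ i < s, ∀ j < s, e i = e j → i = j

/-- No path of positive length can be closed by a further edge. -/
def Acyclic (E : Finset (Finset V)) : Prop :=
  ∀ s v e f, 1 ≤ s → PathIn E s v e → f ∈ E → v 0 ∈ f → v s ∈ f → ∃ i < s, e i = f

theorem Acyclic.mono {E F : Finset (Finset V)} (h : Acyclic E) (hF : F ⊆ E) : Acyclic F :=
  fun s v e f hs hp hf h0 h1 =>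
    h s v e f hs ⟨fun i hi => hF (hp.mem i hi), hp.left, hp.right, hp.injV, hp.injE⟩ (hF hf) h0 h1

namespace PathIn

variable {E : Finset (Finset V)} {s : ℕ} {v : ℕ → V} {e : ℕ → Finset V}

theorem drop (h : PathIn E s v e) {j : ℕ} (hj : j ≤ s) :
    PathIn E (s - j) (fun i => v (i + j)) (fun i => e (i + j)) where
  mem i hi := h.mem _ (by omega)
  left i hi := h.left _ (by omega)
  right i hi := by
    have := h.right (i + j) (by omega)
    rwa [show i + j + 1 = i + 1 + j by omega] at this
  injV i hi l hl hil := by have := h.injV _ (by omega) _ (by omega) hil; omega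
  injE i hi l hl hil := by have := h.injE _ (by omega) _ (by omega) hil; omega

theorem take (h : PathIn E s v e) {j : ℕ} (hj : j ≤ s) : PathIn E j v e where
  mem i hi := h.mem _ (by omega)
  left i hi := h.left _ (by omega)
  right i hi := h.right _ (by omega)
  injV i hi l hl hil := h.injV _ (by omega) _ (by omega) hil
  injE i hi l hl hil := h.injE _ (by omega) _ (by omega) hil

theorem reverse (h : PathIn E s v e) :
    PathIn E s (fun i => v (s - i)) (fun i => e (s - 1 - i)) where
  mem i hi := h.mem _ (by omega)
  left i hi := by
    have := h.right (s - 1 - i) (by omega)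
    rwa [show s - 1 - i + 1 = s - i by omega] at this
  right i hi := by
    have := h.left (s - 1 - i) (by omega)
    rwa [show s - 1 - i = s - (i + 1) by omega] at this ⊢
  injV i hi l hl hil := by have := h.injV _ (by omega) _ (by omega) hil; omega
  injE i hi l hl hil := by have := h.injE _ (by omega) _ (by omega) hil; omega

theorem snoc (h : PathIn E s v e) {f : Finset V} {w : V} (hf : f ∈ E) (hvf : v s ∈ f)
    (hwf : w ∈ f) (hw : ∀ i ≤ s, v i ≠ w) (hfe : ∀ i < s, e i ≠ f) :
    PathIn E (s + 1) (fun i => if i ≤ s then v i else w) (fun i => if i < s then e i else f) where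
  mem i hi := by
    split_ifs with h1
    exacts [h.mem i h1, hf]
  left i hi := by
    rw [if_pos (show i ≤ s by omega)]; split_ifs with h1
    · exact h.left i h1
    · rwa [show i = s by omega]
  right i hi := by
    by_cases h1 : i < s
    · rw [if_pos h1, if_pos (show i + 1 ≤ s by omega)]; exact h.right i h1
    · rw [if_neg h1, if_neg (show ¬ i + 1 ≤ s by omega)]; exact hwf
  injV i hi j hj hij := by
    split_ifs at hij with h1 h2 h2
    · exact h.injV i h1 j h2 hij
    · exact absurd hij (hw i h1)
    · exact absurd hij.symm (hw j h2)
    · omega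
  injE i hi j hj hij := by
    split_ifs at hij with h1 h2 h2
    · exact h.injE i h1 j h2 hij
    · exact absurd hij (hfe i h1)
    · exact absurd hij.symm (hfe j h2)
    · omega

theorem length_le [DecidableEq V] (h : PathIn E s v e) : s ≤ E.card := by
  have : ((Finset.range s).image e).card = s := by
    rw [Finset.card_image_of_injOn, Finset.card_range]
    intro i hi j hj hij
    exact h.injE i (by simpa using hi) j (by simpa using hj) hij
  rw [← this]
  refine Finset.card_le_card fun f hf => ?_
  obtain ⟨i, hi, rfl⟩ := Finset.mem_image.1 hf
  exact h.mem i (by simpa using hi)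

/-- In an acyclic family, the last edge of a path of maximal length meets other edges at most in
its penultimate vertex. -/
theorem last_edge_pendant [DecidableEq V] (h : PathIn E (s + 1) v e) (hac : Acyclic E)
    (hcard : ∀ f ∈ E, 2 ≤ f.card) (hmax : ∀ s' v' e', PathIn E s' v' e' → s' ≤ s + 1)
    {w : V} (hw : w ∈ e s) (hwv : w ≠ v s) {f : Finset V} (hf : f ∈ E) (hwf : w ∈ f) :
    f = e s := by
  by_contra hne
  have hs := h.take (Nat.le_succ s)
  have hes := h.mem s (by omega)
  -- If `w` is an earlier vertex of the path, `e s` closes a cycle. Otherwise `w` can serve as the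
  -- endpoint of an equally long path.
  by_cases hon : ∃ j ≤ s, v j = w
  · obtain ⟨j, hj, rfl⟩ := hon
    have hjs : j ≠ s := by rintro rfl; exact hwv rfl
    obtain ⟨i, hi, hie⟩ := hac (s - j) _ _ (e s) (by omega) (hs.drop hj) hes
      (by simpa using hw) (by simpa [Nat.sub_add_cancel hj] using h.left s (by omega))
    have := h.injE (i + j) (by omega) s (by omega) hie
    omega
  push Not at hon
  have hp := hs.snoc hes (h.left s (by omega)) hw hon
    (fun i hi he => by have := h.injE i (by omega) s (by omega) he; omega)
  set v' : ℕ → V := fun i => if i ≤ s then v i else w with hv'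
  set e' : ℕ → Finset V := fun i => if i < s then e i else e s with he'
  have hv'e : v' (s + 1) = w := by simp [hv']
  -- If `f` was used before on the path, it closes the part of the path after it.
  by_cases hfe : ∃ j < s + 1, e' j = f
  · obtain ⟨j, hj, rfl⟩ := hfe
    have hjs : j < s := by
      by_contra hjs
      exact hne (by simp [he', hjs])
    have hee : e' j = e j := by simp [he', hjs]
    have hp2 := hp.drop (j := j + 1) (by omega)
    obtain ⟨i, hi, hie⟩ := hac _ _ _ (e' j) (by omega) hp2 hf
      (by simpa using hp.right j (by omega))
      (by
        have : s + 1 - (j + 1) + (j + 1) = s + 1 := by omega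
        simpa only [this, hv'e] using hwf)
    have := hp.injE (i + (j + 1)) (by omega) j (by omega) hie
    omega
  push Not at hfe
  -- With `f` unused, a second vertex `y` of `f` either closes a cycle or makes the path too long.
  obtain ⟨y, hy, hyw⟩ := Finset.exists_mem_ne (hcard f hf) w
  by_cases hyon : ∃ j ≤ s + 1, v' j = y
  · obtain ⟨j, hj, rfl⟩ := hyon
    have hjs : j ≠ s + 1 := by rintro rfl; exact hyw hv'e
    obtain ⟨i, hi, hie⟩ := hac _ _ _ f (by omega) (hp.drop hj) hf (by simpa using hy)
      (by simpa only [Nat.sub_add_cancel hj, hv'e] using hwf)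
    exact hfe _ (by omega) hie
  push Not at hyon
  have := hmax _ _ _ (hp.snoc hf (by rwa [hv'e]) hy hyon hfe)
  omega

end PathIn

/-- `E` is the edge set of a `k`-uniform hypertree with vertex set `U`. -/
structure TreeOn (k : ℕ) (E : Finset (Finset V)) (U : Finset V) : Prop where
  nonempty : U.Nonempty
  subset : ∀ e ∈ E, e ⊆ U
  card_eq : ∀ e ∈ E, e.card = k
  connected : ∀ u ∈ U, ∀ w ∈ U, Relation.ReflTransGen (Adj E) u w
  acyclic : Acyclic E

/-- The edge `e` meets other edges of `E` only in its vertex `u`. -/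
def PendantAt (E : Finset (Finset V)) (e : Finset V) (u : V) : Prop :=
  e ∈ E ∧ u ∈ e ∧ ∀ v ∈ e, v ≠ u → ∀ f ∈ E, v ∈ f → f = e

namespace TreeOn

variable {k : ℕ} {E : Finset (Finset V)} {U : Finset V}

theorem eq_singleton (h : TreeOn k ∅ U) : ∃ r, U = {r} := by
  obtain ⟨r, hr⟩ := h.nonempty
  refine ⟨r, Finset.eq_singleton_iff_unique_mem.2 ⟨hr, fun w hw => ?_⟩⟩
  rcases Relation.ReflTransGen.cases_head (h.connected r hr w hw) with h1 | ⟨_, ⟨e, he, _⟩, _⟩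
  · exact h1.symm
  · simp at he

variable [DecidableEq V]

/-- Removing a pendant edge together with its vertices of degree one leaves a hypertree. -/
theorem erase_pendant (h : TreeOn k E U) {e : Finset V} {u : V} (hp : PendantAt E e u) :
    TreeOn k (E.erase e) (U \ e.erase u) where
  nonempty := ⟨u, by simp [h.subset e hp.1 hp.2.1]⟩
  subset f hf x hx := by
    have hf' := Finset.mem_erase.1 hf
    refine Finset.mem_sdiff.2 ⟨h.subset f hf'.2 hx, fun hxe => ?_⟩
    have := Finset.mem_erase.1 hxe
    exact hf'.1 (hp.2.2 x this.2 this.1 f hf'.2 hx)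
  card_eq f hf := h.card_eq f (Finset.mem_of_mem_erase hf)
  acyclic := h.acyclic.mono (Finset.erase_subset _ _)
  connected := by
    intro x hx y hy
    have hx' := Finset.mem_sdiff.1 hx
    have hy' := Finset.mem_sdiff.1 hy
    -- The retraction that sends the removed vertices to `u` carries walks to walks: `e` collapses
    -- to `u`, and every other edge is fixed pointwise.
    let π : V → V := fun z => if z ∈ e.erase u then u else z
    have hπx : π x = x := if_neg hx'.2
    have hπy : π y = y := if_neg hy'.2
    rw [← hπx, ← hπy]
    refine Relation.ReflTransGen.lift' π ?_ _ _ (h.connected x hx'.1 y hy'.1)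
    rintro z w ⟨f, hf, hz, hw⟩
    by_cases hfe : f = e
    · subst hfe
      have hall : ∀ z ∈ f, π z = u := by
        intro z hz
        by_cases hzu : z = u
        · simp [π, hzu]
        · simp [π, hzu, hz]
      change Relation.ReflTransGen _ (π z) (π w)
      rw [hall z hz, hall w hw]
    · have hall : ∀ z ∈ f, π z = z := by
        intro z hz
        refine if_neg fun hze => hfe ?_
        have := Finset.mem_erase.1 hze
        exact hp.2.2 z this.2 this.1 f hf hz
      change Relation.ReflTransGen _ (π z) (π w)
      rw [hall z hz, hall w hw]
      exact Relation.ReflTransGen.single ⟨f, Finset.mem_erase.2 ⟨hfe, hf⟩, hz, hw⟩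

theorem exists_two_edges (h : TreeOn k E U) (hk : 2 ≤ k) (hE : 2 ≤ E.card) :
    ∃ e ∈ E, ∃ f ∈ E, e ≠ f ∧ ∃ w, w ∈ e ∧ w ∈ f := by
  obtain ⟨e, he, f, hf, hef⟩ := Finset.one_lt_card.1 hE
  by_contra hcon
  push Not at hcon
  obtain ⟨x, hx⟩ : e.Nonempty := Finset.card_pos.1 (by have := h.card_eq e he; omega)
  obtain ⟨y, hy⟩ : f.Nonempty := Finset.card_pos.1 (by have := h.card_eq f hf; omega)
  have hall : ∀ z, Relation.ReflTransGen (Adj E) x z → z ∈ e := by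
    intro z hz
    induction hz with
    | refl => exact hx
    | tail _ hadj ih =>
      obtain ⟨g, hg, h1, h2⟩ := hadj
      by_cases hge : e = g
      · exact hge ▸ h2
      · exact absurd h1 (hcon e he g hg hge _ ih)
  exact hcon e he f hf hef y (hall y (h.connected x (h.subset e he hx) y (h.subset f hf hy))) hy

theorem exists_path_two (h : TreeOn k E U) (hk : 2 ≤ k) (hE : 2 ≤ E.card) :
    ∃ v e, PathIn E 2 v e := by
  obtain ⟨e, he, f, hf, hef, w, hwe, hwf⟩ := h.exists_two_edges hk hE
  obtain ⟨x, hx, hxw⟩ := Finset.exists_mem_ne (show 1 < e.card by have := h.card_eq e he; omega) w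
  obtain ⟨y, hy, hyw⟩ := Finset.exists_mem_ne (show 1 < f.card by have := h.card_eq f hf; omega) w
  have h1 : PathIn E 1 (fun i => if i = 0 then x else w) (fun _ => e) := by
    refine ⟨fun _ _ => he, fun i hi => ?_, fun i hi => ?_, fun i hi j hj hij => ?_,
      fun i hi j hj _ => by omega⟩
    · simp [show i = 0 by omega, hx]
    · simpa using hwe
    · split_ifs at hij with h1 h2 h2
      · omega
      · exact absurd hij hxw
      · exact absurd hij.symm hxw
      · omega
  have hxf : x ∉ f := fun hxf => by
    obtain ⟨i, _, hi⟩ := h.acyclic 1 _ _ f le_rfl h1 hf (by simpa using hxf) (by simpa using hwf)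
    exact hef hi
  refine ⟨_, _, h1.snoc hf (by simpa using hwf) hy (fun i hi => ?_) (fun i _ => hef)⟩
  split_ifs
  · rintro rfl; exact hxf hy
  · exact hyw.symm

/-- A hypertree with at least two edges has two pendant edges. -/
theorem exists_two_pendants (h : TreeOn k E U) (hk : 2 ≤ k) (hE : 2 ≤ E.card) :
    ∃ e₁ u₁ e₂ u₂, e₁ ≠ e₂ ∧ PendantAt E e₁ u₁ ∧ PendantAt E e₂ u₂ ∧
      (∃ f ∈ E, f ≠ e₁ ∧ u₁ ∈ f) ∧ ∃ f ∈ E, f ≠ e₂ ∧ u₂ ∈ f := by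
  classical
  have hcard : ∀ f ∈ E, 2 ≤ f.card := fun f hf => by rw [h.card_eq f hf]; exact hk
  let P : ℕ → Prop := fun s => ∃ v e, PathIn E s v e
  have hP2 : P 2 := h.exists_path_two hk hE
  have hmax : ∀ s' v' e', PathIn E s' v' e' → s' ≤ Nat.findGreatest P E.card :=
    fun s' v' e' hp => Nat.le_findGreatest hp.length_le ⟨v', e', hp⟩
  -- The two end edges of a longest path are pendant. Length at least two makes them distinct and
  -- puts another edge at each attaching vertex.
  obtain ⟨v, e, hp⟩ := Nat.findGreatest_spec (P := P) hE hP2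
  obtain ⟨v2, e2, hp2⟩ := hP2
  have h2 := hmax 2 v2 e2 hp2
  obtain ⟨s, hs⟩ : ∃ s, Nat.findGreatest P E.card = s + 2 := ⟨_, (Nat.sub_add_cancel h2).symm⟩
  rw [hs] at hp hmax
  refine ⟨e (s + 1), v (s + 1), e 0, v 1, ?_, ⟨hp.mem _ (by omega), hp.left _ (by omega), ?_⟩,
    ⟨hp.mem _ (by omega), hp.right 0 (by omega), ?_⟩,
    ⟨e s, hp.mem _ (by omega), ?_, hp.right s (by omega)⟩,
    ⟨e 1, hp.mem _ (by omega), ?_, hp.left 1 (by omega)⟩⟩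
  · intro he
    have := hp.injE _ (by omega) _ (by omega) he
    omega
  · intro w hw hwv f hf hwf
    exact hp.last_edge_pendant h.acyclic hcard hmax hw hwv hf hwf
  · intro w hw hwv f hf hwf
    have := hp.reverse.last_edge_pendant (s := s + 1) h.acyclic hcard hmax (w := w) (f := f)
      (by simpa using hw) (by simpa using hwv) hf hwf
    simpa using this
  · intro he
    have := hp.injE _ (by omega) _ (by omega) he
    omega
  · intro he
    have := hp.injE _ (by omega) _ (by omega) he
    omega

end TreeOn

/-! ### Monotonicity and concavity of the loads -/

/-- The load that a pendant path of length `s` puts on its first vertex, at the eigenvalue `lam`. -/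
noncomputable def pathLoad (a C lam : ℝ) : ℕ → ℝ
  | 0 => 0
  | s + 1 => a + C / (lam - a - pathLoad a C lam s)

/-- The recursion map `y ↦ a + C / (lam - a - y)` is increasing below `lam - a`, and the first step
goes up from zero. -/
theorem pathLoad_lt_succ {a C lam : ℝ} (ha : 0 ≤ a) (hC : 0 < C) {n : ℕ}
    (h : ∀ j < n, pathLoad a C lam j < lam - a) :
    ∀ j < n, pathLoad a C lam j < pathLoad a C lam (j + 1) := by
  intro j
  induction j with
  | zero =>
    intro hj
    have h0 := h 0 hj
    have : 0 < C / (lam - a - pathLoad a C lam 0) := div_pos hC (by linarith)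
    rw [pathLoad]
    simp only [pathLoad] at this ⊢
    linarith
  | succ j ih =>
    intro hj
    have h1 := ih (by omega)
    have h2 := h (j + 1) hj
    have e2 : pathLoad a C lam (j + 1 + 1) = a + C / (lam - a - pathLoad a C lam (j + 1)) := rfl
    have e1 : pathLoad a C lam (j + 1) = a + C / (lam - a - pathLoad a C lam j) := rfl
    have : C / (lam - a - pathLoad a C lam j) < C / (lam - a - pathLoad a C lam (j + 1)) :=
      div_lt_div_of_pos_left hC (by linarith) (by linarith)
    rw [e2]
    linarith

theorem pathLoad_mono {a C lam : ℝ} (ha : 0 ≤ a) (hC : 0 < C) {n : ℕ}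
    (h : ∀ j < n, pathLoad a C lam j < lam - a) {i j : ℕ} (hij : i ≤ j) (hj : j ≤ n) :
    pathLoad a C lam i ≤ pathLoad a C lam j := by
  induction j, hij using Nat.le_induction with
  | base => exact le_rfl
  | succ j _ ih => exact (ih (by omega)).trans (pathLoad_lt_succ ha hC h j (by omega)).le

theorem pathLoad_gt {a C lam : ℝ} (hC : 0 < C) {s : ℕ} (h : pathLoad a C lam s < lam - a) :
    a < pathLoad a C lam (s + 1) := by
  rw [pathLoad]
  have : 0 < C / (lam - a - pathLoad a C lam s) := div_pos hC (by linarith)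
  linarith

/-- The increments of the loads satisfy a recursion with the factor
`(σ (s + 1) - a) / (lam - a - σ (s + 1))`. -/
theorem pathLoad_increment {a C lam : ℝ} {s : ℕ} (h0 : pathLoad a C lam s < lam - a)
    (h1 : pathLoad a C lam (s + 1) < lam - a) :
    (pathLoad a C lam (s + 2) - pathLoad a C lam (s + 1)) * (lam - a - pathLoad a C lam (s + 1)) =
      (pathLoad a C lam (s + 1) - pathLoad a C lam s) * (pathLoad a C lam (s + 1) - a) := by
  have e2 : pathLoad a C lam (s + 2) = a + C / (lam - a - pathLoad a C lam (s + 1)) := rfl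
  have e1 : pathLoad a C lam (s + 1) = a + C / (lam - a - pathLoad a C lam s) := rfl
  have h1' : lam - a - pathLoad a C lam (s + 1) ≠ 0 := by linarith
  have h0' : lam - a - pathLoad a C lam s ≠ 0 := by linarith
  -- The recursion with cleared denominators, at two consecutive places; equating the two values of
  -- `C` gives the identity.
  have k2 : (pathLoad a C lam (s + 2) - a) * (lam - a - pathLoad a C lam (s + 1)) = C := by
    rw [e2]; field_simp; ring
  have k1 : (pathLoad a C lam (s + 1) - a) * (lam - a - pathLoad a C lam s) = C := by
    rw [e1]; field_simp; ring
  linear_combination k2 - k1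

/-- The factor `(σ - a) / (lam - a - σ)` between increments is at most one exactly when `2 σ ≤ lam`.
-/
theorem pathLoad_concave {a C lam : ℝ} (ha : 0 ≤ a) (hC : 0 < C) {s : ℕ}
    (h : ∀ j ≤ s + 1, pathLoad a C lam j < lam - a) (h2 : 2 * pathLoad a C lam (s + 1) ≤ lam) :
    pathLoad a C lam (s + 2) - pathLoad a C lam (s + 1) ≤
      pathLoad a C lam (s + 1) - pathLoad a C lam s := by
  have hi := pathLoad_increment (h s (by omega)) (h (s + 1) le_rfl)
  have hm := pathLoad_lt_succ ha hC (n := s + 1) (fun j hj => h j (by omega)) s (by omega)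
  have h1 := h (s + 1) le_rfl
  refine le_of_mul_le_mul_right (hi.trans_le ?_) (sub_pos.2 h1)
  exact mul_le_mul_of_nonneg_left (by linarith) (by linarith)

theorem pathLoad_strictConcave {a C lam : ℝ} (ha : 0 ≤ a) (hC : 0 < C) {s : ℕ}
    (h : ∀ j ≤ s + 1, pathLoad a C lam j < lam - a) (h2 : 2 * pathLoad a C lam (s + 1) < lam) :
    pathLoad a C lam (s + 2) - pathLoad a C lam (s + 1) <
      pathLoad a C lam (s + 1) - pathLoad a C lam s := by
  have hi := pathLoad_increment (h s (by omega)) (h (s + 1) le_rfl)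
  have hm := pathLoad_lt_succ ha hC (n := s + 1) (fun j hj => h j (by omega)) s (by omega)
  have h1 := h (s + 1) le_rfl
  refine lt_of_mul_lt_mul_right (hi.trans_lt ?_) (sub_pos.2 h1).le
  exact mul_lt_mul_of_pos_left (by linarith) (by linarith)

/-- The supporting line of a discretely concave sequence. -/
theorem le_supporting_line {f : ℕ → ℝ} {n L : ℕ} (hL : L < n)
    (h : ∀ j, j + 2 ≤ n → f (j + 2) - f (j + 1) ≤ f (j + 1) - f j) {l : ℕ} (hl : l ≤ n) :
    f l ≤ f L + (f (L + 1) - f L) * ((l : ℝ) - L) := by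
  have hanti : ∀ i j, i ≤ j → j < n → f (j + 1) - f j ≤ f (i + 1) - f i := by
    intro i j hij
    induction j, hij using Nat.le_induction with
    | base => exact fun _ => le_rfl
    | succ j _ ih => exact fun hj => (h j (by omega)).trans (ih (by omega))
  rcases le_total L l with hLl | hLl
  · induction l, hLl using Nat.le_induction with
    | base => simp
    | succ j hj ih =>
      have h1 := ih (by omega)
      have h2 := hanti L j hj (by omega)
      push_cast
      linarith
  · obtain ⟨r, hr⟩ := Nat.exists_eq_add_of_le hLl
    induction r generalizing l with
    | zero => rw [add_zero] at hr; simp [hr]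
    | succ r ih =>
      have h1 := ih (l := l + 1) (by omega) (by omega) (by omega)
      have h2 := hanti l L (by omega) hL
      push_cast at h1
      linarith

/-- What the comparison of hypertrees uses about the loads `σ` of pendant paths: `lam` is the
total load of `t` paths of almost equal lengths with sum `m`, and `δ` is the slope of a supporting
line at these lengths. -/
structure LegBound (a C lam : ℝ) (m t : ℕ) (σ : ℕ → ℝ) (δ : ℝ) : Prop where
  zero : σ 0 = 0
  succ : ∀ s, σ (s + 1) = a + C / (lam - a - σ s)
  gt : ∀ s, 2 * s ≤ m → a < σ (s + 1)
  two_mul_lt : 2 * a < lam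
  two_mul_le : ∀ s, 2 * s ≤ m → 2 * σ s ≤ lam
  tangent : ∀ s, 2 * s ≤ m + 1 → σ s ≤ σ (m / t) + δ * ((s : ℝ) - (m / t : ℕ))
  tangent_eq : ∀ s, 2 * s ≤ m + 1 → σ s = σ (m / t) + δ * ((s : ℝ) - (m / t : ℕ)) →
    s ≤ m / t + 1 ∧ (s < m / t → 2 * (m / t) = m)
  total : t * σ (m / t) + δ * ((m : ℝ) - t * (m / t : ℕ)) = lam
  slope_pos : 0 < δ
  slope_mul_le : δ * (m / t : ℕ) ≤ σ (m / t)

theorem sum_balancedLength (m t : ℕ) (ht : 0 < t) (f : ℕ → ℝ) :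
    ∑ i, f (Hypergraph.balancedLength m t i) =
      t * f (m / t) + (f (m / t + 1) - f (m / t)) * ((m : ℝ) - t * (m / t : ℕ)) := by
  have h1 : ∀ i : Fin t, f (Hypergraph.balancedLength m t i) =
      f (m / t) + if (i : ℕ) < m % t then f (m / t + 1) - f (m / t) else 0 := by
    intro i
    unfold Hypergraph.balancedLength
    split_ifs <;> simp
  have h2 : ((m % t : ℕ) : ℝ) = (m : ℝ) - t * (m / t : ℕ) := by
    have : (m : ℝ) = ((t * (m / t) + m % t : ℕ) : ℝ) := by rw [Nat.div_add_mod]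
    push_cast at this
    linarith
  have h3 : (Finset.univ.filter fun i : Fin t => (i : ℕ) < m % t).card = m % t := by
    rw [Fin.card_filter_val_lt, min_eq_right (Nat.mod_lt _ ht).le]
  simp only [h1, Finset.sum_add_distrib, Finset.sum_const, Finset.card_univ, Fintype.card_fin,
    nsmul_eq_mul, ← Finset.sum_filter, h3]
  rw [h2]
  ring

/-- Concavity needs `2 σ s ≤ lam`, which is known at first only for `s ≤ m / t`. The supporting line
at `m / t`, combined with the fact that the balanced loads sum to `lam`, carries the bound upwards
one length at a time to all `s ≤ m / 2`. -/
theorem pathLoad_legBound {a C lam : ℝ} (ha : 0 ≤ a) (hC : 0 < C) {m t : ℕ} (ht : 2 ≤ t)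
    (htm : t ≤ m)
    (hlt : ∀ i : Fin t, ∀ s < Hypergraph.balancedLength m t i, pathLoad a C lam s < lam - a)
    (hsum : ∑ i : Fin t, pathLoad a C lam (Hypergraph.balancedLength m t i) = lam) :
    LegBound a C lam m t (pathLoad a C lam)
      (pathLoad a C lam (m / t + 1) - pathLoad a C lam (m / t)) := by
  set σ := pathLoad a C lam with hσ
  set L := m / t with hL
  have hL1 : 1 ≤ L := (Nat.one_le_div_iff (by omega)).2 htm
  have htL : t * L ≤ m := Nat.mul_div_le m t
  have h2L : 2 * L ≤ m := (Nat.mul_le_mul_right L ht).trans htL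
  have htot := sum_balancedLength m t (by omega) σ
  rw [hsum] at htot
  have hltL : ∀ s < L, σ s < lam - a := by
    intro s hs
    refine hlt ⟨0, by omega⟩ s ?_
    unfold Hypergraph.balancedLength
    split_ifs <;> omega
  have hσL : a < σ L := by
    obtain ⟨s, hs⟩ : ∃ s, L = s + 1 := ⟨L - 1, by omega⟩
    rw [hs]
    exact pathLoad_gt hC (hltL s (by omega))
  have hmR : (0 : ℝ) ≤ (m : ℝ) - t * (L : ℕ) := by
    rw [sub_nonneg]; exact_mod_cast htL
  have htR : (2 : ℝ) ≤ t := by exact_mod_cast ht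
  have hσL0 : 0 < σ L := by linarith
  -- Replacing the lengths `L + 1` by `L` does not increase the total load; when `m % t = 0` no such
  -- lengths occur.
  have htσ : t * σ L ≤ lam := by
    rcases Nat.eq_zero_or_pos (m % t) with h0 | h0
    · have : (m : ℝ) - t * (L : ℕ) = 0 := by
        have := Nat.div_add_mod m t
        rw [h0, add_zero] at this
        rw [sub_eq_zero]; exact_mod_cast this.symm
      rw [this] at htot
      linarith
    · have hle : σ L ≤ σ (L + 1) := by
        have hbl : Hypergraph.balancedLength m t ⟨0, by omega⟩ = L + 1 := by
          simp [Hypergraph.balancedLength, h0, hL]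
        have := hlt ⟨0, by omega⟩
        rw [hbl] at this
        exact (pathLoad_lt_succ ha hC this L (by omega)).le
      have := mul_nonneg (sub_nonneg.2 hle) hmR
      linarith
  have h2σL : 2 * σ L ≤ lam := by nlinarith
  have h2a : 2 * a < lam := by linarith
  have hhalf : ∀ s, 2 * σ s ≤ lam → σ s < lam - a := fun s hs => by linarith
  have hleL : ∀ s ≤ L, σ s < lam - a := by
    intro s hs
    rcases hs.lt_or_eq with h | rfl
    · exact hltL s h
    · exact hhalf _ h2σL
  set δ := σ (L + 1) - σ L with hδ
  have hδ0 : 0 < δ :=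
    sub_pos.2 (pathLoad_lt_succ ha hC (n := L + 1) (fun j hj => hleL j (by omega)) L (by omega))
  have h2leL : ∀ s ≤ L, 2 * σ s ≤ lam := by
    intro s hs
    have := pathLoad_mono ha hC hltL hs le_rfl
    linarith
  have hline : ∀ n, L < n → (∀ s < n, 2 * σ s ≤ lam) → ∀ l ≤ n, σ l ≤ σ L + δ * ((l : ℝ) - L) := by
    intro n hn h l hl
    refine le_supporting_line hn (fun j hj => ?_) hl
    exact pathLoad_concave ha hC (fun i hi => hhalf i (h i (by omega))) (h (j + 1) (by omega))
  -- The supporting line, evaluated at length zero, lies above `σ 0 = 0`.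
  have hslope : δ * (L : ℕ) ≤ σ L := by
    have := hline (L + 1) (by omega) (fun s hs => h2leL s (by omega)) 0 (by omega)
    have h0 : σ 0 = 0 := rfl
    rw [h0] at this
    push_cast at this
    linarith
  -- Twice the line bound falls short of the total `t * σ L + δ * (m - t * L) = lam` by `(t - 2) *
  -- (σ L - δ * L)`, which is nonnegative by `hslope`.
  have hcombine : ∀ s, σ s ≤ σ L + δ * ((s : ℝ) - L) → 2 * σ s + δ * ((m : ℝ) - 2 * s) ≤ lam := by
    intro s hs
    nlinarith [mul_nonneg (sub_nonneg.2 htR) (sub_nonneg.2 hslope)]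
  have h2le : ∀ s, 2 * s ≤ m → 2 * σ s ≤ lam := by
    intro s
    induction s using Nat.strong_induction_on with
    | _ s ih =>
      intro hs
      rcases le_or_gt s L with h | h
      · exact h2leL s h
      · have h1 := hcombine s (hline s h (fun j hj => ih j hj (by omega)) s le_rfl)
        have h2 : (0 : ℝ) ≤ (m : ℝ) - 2 * s := by rw [sub_nonneg]; exact_mod_cast hs
        have := mul_nonneg hδ0.le h2
        linarith
  -- Concavity up to `s` uses `2 σ j ≤ lam` only for `j < s`, so the line reaches one length beyond
  -- `m / 2`.
  have htan : ∀ s, 2 * s ≤ m + 2 → σ s ≤ σ L + δ * ((s : ℝ) - L) := by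
    intro s hs
    refine hline (max s (L + 1)) (by omega) (fun j hj => h2le j (by omega)) s (by omega)
  have h2lt : ∀ s, 2 * s < m → 2 * σ s < lam := by
    intro s hs
    have h1 := hcombine s (htan s (by omega))
    have h2 : (0 : ℝ) < (m : ℝ) - 2 * s := by rw [sub_pos]; exact_mod_cast hs
    have := mul_pos hδ0 h2
    linarith
  have hA : ∀ s, 2 * s ≤ m → σ s < lam - a := fun s hs => hhalf s (h2le s hs)
  refine ⟨rfl, fun s => rfl, fun s hs => pathLoad_gt hC (hA s hs), h2a, h2le,
    fun s hs => htan s (by omega), fun s hs heq => ⟨?_, fun hsL => ?_⟩, htot.symm, hδ0, hslope⟩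
  -- For `s ≥ L + 2` the increment after `L + 1` is strictly below `δ`, so the supporting line of
  -- slope `σ (L + 2) - σ (L + 1)` puts `σ s` strictly below the line at `L`.
  · by_contra hcon
    have hc1 := pathLoad_strictConcave ha hC (s := L) (fun j hj => hA j (by omega))
      (h2lt (L + 1) (by omega))
    obtain ⟨r, rfl⟩ : ∃ r, s = L + 1 + 1 + r := ⟨s - (L + 2), by omega⟩
    have h3 := le_supporting_line (f := σ) (n := L + 2 + r) (L := L + 1) (by omega)
      (fun j hj => pathLoad_concave ha hC (fun i hi => hA i (by omega)) (h2le _ (by omega)))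
      (l := L + 1 + 1 + r) (by omega)
    rw [heq] at h3
    have hr : (0 : ℝ) ≤ r := Nat.cast_nonneg r
    change σ (L + 1 + 1) - σ (L + 1) < δ at hc1
    push_cast at h3
    nlinarith
  -- For `s < L` the increment before `L` is strictly above `δ`, provided `2 σ L < lam`; this is
  -- available when `2 * L < m`, and `2 * L = m` is the exception allowed by `tangent_eq`.
  · by_contra hcon
    obtain ⟨r, hr⟩ : ∃ r, L = r + 1 := ⟨L - 1, by omega⟩
    have hc1 := pathLoad_strictConcave ha hC (s := r) (fun j hj => hA j (by omega))
      (h2lt (r + 1) (by omega))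
    have h3 := le_supporting_line (f := σ) (n := L) (L := r) (by omega)
      (fun j hj => pathLoad_concave ha hC (fun i hi => hA i (by omega)) (h2le _ (by omega)))
      (l := s) (by omega)
    rw [heq] at h3
    have hrs : (s : ℝ) ≤ r := by exact_mod_cast (by omega : s ≤ r)
    change σ (r + 1 + 1) - σ (r + 1) < σ (r + 1) - σ r at hc1
    rw [← hr] at hc1 h3
    change δ < _ at hc1
    have : (L : ℝ) = r + 1 := by exact_mod_cast hr
    rw [this] at h3
    nlinarith

/-! ### Comparing the total load of a family of legs with `lam` -/

namespace LegBound

variable {a C lam δ : ℝ} {m t : ℕ} {σ : ℕ → ℝ}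

theorem lt (h : LegBound a C lam m t σ δ) {s : ℕ} (hs : 2 * s ≤ m) : σ s < lam - a := by
  have := h.two_mul_le s hs
  have := h.two_mul_lt
  linarith

theorem nonneg (h : LegBound a C lam m t σ δ) (ha : 0 ≤ a) {s : ℕ} (hs : 2 * s ≤ m + 1) :
    0 ≤ σ s := by
  cases s with
  | zero => exact h.zero.ge
  | succ s => exact ha.trans (h.gt s (by omega)).le

theorem pos (h : LegBound a C lam m t σ δ) (ha : 0 ≤ a) {s : ℕ} (h0 : s ≠ 0)
    (hs : 2 * s ≤ m + 1) : 0 < σ s := by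
  obtain ⟨r, rfl⟩ := Nat.exists_eq_succ_of_ne_zero h0
  exact ha.trans_lt (h.gt r (by omega))

theorem sum_le_line (h : LegBound a C lam m t σ δ) {X : Multiset ℕ}
    (hX : ∀ s ∈ X, 2 * s ≤ m + 1) :
    (X.map σ).sum ≤ X.card * σ (m / t) + δ * ((X.sum : ℝ) - X.card * (m / t : ℕ)) := by
  induction X using Multiset.induction_on with
  | empty => simp
  | cons s X ih =>
    have h1 := h.tangent s (hX s (Multiset.mem_cons_self s X))
    have h2 := ih fun r hr => hX r (Multiset.mem_cons_of_mem hr)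
    simp only [Multiset.map_cons, Multiset.sum_cons, Multiset.card_cons, Nat.cast_add,
      Nat.cast_one]
    linarith

/-- The line is nonnegative at length zero (`slope_mul_le`), so missing legs can be filled up by
legs of length zero without lowering the bound. With `t` legs, `total` gives equality. -/
theorem line_le (h : LegBound a C lam m t σ δ) {c w : ℕ} (hc : c ≤ t) :
    c * σ (m / t) + δ * ((w : ℝ) - c * (m / t : ℕ)) ≤ lam + δ * ((w : ℝ) - m) := by
  have h1 : (c : ℝ) ≤ t := by exact_mod_cast hc
  have h2 := mul_le_mul_of_nonneg_left h.slope_mul_le (sub_nonneg.2 h1)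
  have h3 := h.total
  linarith

theorem sum_le (h : LegBound a C lam m t σ δ) {X : Multiset ℕ} (hX : ∀ s ∈ X, 2 * s ≤ m + 1)
    (hc : X.card ≤ t) (hs : X.sum ≤ m) : (X.map σ).sum ≤ lam := by
  have h1 := h.sum_le_line hX
  have h2 := h.line_le (w := X.sum) hc
  have h3 : (X.sum : ℝ) - m ≤ 0 := by rw [sub_nonpos]; exact_mod_cast hs
  have h4 := mul_nonpos_of_nonneg_of_nonpos h.slope_pos.le h3
  linarith

theorem sum_lt (h : LegBound a C lam m t σ δ) {X : Multiset ℕ} (hX : ∀ s ∈ X, 2 * s ≤ m + 1)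
    (hc : X.card ≤ t) (hs : X.sum < m) : (X.map σ).sum < lam := by
  have h1 := h.sum_le_line hX
  have h2 := h.line_le (w := X.sum) hc
  have h3 : (X.sum : ℝ) - m < 0 := by rw [sub_neg]; exact_mod_cast hs
  have h4 := mul_neg_of_pos_of_neg h.slope_pos h3
  linarith

/-- Equality of the sums puts each length on the supporting line, and `tangent_eq` then leaves
lengths below `m / t` possible only if `2 * (m / t) = m`. In that case `t = 2` and no leg exceeds `m
/ 2`, so two legs of total length `m` are both equal to `m / 2`. -/
theorem mem_of_sum_eq (h : LegBound a C lam m t σ δ) {X : Multiset ℕ}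
    (hX : ∀ s ∈ X, 2 * s ≤ m + 1) (hc : X.card = t) (hs : X.sum = m) (ht : 2 ≤ t)
    (heq : (X.map σ).sum = lam) : ∀ s ∈ X, s = m / t ∨ s = m / t + 1 := by
  have key : ∀ s ∈ X, s ≤ m / t + 1 ∧ (s < m / t → 2 * (m / t) = m) := by
    intro s hsX
    obtain ⟨Y, rfl⟩ := Multiset.exists_cons_of_mem hsX
    refine h.tangent_eq s (hX s hsX) (le_antisymm (h.tangent s (hX s hsX)) ?_)
    have h1 := h.sum_le_line (X := Y) fun r hr => hX r (Multiset.mem_cons_of_mem hr)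
    have h2 := h.line_le (c := (s ::ₘ Y).card) (w := (s ::ₘ Y).sum) hc.le
    simp only [Multiset.map_cons, Multiset.sum_cons, Multiset.card_cons] at heq hc hs h2
    have hs' : ((s + Y.sum : ℕ) : ℝ) = m := by exact_mod_cast hs
    rw [hs'] at h2
    simp only [Nat.cast_add, Nat.cast_one] at hs' h2
    have h3 := h.total
    have hc' : ((Y.card + 1 : ℕ) : ℝ) = t := by exact_mod_cast hc
    push_cast at hc'
    have h4 : (t : ℝ) * σ (m / t) = Y.card * σ (m / t) + σ (m / t) := by rw [← hc']; ring
    have h5 : δ * ((m : ℝ) - t * (m / t : ℕ)) = δ * ((Y.sum : ℝ) - Y.card * (m / t : ℕ))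
        + δ * ((s : ℝ) - (m / t : ℕ)) := by rw [← hc', ← hs']; ring
    linarith
  intro s hsX
  obtain ⟨h1, h2⟩ := key s hsX
  by_contra hcon
  push Not at hcon
  have hlt : s < m / t := by omega
  have hm := h2 hlt
  have htL : t * (m / t) ≤ m := Nat.mul_div_le m t
  have ht2 : t = 2 := by
    by_contra ht2
    have : 3 * (m / t) ≤ t * (m / t) := Nat.mul_le_mul_right _ (by omega)
    omega
  have hle : ∀ r ∈ X, r ≤ m / t := fun r hr => by have := hX r hr; omega
  obtain ⟨Y, rfl⟩ := Multiset.exists_cons_of_mem hsX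
  have hY : Y.sum ≤ Y.card • (m / t) :=
    Multiset.sum_le_card_nsmul Y (m / t) fun r hr => hle r (Multiset.mem_cons_of_mem hr)
  simp only [Multiset.sum_cons, Multiset.card_cons] at hc hs
  rw [show Y.card = 1 by omega, one_smul] at hY
  omega

/-- Lengthening one leg costs at least as much as the load through an edge. -/
theorem load_step (h : LegBound a C lam m t σ δ) {s : ℕ} (hs : 2 * s ≤ m) {z : ℝ}
    (hz : σ s ≤ z) (hle : σ (s + 1) + z ≤ lam) :
    z < lam - a ∧ a + C / (lam - a - z) ≤ z - σ s + σ (s + 1) := by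
  have h1 := h.gt s hs
  have h2 := h.lt hs
  have hz1 : z < lam - a := by linarith
  refine ⟨hz1, ?_⟩
  have k1 : (σ (s + 1) - a) * (lam - a - σ s) = C := by
    have : lam - a - σ s ≠ 0 := by linarith
    rw [h.succ s]; field_simp; ring
  rw [← le_sub_iff_add_le', div_le_iff₀ (by linarith), ← k1]
  -- After clearing denominators and inserting `k1`, the difference of the two sides is exactly `(z
  -- - σ s) * (lam - σ (s + 1) - z)`.
  nlinarith [mul_nonneg (sub_nonneg.2 hz) (sub_nonneg.2 hle)]

theorem load_step_lt (h : LegBound a C lam m t σ δ) {s : ℕ} (hs : 2 * s ≤ m) {z : ℝ}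
    (hz : σ s < z) (hlt : σ (s + 1) + z < lam) :
    a + C / (lam - a - z) < z - σ s + σ (s + 1) := by
  have h1 := h.gt s hs
  have h2 := h.lt hs
  have hz1 : z < lam - a := by linarith
  have k1 : (σ (s + 1) - a) * (lam - a - σ s) = C := by
    have : lam - a - σ s ≠ 0 := by linarith
    rw [h.succ s]; field_simp; ring
  rw [← lt_sub_iff_add_lt', div_lt_iff₀ (by linarith), ← k1]
  nlinarith [mul_pos (sub_pos.2 hz) (sub_pos.2 hlt)]

end LegBound

/-- A multiset with elements `L` and `L + 1` is determined by its size and its sum. -/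
theorem eq_of_card_eq_of_sum_eq {X Y : Multiset ℕ} {L : ℕ} (hX : ∀ s ∈ X, s = L ∨ s = L + 1)
    (hY : ∀ s ∈ Y, s = L ∨ s = L + 1) (hc : X.card = Y.card) (hs : X.sum = Y.sum) : X = Y := by
  have key : ∀ Z : Multiset ℕ, (∀ s ∈ Z, s = L ∨ s = L + 1) →
      ∃ p q, Z = Multiset.replicate p L + Multiset.replicate q (L + 1) := by
    intro Z
    induction Z using Multiset.induction_on with
    | empty => exact fun _ => ⟨0, 0, by simp⟩
    | cons s Z ih =>
      intro h
      obtain ⟨p, q, rfl⟩ := ih fun r hr => h r (Multiset.mem_cons_of_mem hr)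
      rcases h s (Multiset.mem_cons_self s _) with rfl | rfl
      · exact ⟨p + 1, q, by simp [Multiset.replicate_succ]⟩
      · exact ⟨p, q + 1, by simp [Multiset.replicate_succ]⟩
  obtain ⟨p, q, rfl⟩ := key X hX
  obtain ⟨p', q', rfl⟩ := key Y hY
  simp only [Multiset.card_add, Multiset.card_replicate, Multiset.sum_add, Multiset.sum_replicate,
    smul_eq_mul] at hc hs
  have hq : q = q' := by
    have h1 : p * L + q * (L + 1) = (p + q) * L + q := by ring
    have h2 : p' * L + q' * (L + 1) = (p' + q') * L + q' := by ring
    rw [h1, h2, hc] at hs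
    omega
  have hp : p = p' := by omega
  rw [hp, hq]

/-! ### The inequality for a single edge -/

section EdgeStep

variable {V : Type*} [DecidableEq V]

/-- Weierstrass' product inequality: each induction step discards the nonnegative cross term `z v *
∑ z w`. The extra factor `A` on the right avoids the exponent `s.card - 1`. -/
theorem pow_mul_sub_sum_le {A : ℝ} {z : V → ℝ} (s : Finset V) (hA : 0 < A)
    (hz : ∀ v ∈ s, 0 ≤ z v) (hs : ∑ v ∈ s, z v < A) :
    A ^ s.card * (A - ∑ v ∈ s, z v) ≤ A * ∏ v ∈ s, (A - z v) := by
  induction s using Finset.induction_on with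
  | empty => simp
  | insert v s hv ih =>
    have hz' : ∀ w ∈ s, 0 ≤ z w := fun w hw => hz w (Finset.mem_insert_of_mem hw)
    have hzv := hz v (Finset.mem_insert_self v s)
    have hS := Finset.sum_nonneg hz'
    rw [Finset.sum_insert hv] at hs
    have h1 := ih hz' (by linarith)
    rw [Finset.sum_insert hv, Finset.prod_insert hv, Finset.card_insert_of_notMem hv, pow_succ]
    have h2 := mul_le_mul_of_nonneg_left h1 (show 0 ≤ A - z v by linarith)
    have h3 : 0 ≤ A ^ s.card * (z v * ∑ w ∈ s, z w) := by positivity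
    nlinarith

/-- With two positive entries the cross term discarded at `v` is positive. -/
theorem pow_mul_sub_sum_lt {A : ℝ} {z : V → ℝ} (s : Finset V) (hA : 0 < A)
    (hz : ∀ v ∈ s, 0 ≤ z v) (hs : ∑ v ∈ s, z v < A) {v w : V} (hv : v ∈ s) (hw : w ∈ s)
    (hvw : v ≠ w) (hv0 : 0 < z v) (hw0 : 0 < z w) :
    A ^ s.card * (A - ∑ v ∈ s, z v) < A * ∏ v ∈ s, (A - z v) := by
  obtain ⟨r, hr, rfl⟩ : ∃ r, v ∉ r ∧ insert v r = s :=
    ⟨s.erase v, Finset.notMem_erase v s, Finset.insert_erase hv⟩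
  have hz' : ∀ w ∈ r, 0 ≤ z w := fun w hw => hz w (Finset.mem_insert_of_mem hw)
  have hwr : w ∈ r := (Finset.mem_insert.1 hw).resolve_left hvw.symm
  have hS : 0 < ∑ w ∈ r, z w := Finset.sum_pos' hz' ⟨w, hwr, hw0⟩
  rw [Finset.sum_insert hr] at hs
  have h1 := pow_mul_sub_sum_le r hA hz' (by linarith)
  rw [Finset.sum_insert hr, Finset.prod_insert hr, Finset.card_insert_of_notMem hr, pow_succ]
  have h2 := mul_le_mul_of_nonneg_left h1 (show 0 ≤ A - z v by linarith)
  have h3 : 0 < A ^ r.card * (z v * ∑ w ∈ r, z w) := by positivity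
  nlinarith

variable {k : ℕ} {a lam : ℝ}

/-- AM-GM requires the product of the weights to be at least `(1 - a) ^ k`. For a given total load
the product is smallest when the whole load sits at one vertex, which is the situation on a path and
yields the constant in `hD`. Strictness comes from slack in `D` or from loads at two different
vertices. -/
theorem le_prod_edge_weights {A D : ℝ} {S : V → ℝ} {c : Finset V} (hc : c.card + 1 = k)
    (hk : 2 ≤ k) (ha1 : a < 1) (hA : 0 < A) (hS : ∀ v ∈ c, 0 ≤ S v) (hz : ∑ v ∈ c, S v < A)
    (hD : (1 - a) ^ k / A ^ (k - 2) / (A - ∑ v ∈ c, S v) ≤ D) :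
    (1 - a) ^ k ≤ D * ∏ v ∈ c, (A - S v) ∧
      (((1 - a) ^ k / A ^ (k - 2) / (A - ∑ v ∈ c, S v) < D ∨
        ∃ v ∈ c, ∃ w ∈ c, v ≠ w ∧ 0 < S v ∧ 0 < S w) →
        (1 - a) ^ k < D * ∏ v ∈ c, (A - S v)) := by
  have hz' : 0 < A - ∑ v ∈ c, S v := by linarith
  have hq : 0 < (1 - a) ^ k := pow_pos (by linarith) k
  have hAk : 0 < A ^ (k - 2) := pow_pos hA _
  have hD0 : 0 < D := lt_of_lt_of_le (by positivity) hD
  have hpow : A ^ c.card = A ^ (k - 2) * A := by rw [← pow_succ]; congr 1; omega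
  have h1 : A ^ (k - 2) * (A - ∑ v ∈ c, S v) ≤ ∏ v ∈ c, (A - S v) := by
    have := pow_mul_sub_sum_le c hA hS hz
    rw [hpow] at this
    refine le_of_mul_le_mul_left ?_ hA
    linarith
  have hprod : 0 < ∏ v ∈ c, (A - S v) := lt_of_lt_of_le (by positivity) h1
  have h2 : (1 - a) ^ k ≤ D * (A ^ (k - 2) * (A - ∑ v ∈ c, S v)) := by
    rwa [div_div, div_le_iff₀ (by positivity)] at hD
  refine ⟨h2.trans (mul_le_mul_of_nonneg_left h1 hD0.le), ?_⟩
  rintro (h | ⟨v, hv, w, hw, hvw, hv0, hw0⟩)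
  · rw [div_div, div_lt_iff₀ (by positivity)] at h
    exact h.trans_le (mul_le_mul_of_nonneg_left h1 hD0.le)
  · have := pow_mul_sub_sum_lt c hA hS hz hv hw hvw hv0 hw0
    rw [hpow] at this
    refine h2.trans_lt (mul_lt_mul_of_pos_left (lt_of_mul_lt_mul_left ?_ hA.le) hD0)
    linarith

variable {e : Finset V} {u : V} {S x : V → ℝ} {D : ℝ}

/-- The AM-GM weights are `D - a` at `u` and `lam - a - S v` elsewhere; the diagonal term of the
edge restores the `a`. -/
theorem sum_edge_weights (hu : u ∈ e) :
    a * ∑ v ∈ e, x v ^ k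
      + ∑ v ∈ e, (if v = u then D - a else lam - a - S v) * x v ^ k =
      ∑ v ∈ e.erase u, (lam - S v) * x v ^ k + D * x u ^ k := by
  rw [Finset.mul_sum, ← Finset.sum_add_distrib, ← Finset.add_sum_erase _ _ hu, if_pos rfl, add_comm]
  congr 1
  · refine Finset.sum_congr rfl fun v hv => ?_
    rw [if_neg (Finset.ne_of_mem_erase hv)]
    ring
  · ring

theorem prod_edge_weights (hu : u ∈ e) :
    ∏ v ∈ e, (if v = u then D - a else lam - a - S v) =
      (D - a) * ∏ v ∈ e.erase u, (lam - a - S v) := by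
  rw [← Finset.mul_prod_erase _ _ hu, if_pos rfl]
  congr 1
  exact Finset.prod_congr rfl fun v hv => if_neg (Finset.ne_of_mem_erase hv)

/-- The load `D` on the vertex `u` of the edge `e` dominates the form of `e`, when the other
vertices carry the loads `S v`. -/
theorem edgeForm_le (he : e.card = k) (hk : 2 ≤ k) (ha1 : a < 1) (hu : u ∈ e)
    (hA : 0 < lam - a) (hS : ∀ v ∈ e.erase u, 0 ≤ S v) (hz : ∑ v ∈ e.erase u, S v < lam - a)
    (hD : a + (1 - a) ^ k / (lam - a) ^ (k - 2) / (lam - a - ∑ v ∈ e.erase u, S v) ≤ D)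
    (hx : ∀ v ∈ e, 0 ≤ x v) :
    edgeForm k a e x ≤ ∑ v ∈ e.erase u, (lam - S v) * x v ^ k + D * x u ^ k := by
  have hc : (e.erase u).card + 1 = k := by rw [Finset.card_erase_add_one hu, he]
  have h := (le_prod_edge_weights hc hk ha1 hA hS hz (D := D - a) (by linarith)).1
  rw [← prod_edge_weights hu] at h
  rw [← sum_edge_weights (a := a) hu, edgeForm]
  refine add_le_add_right (Finset.mul_prod_le_sum_mul_pow e he (by omega) (fun v hv => ?_) hx h) _
  split_ifs with hvu
  · have : 0 ≤ (1 - a) ^ k / (lam - a) ^ (k - 2) / (lam - a - ∑ v ∈ e.erase u, S v) :=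
      div_nonneg (div_nonneg (pow_nonneg (by linarith) _) (pow_nonneg hA.le _)) (by linarith)
    linarith
  · have hve := Finset.mem_erase.2 ⟨hvu, hv⟩
    have := Finset.single_le_sum hS hve
    linarith

theorem edgeForm_lt (he : e.card = k) (hk : 2 ≤ k) (ha1 : a < 1) (hu : u ∈ e)
    (hA : 0 < lam - a) (hS : ∀ v ∈ e.erase u, 0 ≤ S v) (hz : ∑ v ∈ e.erase u, S v < lam - a)
    (hD : a + (1 - a) ^ k / (lam - a) ^ (k - 2) / (lam - a - ∑ v ∈ e.erase u, S v) ≤ D)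
    (hstrict : a + (1 - a) ^ k / (lam - a) ^ (k - 2) / (lam - a - ∑ v ∈ e.erase u, S v) < D ∨
        ∃ v ∈ e.erase u, ∃ w ∈ e.erase u, v ≠ w ∧ 0 < S v ∧ 0 < S w)
    (hx : ∀ v ∈ e, 0 < x v) :
    edgeForm k a e x < ∑ v ∈ e.erase u, (lam - S v) * x v ^ k + D * x u ^ k := by
  have hc : (e.erase u).card + 1 = k := by rw [Finset.card_erase_add_one hu, he]
  have h := (le_prod_edge_weights hc hk ha1 hA hS hz (D := D - a) (by linarith)).2
    (hstrict.imp_left fun h => by linarith)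
  rw [← prod_edge_weights hu] at h
  rw [← sum_edge_weights (a := a) hu, edgeForm]
  refine add_lt_add_right (Finset.mul_prod_lt_sum_mul_pow e he (by omega) (fun v hv => ?_) hx h) _
  split_ifs with hvu
  · have : 0 ≤ (1 - a) ^ k / (lam - a) ^ (k - 2) / (lam - a - ∑ v ∈ e.erase u, S v) :=
      div_nonneg (div_nonneg (pow_nonneg (by linarith) _) (pow_nonneg hA.le _)) (by linarith)
    linarith
  · have hve := Finset.mem_erase.2 ⟨hvu, hv⟩
    have := Finset.single_le_sum hS hve
    linarith

end EdgeStep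

/-! ### Removing pendant edges and recording them as legs -/

section LegState

variable {V : Type*} [DecidableEq V]

/-- The degree of `v` when further paths with the lengths `Λ v` start at `v`. -/
def legDegree (E : Finset (Finset V)) (Λ : V → Multiset ℕ) (v : V) : ℕ :=
  (E.filter fun f => v ∈ f).card + (Λ v).card

/-- The edges with exactly one vertex of degree at least two. -/
def pendantEdges (E : Finset (Finset V)) (Λ : V → Multiset ℕ) : Finset (Finset V) :=
  E.filter fun e => (e.filter fun v => 2 ≤ legDegree E Λ v).card = 1

/-- A hypertree with edge set `E` and vertex set `U`, and with further paths of lengths `Λ v`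
attached at each vertex `v`: in total `m` edges, `t` of which are pendant. -/
structure LegState (k m t : ℕ) (E : Finset (Finset V)) (U : Finset V) (Λ : V → Multiset ℕ) :
    Prop where
  tree : TreeOn k E U
  total : E.card + ∑ v ∈ U, (Λ v).sum = m
  legs : ∑ v ∈ U, (Λ v).card + (pendantEdges E Λ).card = t
  ne_zero : ∀ v ∈ U, ∀ s ∈ Λ v, s ≠ 0
  half : ∀ v ∈ U, ∀ s ∈ Λ v, 2 * s ≤ m + 1

variable {k m t : ℕ} {E : Finset (Finset V)} {U : Finset V} {Λ : V → Multiset ℕ}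
  {e : Finset V} {u : V}

theorem PendantAt.degree_eq_one (hp : PendantAt E e u) {v : V} (hv : v ∈ e.erase u) :
    (E.filter fun f => v ∈ f).card = 1 := by
  have hv' := Finset.mem_erase.1 hv
  rw [Finset.card_eq_one]
  refine ⟨e, Finset.eq_singleton_iff_unique_mem.2
    ⟨Finset.mem_filter.2 ⟨hp.1, hv'.2⟩, fun f hf => ?_⟩⟩
  have := Finset.mem_filter.1 hf
  exact hp.2.2 v hv'.2 hv'.1 f this.1 this.2

/-- The vertices of `e` other than `u` lie in no other edge, so they have degree at least two
exactly when they carry a leg. -/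
theorem mem_pendantEdges_iff (hp : PendantAt E e u) (hu : 2 ≤ legDegree E Λ u) :
    e ∈ pendantEdges E Λ ↔ ∑ v ∈ e.erase u, Λ v = 0 := by
  rw [Finset.sum_eq_zero_iff, pendantEdges, Finset.mem_filter, Finset.card_eq_one]
  have hue : u ∈ e.filter fun v => 2 ≤ legDegree E Λ v := Finset.mem_filter.2 ⟨hp.2.1, hu⟩
  constructor
  · rintro ⟨-, w, hw⟩ v hv
    have huw : u = w := by rw [hw] at hue; simpa using hue
    by_contra hne
    have hv' := Finset.mem_erase.1 hv
    have : v ∈ e.filter fun v => 2 ≤ legDegree E Λ v := by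
      refine Finset.mem_filter.2 ⟨hv'.2, ?_⟩
      have := Multiset.card_pos.2 hne
      rw [legDegree, hp.degree_eq_one hv]
      omega
    rw [hw, Finset.mem_singleton] at this
    exact hv'.1 (this.trans huw.symm)
  · intro h
    refine ⟨hp.1, u, Finset.eq_singleton_iff_unique_mem.2 ⟨hue, fun v hv => ?_⟩⟩
    by_contra hne
    have hv' := Finset.mem_filter.1 hv
    have hve := Finset.mem_erase.2 ⟨hne, hv'.1⟩
    have := hv'.2
    rw [legDegree, hp.degree_eq_one hve, h v hve] at this
    simp at this

/-- On the other edges only the degree of `u` can change. It loses the edge `e` and gains at least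
one leg, so it stays at least two. -/
theorem pendantEdges_erase (hp : PendantAt E e u) (hu : 2 ≤ legDegree E Λ u) {Y : Multiset ℕ}
    (hY : Y ≠ 0) :
    pendantEdges (E.erase e) (Function.update Λ u (Λ u + Y)) = (pendantEdges E Λ).erase e := by
  ext f
  simp only [pendantEdges, Finset.mem_filter, Finset.mem_erase, and_assoc]
  refine and_congr_right fun hfe => and_congr_right fun hf => ?_
  have : ∀ v ∈ f, (2 ≤ legDegree (E.erase e) (Function.update Λ u (Λ u + Y)) v ↔
      2 ≤ legDegree E Λ v) := by
    intro v hv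
    by_cases hvu : v = u
    · subst hvu
      refine iff_of_true ?_ hu
      have h1 : ((E.erase e).filter fun f => v ∈ f).card + 1 = (E.filter fun f => v ∈ f).card := by
        rw [Finset.filter_erase, Finset.card_erase_add_one]
        exact Finset.mem_filter.2 ⟨hp.1, hp.2.1⟩
      have h2 := Multiset.card_pos.2 hY
      unfold legDegree at hu ⊢
      rw [Function.update_self, Multiset.card_add]
      omega
    · have hve : v ∉ e := fun hve => hfe (hp.2.2 v hve hvu f hf hv)
      have h1 : (E.erase e).filter (fun f => v ∈ f) = E.filter fun f => v ∈ f := by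
        rw [Finset.filter_erase, Finset.erase_eq_of_notMem]
        simp [hve]
      rw [legDegree, legDegree, h1, Function.update_of_ne hvu]
  rw [Finset.filter_congr this]

namespace LegState

/-- Removing a pendant edge, and recording it in the attached paths. -/
theorem peel (h : LegState k m t E U Λ) (hp : PendantAt E e u) (hu : 2 ≤ legDegree E Λ u)
    {Y : Multiset ℕ} (hYs : Y.sum = (∑ v ∈ e.erase u, Λ v).sum + 1)
    (hYc : Y.card = max 1 (∑ v ∈ e.erase u, Λ v).card) (hY0 : ∀ s ∈ Y, s ≠ 0)
    (hYh : ∀ s ∈ Y, 2 * s ≤ m + 1) :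
    LegState k m t (E.erase e) (U \ e.erase u) (Function.update Λ u (Λ u + Y)) := by
  have hsub : e.erase u ⊆ U := (Finset.erase_subset _ _).trans (h.tree.subset e hp.1)
  have huU : u ∈ U \ e.erase u := by simp [h.tree.subset e hp.1 hp.2.1]
  have hYne : Y ≠ 0 := by rintro rfl; simp at hYs
  have hsum : ∀ g : Multiset ℕ →+ ℕ,
      ∑ v ∈ U \ e.erase u, g (Function.update Λ u (Λ u + Y) v) + g (∑ v ∈ e.erase u, Λ v) =
        ∑ v ∈ U, g (Λ v) + g Y := by
    intro g
    rw [map_sum, ← Finset.sum_sdiff hsub, ← Finset.add_sum_erase _ _ huU,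
      ← Finset.add_sum_erase (U \ e.erase u) (fun v => g (Λ v)) huU, Function.update_self, map_add]
    have : ∑ v ∈ (U \ e.erase u).erase u, g (Function.update Λ u (Λ u + Y) v) =
        ∑ v ∈ (U \ e.erase u).erase u, g (Λ v) :=
      Finset.sum_congr rfl fun v hv => by rw [Function.update_of_ne (Finset.ne_of_mem_erase hv)]
    rw [this]
    ring
  refine ⟨h.tree.erase_pendant hp, ?_, ?_, ?_, ?_⟩
  · have h1 := hsum Multiset.sumAddMonoidHom
    simp only [Multiset.coe_sumAddMonoidHom] at h1
    have h2 := h.total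
    have h3 := Finset.card_erase_add_one hp.1
    omega
  · have h1 := hsum Multiset.cardHom
    simp only [Multiset.cardHom_apply] at h1
    have h2 := h.legs
    rw [pendantEdges_erase hp hu hYne]
    -- Without legs, `e` is a pendant edge and turns into one leg. With legs, `e` is not pendant and
    -- the number of legs is unchanged. Either way `t` is preserved.
    by_cases hX : ∑ v ∈ e.erase u, Λ v = 0
    · have h3 := Finset.card_erase_add_one ((mem_pendantEdges_iff hp hu).2 hX)
      rw [hX] at h1 hYc
      simp only [Multiset.card_zero] at h1 hYc
      omega
    · rw [Finset.erase_eq_of_notMem (mt (mem_pendantEdges_iff hp hu).1 hX)]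
      have := Multiset.card_pos.2 hX
      omega
  · intro v hv s hs
    by_cases hvu : v = u
    · subst hvu
      rw [Function.update_self, Multiset.mem_add] at hs
      exact hs.elim (h.ne_zero v (Finset.mem_sdiff.1 hv).1 s) (hY0 s)
    · rw [Function.update_of_ne hvu] at hs
      exact h.ne_zero v (Finset.mem_sdiff.1 hv).1 s hs
  · intro v hv s hs
    by_cases hvu : v = u
    · subst hvu
      rw [Function.update_self, Multiset.mem_add] at hs
      exact hs.elim (h.half v (Finset.mem_sdiff.1 hv).1 s) (hYh s)
    · rw [Function.update_of_ne hvu] at hs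
      exact h.half v (Finset.mem_sdiff.1 hv).1 s hs

/-- The properties of a pendant edge that make its removal profitable. -/
structure Removable (m t : ℕ) (E : Finset (Finset V)) (Λ : V → Multiset ℕ) (e : Finset V)
    (u : V) : Prop where
  pendant : PendantAt E e u
  degree : 2 ≤ legDegree E Λ u
  sum_le : ∀ s ∈ ∑ v ∈ e.erase u, Λ v, (∑ v ∈ e.erase u, Λ v).sum + s + 1 ≤ m
  card_lt : (∑ v ∈ e.erase u, Λ v).card < t
  strict : 2 ≤ (∑ v ∈ e.erase u, Λ v).card →
    (∀ s ∈ ∑ v ∈ e.erase u, Λ v, (∑ v ∈ e.erase u, Λ v).sum + s + 1 < m) ∨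
      ∃ v ∈ e.erase u, ∃ w ∈ e.erase u, v ≠ w ∧ Λ v ≠ 0 ∧ Λ w ≠ 0

/-- Of two pendant edges, the one with the smaller leg total is removable: that total occurs twice
within `m`, besides the two edges themselves, and it bounds each single leg. The other edge is
pendant or carries a leg, so not all of `t` is used up at `e`. -/
theorem removable_of_le (h : LegState k m t E U Λ) {e' : Finset V} {u' : V} (hne : e ≠ e')
    (hp : PendantAt E e u) (hp' : PendantAt E e' u') (hu : ∃ f ∈ E, f ≠ e ∧ u ∈ f)
    (hu' : ∃ f ∈ E, f ≠ e' ∧ u' ∈ f)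
    (hle : (∑ v ∈ e.erase u, Λ v).sum ≤ (∑ v ∈ e'.erase u', Λ v).sum) :
    Removable m t E Λ e u := by
  have hdeg : ∀ {e u}, PendantAt E e u → (∃ f ∈ E, f ≠ e ∧ u ∈ f) → 2 ≤ legDegree E Λ u := by
    rintro e u hp ⟨f, hf, hfe, huf⟩
    have : 1 < (E.filter fun f => u ∈ f).card := Finset.one_lt_card.2
      ⟨f, Finset.mem_filter.2 ⟨hf, huf⟩, e, Finset.mem_filter.2 ⟨hp.1, hp.2.1⟩, hfe⟩
    unfold legDegree
    omega
  have hdisj : Disjoint (e.erase u) (e'.erase u') := by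
    rw [Finset.disjoint_left]
    intro v hv hv'
    have h1 := Finset.mem_erase.1 hv
    exact hne (hp.2.2 v h1.2 h1.1 e' hp'.1 (Finset.mem_erase.1 hv').2).symm
  have hsub : (e.erase u).disjUnion (e'.erase u') hdisj ⊆ U := by
    intro v hv
    rcases Finset.mem_disjUnion.1 hv with hv | hv
    · exact h.tree.subset e hp.1 (Finset.mem_of_mem_erase hv)
    · exact h.tree.subset e' hp'.1 (Finset.mem_of_mem_erase hv)
  have hsum : ∀ g : Multiset ℕ →+ ℕ,
      g (∑ v ∈ e.erase u, Λ v) + g (∑ v ∈ e'.erase u', Λ v) ≤ ∑ v ∈ U, g (Λ v) := by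
    intro g
    rw [map_sum, map_sum, ← Finset.sum_disjUnion hdisj]
    exact Finset.sum_le_sum_of_subset hsub
  have h1 := hsum Multiset.sumAddMonoidHom
  have h2 := hsum Multiset.cardHom
  simp only [Multiset.coe_sumAddMonoidHom, Multiset.cardHom_apply] at h1 h2
  have h3 := h.total
  have h4 := h.legs
  have h5 : 2 ≤ E.card := Finset.one_lt_card.2 ⟨e, hp.1, e', hp'.1, hne⟩
  have hkey : ∀ s ∈ ∑ v ∈ e.erase u, Λ v, (∑ v ∈ e.erase u, Λ v).sum + s + 1 < m := by
    intro s hs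
    have := Multiset.single_le_sum (fun _ _ => Nat.zero_le _) s hs
    omega
  refine ⟨hp, hdeg hp hu, fun s hs => (hkey s hs).le, ?_, fun _ => Or.inl hkey⟩
  by_cases hX : ∑ v ∈ e'.erase u', Λ v = 0
  · have := Finset.card_pos.2 ⟨e', (mem_pendantEdges_iff hp' (hdeg hp' hu')).2 hX⟩
    omega
  · have := Multiset.card_pos.2 hX
    omega

/-- With at least two edges there are two pendant ones to compare. A last single edge is made to
hang at its vertex with the largest leg total, which then plays the role of the second edge. -/
theorem exists_removable (h : LegState k m t E U Λ) (hk : 2 ≤ k) (hm : 2 ≤ m)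
    (hE : E.Nonempty) : ∃ e u, Removable m t E Λ e u := by
  rcases Nat.lt_or_ge E.card 2 with hE2 | hE2
  · obtain ⟨e, rfl⟩ := Finset.card_eq_one.1 (show E.card = 1 by have := hE.card_pos; omega)
    have heE : e ∈ ({e} : Finset (Finset V)) := Finset.mem_singleton_self e
    have hne : e.Nonempty := Finset.card_pos.1 (by rw [h.tree.card_eq e heE]; omega)
    obtain ⟨u, hu, hmax⟩ := Finset.exists_max_image e (fun v => (Λ v).sum) hne
    have hp : PendantAt {e} e u := ⟨heE, hu, fun v _ _ f hf _ => Finset.mem_singleton.1 hf⟩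
    have hU : U = e := by
      refine Finset.Subset.antisymm (fun w hw => ?_) (h.tree.subset e heE)
      rcases Relation.ReflTransGen.cases_tail
        (h.tree.connected u (h.tree.subset e heE hu) w hw) with h1 | ⟨_, _, f, hf, _, hwf⟩
      · exact h1 ▸ hu
      · rwa [Finset.mem_singleton.1 hf] at hwf
    have htot := h.total
    have hleg := h.legs
    rw [hU] at htot hleg
    have hΛu : Λ u ≠ 0 := by
      intro h0
      have : ∀ v ∈ e, (Λ v).sum = 0 := fun v hv => by
        have := hmax v hv
        rw [h0] at this
        simpa using this
      rw [Finset.sum_eq_zero this, Finset.card_singleton] at htot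
      omega
    have hΛu' := Multiset.card_pos.2 hΛu
    have hsum : ∀ g : Multiset ℕ →+ ℕ,
        g (Λ u) + g (∑ v ∈ e.erase u, Λ v) = ∑ v ∈ e, g (Λ v) := by
      intro g
      rw [map_sum, ← Finset.add_sum_erase _ _ hu]
    have h1 := hsum Multiset.sumAddMonoidHom
    have h2 := hsum Multiset.cardHom
    simp only [Multiset.coe_sumAddMonoidHom, Multiset.cardHom_apply] at h1 h2
    rw [Finset.card_singleton] at htot
    refine ⟨e, u, hp, ?_, ?_, by omega, fun hc => ?_⟩
    · have : (({e} : Finset (Finset V)).filter fun f => u ∈ f).card = 1 := by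
        rw [Finset.filter_singleton, if_pos hu, Finset.card_singleton]
      rw [legDegree, this]
      omega
    · intro s hs
      obtain ⟨v, hv, hsv⟩ := Multiset.mem_sum.1 hs
      have h3 := Multiset.single_le_sum (fun _ _ => Nat.zero_le _) s hsv
      have h4 := hmax v (Finset.mem_of_mem_erase hv)
      omega
    -- Otherwise all legs lie at a single vertex `v`. It has two of them, so each is strictly
    -- shorter than the leg total at `v`, hence than the one at `u`.
    · by_contra hcon
      push Not at hcon
      obtain ⟨⟨s, hs, hsm⟩, hone⟩ := hcon
      obtain ⟨v, hv, hsv⟩ := Multiset.mem_sum.1 hs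
      have hΛv : Λ v ≠ 0 := by intro h0; rw [h0] at hsv; simp at hsv
      have hX : ∑ v ∈ e.erase u, Λ v = Λ v :=
        Finset.sum_eq_single_of_mem v hv fun w hw hwv => hone v hv w hw hwv.symm hΛv
      have h4 := hmax v (Finset.mem_of_mem_erase hv)
      rw [hX] at hc h1 hsm
      obtain ⟨Y, hY⟩ := Multiset.exists_cons_of_mem hsv
      rw [hY, Multiset.card_cons] at hc
      obtain ⟨r, hr⟩ := Multiset.card_pos_iff_exists_mem.1 (show 0 < Y.card by omega)
      have h5 := Multiset.single_le_sum (fun _ _ => Nat.zero_le _) r hr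
      have h6 := h.ne_zero v (h.tree.subset e heE (Finset.mem_of_mem_erase hv)) r
        (by rw [hY]; exact Multiset.mem_cons_of_mem hr)
      rw [hY, Multiset.sum_cons] at h1 h4 hsm
      omega
  · obtain ⟨e₁, u₁, e₂, u₂, hne, hp₁, hp₂, hu₁, hu₂⟩ := h.tree.exists_two_pendants hk hE2
    rcases le_total (∑ v ∈ e₁.erase u₁, Λ v).sum (∑ v ∈ e₂.erase u₂, Λ v).sum with hle | hle
    · exact ⟨e₁, u₁, h.removable_of_le hne hp₁ hp₂ hu₁ hu₂ hle⟩
    · exact ⟨e₂, u₂, h.removable_of_le hne.symm hp₂ hp₁ hu₂ hu₁ hle⟩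

end LegState

end LegState

/-! ### Legs as actual paths of the original hypergraph -/

section Realization

variable {V : Type*} {n : ℕ}

theorem exists_enumeration {c : Finset V} (hc : c.card = n) :
    ∃ τ : Fin n → V, Finset.univ.val.map τ = c.val := by
  let f := (c.equivFinOfCardEq hc).symm
  refine ⟨fun i => f i, ?_⟩
  have h1 : Finset.univ.val.map (fun i => f i) = (Finset.univ : Finset c).val :=
    Multiset.map_univ_val_equiv f
  have h2 : (Finset.univ : Finset c).val.map Subtype.val = c.val := by
    rw [Finset.univ_eq_attach, Finset.attach_val, Multiset.attach_map_val]
  rw [← h2, ← h1, Multiset.map_map]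
  rfl

/-- The position `o` is reserved for the vertex where the path continues. -/
theorem exists_enumeration_of_mem (o : Fin n) {c : Finset V} (hc : c.card = n) {w : V} (hw : w ∈ c) :
    ∃ τ : Fin n → V, Finset.univ.val.map τ = c.val ∧ τ o = w := by
  obtain ⟨τ, hτ⟩ := exists_enumeration hc
  have hw' : w ∈ Finset.univ.val.map τ := by rw [hτ]; exact hw
  obtain ⟨i, _, hi⟩ := Multiset.mem_map.1 hw'
  refine ⟨τ ∘ Equiv.swap o i, ?_, by simp [hi]⟩
  rw [← hτ, ← Multiset.map_map, Multiset.map_univ_val_equiv]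

variable [DecidableEq V]

/-- The edges of a path that starts at `v` and whose edges have the further vertices `τ a`, for `τ`
in the list; the vertex `τ o` lies on the next edge. -/
def legEdges (o : Fin n) : V → List (Fin n → V) → Multiset (Finset V)
  | _, [] => 0
  | v, τ :: l => insert v (Finset.univ.image τ) ::ₘ legEdges o (τ o) l

/-- The vertices of a path, without its first vertex. -/
def legVerts : List (Fin n → V) → Multiset V
  | [] => 0
  | τ :: l => Finset.univ.val.map τ + legVerts l

variable [Fintype V]

/-- The family `E₀` consists of `E`, on the vertices `U`, and of the disjoint paths in `B` with
lengths `Λ`. -/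
structure Realized (o : Fin n) (E₀ E : Finset (Finset V)) (U : Finset V) (Λ : V → Multiset ℕ)
    (B : Multiset (V × List (Fin n → V))) : Prop where
  base : ∀ p ∈ B, p.1 ∈ U
  verts : U.val + (B.map fun p => legVerts p.2).sum = Finset.univ.val
  edges : E.val + (B.map fun p => legEdges o p.1 p.2).sum = E₀.val
  legs : ∀ v ∈ U, (B.filter fun p => p.1 = v).map (fun p => p.2.length) = Λ v

variable {o : Fin n} {E₀ E : Finset (Finset V)} {U : Finset V} {Λ : V → Multiset ℕ}
  {B : Multiset (V × List (Fin n → V))} {e : Finset V} {u : V}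

/-- The hypotheses `hverts` and `hedges` describe the realization with the path `l` taken out of
`B`. Prepending `e` moves one edge and its own vertices from the remaining tree to that path. As
these are identities of multisets, they keep the paths disjoint and exhaustive. -/
theorem realized_cons (he : e ∈ E) (hu : u ∈ e) (heU : e ⊆ U) {τ : Fin n → V}
    {l : List (Fin n → V)} (hτ : Finset.univ.val.map τ = (e.erase u).val)
    (hbase : ∀ p ∈ B, p.1 ∈ U \ e.erase u)
    (hverts : U.val + (legVerts l + (B.map fun p => legVerts p.2).sum) = Finset.univ.val)
    (hedges : E.val + (legEdges o (τ o) l + (B.map fun p => legEdges o p.1 p.2).sum) = E₀.val)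
    (hlegs : ∀ v ∈ U \ e.erase u, (B.filter fun p => p.1 = v).map (fun p => p.2.length) = Λ v) :
    Realized o E₀ (E.erase e) (U \ e.erase u)
      (Function.update Λ u (Λ u + {l.length + 1})) ((u, τ :: l) ::ₘ B) where
  base p hp := by
    rcases Multiset.mem_cons.1 hp with rfl | hp
    · simp [heU hu]
    · exact hbase p hp
  verts := by
    have hsub : (e.erase u).val ≤ U.val :=
      Finset.val_le_iff.2 ((Finset.erase_subset _ _).trans heU)
    rw [← hverts, Multiset.map_cons, Multiset.sum_cons, legVerts, hτ, Finset.sdiff_val,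
      add_assoc, ← add_assoc, tsub_add_cancel_of_le hsub]
  edges := by
    have himage : insert u (Finset.univ.image τ) = e := by
      rw [Finset.image, hτ, Finset.val_toFinset, Finset.insert_erase hu]
    rw [← hedges, Multiset.map_cons, Multiset.sum_cons, legEdges, himage, Finset.erase_val,
      Multiset.cons_add, Multiset.add_cons, ← Multiset.cons_add, Multiset.cons_erase he]
  legs v hv := by
    by_cases hvu : v = u
    · subst hvu
      rw [Multiset.filter_cons_of_pos (p := fun p : V × List (Fin n → V) => p.1 = v) _ rfl,
        Multiset.map_cons, hlegs v hv, Function.update_self,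
        ← Multiset.singleton_add, add_comm, List.length_cons]
    · rw [Multiset.filter_cons_of_neg (p := fun p : V × List (Fin n → V) => p.1 = v) _
        (fun h => hvu h.symm), hlegs v hv,
        Function.update_of_ne hvu]

/-- A pendant edge whose vertices carry at most one path extends the realization. -/
theorem Realized.peel {k m t : ℕ} (hstate : LegState k m t E U Λ) (hn : n + 1 = k)
    (h : Realized o E₀ E U Λ B) (hp : PendantAt E e u) {l : ℕ} {X : Multiset ℕ}
    (hX : ∑ v ∈ e.erase u, Λ v = X) (hXl : X = 0 ∧ l = 0 ∨ X = {l}) :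
    ∃ B', Realized o E₀ (E.erase e) (U \ e.erase u)
      (Function.update Λ u (Λ u + {l + 1})) B' := by
  have heU := hstate.tree.subset e hp.1
  have hcU : e.erase u ⊆ U := (Finset.erase_subset _ _).trans heU
  have hc : (e.erase u).card = n := by
    have := Finset.card_erase_add_one hp.2.1
    have := hstate.tree.card_eq e hp.1
    omega
  have hbase : ∀ p ∈ B, p.1 ∈ e.erase u → Λ p.1 ≠ 0 := by
    intro p hpB hpc h0
    have h1 := h.legs p.1 (hcU hpc)
    rw [h0, Multiset.map_eq_zero] at h1
    have : p ∈ B.filter fun q => q.1 = p.1 := Multiset.mem_filter.2 ⟨hpB, rfl⟩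
    rw [h1] at this
    simp at this
  rcases hXl with ⟨rfl, rfl⟩ | rfl
  · rw [Finset.sum_eq_zero_iff] at hX
    obtain ⟨τ, hτ⟩ := exists_enumeration hc
    refine ⟨_, realized_cons (l := []) (B := B) hp.1 hp.2.1 heU hτ (fun p hpB => ?_) ?_ ?_ fun v hv => ?_⟩
    · exact Finset.mem_sdiff.2 ⟨h.base p hpB, fun hpc => hbase p hpB hpc (hX _ hpc)⟩
    · rw [legVerts, zero_add]; exact h.verts
    · rw [legEdges, zero_add]; exact h.edges
    · exact h.legs v (Finset.mem_sdiff.1 hv).1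
  -- The only leg starts at one vertex `c` of `e`; the path of `B` realizing it is extended by `e`
  -- through `c`.
  · have hl : l ∈ ∑ v ∈ e.erase u, Λ v := by rw [hX]; exact Multiset.mem_singleton_self l
    obtain ⟨c, hcc, hlc⟩ := Multiset.mem_sum.1 hl
    rw [← Finset.add_sum_erase _ _ hcc] at hX
    obtain ⟨Y, hY⟩ := Multiset.exists_cons_of_mem hlc
    rw [hY, Multiset.cons_add, ← Multiset.cons_zero, Multiset.cons_inj_right] at hX
    obtain ⟨hY0, hrest⟩ := add_eq_zero.1 hX
    rw [Finset.sum_eq_zero_iff] at hrest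
    rw [hY0, Multiset.cons_zero] at hY
    have hfil := h.legs c (hcU hcc)
    rw [hY, Multiset.map_eq_singleton] at hfil
    obtain ⟨p, hpf, hpl⟩ := hfil
    obtain ⟨hpB, hpc⟩ := Multiset.mem_filter.1
      (show p ∈ B.filter fun q => q.1 = c by rw [hpf]; exact Multiset.mem_singleton_self p)
    obtain ⟨B₀, rfl⟩ := Multiset.exists_cons_of_mem hpB
    rw [Multiset.filter_cons_of_pos (p := fun p : V × List (Fin n → V) => p.1 = c) _ hpc, ← Multiset.cons_zero, Multiset.cons_inj_right,
      Multiset.filter_eq_nil] at hpf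
    obtain ⟨τ, hτ, hτo⟩ := exists_enumeration_of_mem o hc hcc
    subst hpl
    refine ⟨_, realized_cons (l := p.2) (B := B₀) hp.1 hp.2.1 heU hτ (fun q hqB => ?_) ?_ ?_
      fun v hv => ?_⟩
    · refine Finset.mem_sdiff.2 ⟨h.base q (Multiset.mem_cons_of_mem hqB), fun hqc => ?_⟩
      exact hbase q (Multiset.mem_cons_of_mem hqB) hqc
        (hrest _ (Finset.mem_erase.2 ⟨hpf q hqB, hqc⟩))
    · have := h.verts
      rwa [Multiset.map_cons, Multiset.sum_cons] at this
    · have := h.edges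
      rw [Multiset.map_cons, Multiset.sum_cons, hpc] at this
      rwa [hτo]
    · have hv' := Finset.mem_sdiff.1 hv
      have := h.legs v hv'.1
      rwa [Multiset.filter_cons_of_neg] at this
      rintro rfl
      exact hv'.2 (hpc ▸ hcc)

/-- The family `E₀` consists of disjoint paths at a common vertex, of almost equal lengths. -/
def IsBalancedSpider (o : Fin n) (E₀ : Finset (Finset V)) (m t : ℕ) : Prop :=
  ∃ (r : V) (Λ : V → Multiset ℕ) (B : Multiset (V × List (Fin n → V))),
    Realized o E₀ ∅ {r} Λ B ∧
      Λ r = Finset.univ.val.map fun i : Fin t => Hypergraph.balancedLength m t i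

end Realization

/-! ### The comparison by induction on the number of remaining edges -/

section Comparison

variable {V : Type*} [DecidableEq V]

theorem balancedLength_sum (m t : ℕ) (ht : 0 < t) :
    (Finset.univ.val.map fun i : Fin t => Hypergraph.balancedLength m t i).sum = m := by
  have h := sum_balancedLength m t ht (fun j => (j : ℝ))
  have h2 : ((∑ i : Fin t, Hypergraph.balancedLength m t i : ℕ) : ℝ) = (m : ℕ) := by
    push_cast at h ⊢
    rw [h]
    ring
  exact_mod_cast h2

theorem balancedLength_eq (m t : ℕ) (i : Fin t) :
    Hypergraph.balancedLength m t i = m / t ∨ Hypergraph.balancedLength m t i = m / t + 1 := by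
  unfold Hypergraph.balancedLength
  split_ifs <;> simp

variable {k m t : ℕ} {a lam δ : ℝ} {σ : ℕ → ℝ} {E : Finset (Finset V)} {U : Finset V}
  {Λ : V → Multiset ℕ} {e : Finset V} {u : V}

/-- The lengths of the attached paths after the removal of an edge whose vertices carry paths of
lengths `X`. -/
theorem exists_lengthened (hb : LegBound a ((1 - a) ^ k / (lam - a) ^ (k - 2)) lam m t σ δ)
    (ha0 : 0 ≤ a) (hm : 2 ≤ m) {X : Multiset ℕ} (hne : ∀ s ∈ X, s ≠ 0)
    (hhalf : ∀ s ∈ X, 2 * s ≤ m + 1) (hsum : ∀ s ∈ X, X.sum + s + 1 ≤ m) (hcard : X.card < t) :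
    ∃ Y : Multiset ℕ, Y.sum = X.sum + 1 ∧ Y.card = max 1 X.card ∧ (∀ s ∈ Y, s ≠ 0) ∧
      (∀ s ∈ Y, 2 * s ≤ m + 1) ∧ (X.map σ).sum < lam - a ∧
      a + (1 - a) ^ k / (lam - a) ^ (k - 2) / (lam - a - (X.map σ).sum) ≤ (Y.map σ).sum ∧
      (2 ≤ X.card → (∀ s ∈ X, X.sum + s + 1 < m) →
        a + (1 - a) ^ k / (lam - a) ^ (k - 2) / (lam - a - (X.map σ).sum) < (Y.map σ).sum) ∧
      (X.card < 2 → ∃ l, (X = 0 ∧ l = 0 ∨ X = {l}) ∧ Y = {l + 1}) := by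
  rcases Multiset.empty_or_exists_mem X with rfl | ⟨s, hs⟩
  -- Without legs, `e` becomes a leg of length one, and the load inequality is the recursion for `σ
  -- 1`.
  · refine ⟨{1}, by simp, by simp, by simp, by simpa using by omega, ?_, ?_, by simp,
      fun _ => ⟨0, by simp⟩⟩
    · have := hb.two_mul_lt
      simp only [Multiset.map_zero, Multiset.sum_zero]
      linarith
    · rw [Multiset.map_singleton, Multiset.sum_singleton, hb.succ 0, hb.zero]
      simp
  · obtain ⟨Z, rfl⟩ := Multiset.exists_cons_of_mem hs
    have hs1 := hsum s hs
    rw [Multiset.sum_cons] at hs1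
    have hs2 : 2 * s ≤ m := by omega
    have hZ0 : 0 ≤ (Z.map σ).sum := by
      refine Multiset.sum_nonneg fun r hr => ?_
      obtain ⟨q, hq, rfl⟩ := Multiset.mem_map.1 hr
      exact hb.nonneg ha0 (hhalf q (Multiset.mem_cons_of_mem hq))
    have hmem : ∀ r ∈ (s + 1) ::ₘ s ::ₘ Z, 2 * r ≤ m + 1 := by
      intro r hr
      rcases Multiset.mem_cons.1 hr with rfl | hr
      · omega
      · exact hhalf r hr
    -- Any leg `s` may be the one that is lengthened. The fictitious family consisting of `X` and
    -- one more leg `s + 1` still has at most `t` legs and total length at most `m`.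
    have hle : σ (s + 1) + ((s ::ₘ Z).map σ).sum ≤ lam := by
      have := hb.sum_le (X := (s + 1) ::ₘ s ::ₘ Z) hmem
        (by rw [Multiset.card_cons]; omega) (by rw [Multiset.sum_cons, Multiset.sum_cons]; omega)
      rwa [Multiset.map_cons, Multiset.sum_cons] at this
    have hz : σ s ≤ ((s ::ₘ Z).map σ).sum := by
      rw [Multiset.map_cons, Multiset.sum_cons]; linarith
    have hstep := hb.load_step hs2 hz hle
    have hYsum : (((s + 1) ::ₘ Z).map σ).sum = ((s ::ₘ Z).map σ).sum - σ s + σ (s + 1) := by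
      simp only [Multiset.map_cons, Multiset.sum_cons]; ring
    refine ⟨(s + 1) ::ₘ Z, ?_, ?_, fun r hr => ?_, fun r hr => ?_, hstep.1, hYsum ▸ hstep.2,
      fun hc hlt => ?_, fun hc => ⟨s, Or.inr ?_, ?_⟩⟩
    · simp only [Multiset.sum_cons]; ring
    · simp
    · rcases Multiset.mem_cons.1 hr with rfl | hr
      · omega
      · exact hne r (Multiset.mem_cons_of_mem hr)
    · refine hmem r ?_
      rcases Multiset.mem_cons.1 hr with rfl | hr
      · exact Multiset.mem_cons_self _ _
      · exact Multiset.mem_cons_of_mem (Multiset.mem_cons_of_mem hr)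
    · rw [hYsum]
      refine hb.load_step_lt hs2 ?_ ?_
      · rw [Multiset.card_cons] at hc
        obtain ⟨r, hr⟩ := Multiset.card_pos_iff_exists_mem.1 (show 0 < Z.card by omega)
        obtain ⟨W, rfl⟩ := Multiset.exists_cons_of_mem hr
        have hr' : r ∈ s ::ₘ r ::ₘ W := Multiset.mem_cons_of_mem hr
        have h1 := hb.pos ha0 (hne r hr') (hhalf r hr')
        have h2 : 0 ≤ (W.map σ).sum := by
          refine Multiset.sum_nonneg fun r' hr' => ?_
          obtain ⟨q, hq, rfl⟩ := Multiset.mem_map.1 hr'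
          exact hb.nonneg ha0
            (hhalf q (Multiset.mem_cons_of_mem (Multiset.mem_cons_of_mem hq)))
        simp only [Multiset.map_cons, Multiset.sum_cons]
        linarith
      · have := hb.sum_lt (X := (s + 1) ::ₘ s ::ₘ Z) hmem
          (by rw [Multiset.card_cons]; omega)
          (by have := hlt s hs; rw [Multiset.sum_cons]; omega)
        rwa [Multiset.map_cons, Multiset.sum_cons] at this
    · rw [Multiset.card_cons] at hc
      rw [Multiset.card_eq_zero.1 (show Z.card = 0 by omega), Multiset.cons_zero]
    · rw [Multiset.card_cons] at hc
      rw [Multiset.card_eq_zero.1 (show Z.card = 0 by omega), Multiset.cons_zero]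

variable [Fintype V]

/-- The comparison of a hypertree with the balanced spider, with the case of equality. -/
theorem LegState.alphaForm_le {n : ℕ} {o : Fin n} {E₀ : Finset (Finset V)}
    (hb : LegBound a ((1 - a) ^ k / (lam - a) ^ (k - 2)) lam m t σ δ) (hn : n + 1 = k)
    (ha0 : 0 ≤ a) (ha1 : a < 1) (hk : 2 ≤ k) (hm : 2 ≤ m) (ht : 2 ≤ t)
    (h : LegState k m t E U Λ) :
    (∀ x : V → ℝ, (∀ v, 0 ≤ x v) →
      alphaForm k a E x ≤ ∑ v ∈ U, (lam - ((Λ v).map σ).sum) * x v ^ k) ∧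
    ((∃ x : V → ℝ, (∀ v, 0 < x v) ∧
      alphaForm k a E x = ∑ v ∈ U, (lam - ((Λ v).map σ).sum) * x v ^ k) →
      (∃ B, Realized o E₀ E U Λ B) → IsBalancedSpider o E₀ m t) := by
  induction hN : E.card generalizing E U Λ with
  | zero =>
    obtain rfl := Finset.card_eq_zero.1 hN
    obtain ⟨r, rfl⟩ := h.tree.eq_singleton
    have hr := Finset.mem_singleton_self r
    have hc : (Λ r).card = t := by simpa [pendantEdges] using h.legs
    have hs : (Λ r).sum = m := by simpa using h.total
    have hle := hb.sum_le (h.half r hr) hc.le hs.le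
    simp only [alphaForm, Finset.sum_empty, Finset.sum_singleton]
    refine ⟨fun x hx => mul_nonneg (sub_nonneg.2 hle) (pow_nonneg (hx r) k), ?_⟩
    rintro ⟨x, hx, heq⟩ ⟨B, hB⟩
    have heq' : ((Λ r).map σ).sum = lam := by
      have := (mul_eq_zero.1 heq.symm).resolve_right (pow_pos (hx r) k).ne'
      linarith
    refine ⟨r, Λ, B, hB, eq_of_card_eq_of_sum_eq (L := m / t)
      (hb.mem_of_sum_eq (h.half r hr) hc hs ht heq') (fun s hs => ?_) (by simp [hc]) ?_⟩
    · obtain ⟨i, _, rfl⟩ := Multiset.mem_map.1 hs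
      exact balancedLength_eq m t i
    · rw [hs, balancedLength_sum m t (by omega)]
  | succ N ih =>
    obtain ⟨e, u, hrem⟩ := h.exists_removable hk hm (Finset.card_pos.1 (by omega))
    have hp := hrem.pendant
    have heU := h.tree.subset e hp.1
    have hcU : e.erase u ⊆ U := (Finset.erase_subset _ _).trans heU
    have huU : u ∈ U \ e.erase u := by simp [heU hp.2.1]
    set X := ∑ v ∈ e.erase u, Λ v with hX
    have hXmem : ∀ s ∈ X, ∃ v ∈ U, s ∈ Λ v := by
      intro s hs
      obtain ⟨v, hv, hsv⟩ := Multiset.mem_sum.1 hs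
      exact ⟨v, hcU hv, hsv⟩
    obtain ⟨Y, hYs, hYc, hY0, hYh, hz, hD, hDlt, hY1⟩ := exists_lengthened hb ha0 hm (X := X)
      (fun s hs => by obtain ⟨v, hv, hsv⟩ := hXmem s hs; exact h.ne_zero v hv s hsv)
      (fun s hs => by obtain ⟨v, hv, hsv⟩ := hXmem s hs; exact h.half v hv s hsv)
      hrem.sum_le hrem.card_lt
    have hstate := h.peel hp hrem.degree hYs hYc hY0 hYh
    obtain ⟨ih1, ih2⟩ := ih hstate (by rw [Finset.card_erase_of_mem hp.1, hN]; rfl)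
    set S : V → ℝ := fun v => ((Λ v).map σ).sum with hS
    have hXS : (X.map σ).sum = ∑ v ∈ e.erase u, S v := by
      rw [hX, hS]
      exact map_sum ((Multiset.sumAddMonoidHom (M := ℝ)).comp (Multiset.mapAddMonoidHom σ))
        Λ (e.erase u)
    rw [hXS] at hz hD hDlt
    have hS0 : ∀ v ∈ e.erase u, 0 ≤ S v := fun v hv => Multiset.sum_nonneg fun r hr => by
      obtain ⟨q, hq, rfl⟩ := Multiset.mem_map.1 hr
      exact hb.nonneg ha0 (h.half v (hcU hv) q hq)
    have hSpos : ∀ v ∈ e.erase u, Λ v ≠ 0 → 0 < S v := fun v hv hne => by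
      obtain ⟨q, hq⟩ := Multiset.exists_mem_of_ne_zero hne
      have h1 := hb.pos ha0 (h.ne_zero v (hcU hv) q hq) (h.half v (hcU hv) q hq)
      refine h1.trans_le (Multiset.single_le_sum (fun r hr => ?_) _ (Multiset.mem_map_of_mem σ hq))
      obtain ⟨q, hq, rfl⟩ := Multiset.mem_map.1 hr
      exact hb.nonneg ha0 (h.half v (hcU hv) q hq)
    have hA : 0 < lam - a := by have := hb.two_mul_lt; linarith
    -- The bound for `e` and the bound after its removal add up exactly to the bound before: the
    -- load of `Y` spent at `u` cancels.
    have hsplit : ∀ x : V → ℝ,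
        (∑ v ∈ e.erase u, (lam - S v) * x v ^ k + (Y.map σ).sum * x u ^ k) +
          ∑ v ∈ U \ e.erase u,
            (lam - ((Function.update Λ u (Λ u + Y) v).map σ).sum) * x v ^ k =
        ∑ v ∈ U, (lam - S v) * x v ^ k := by
      intro x
      rw [← Finset.sum_sdiff hcU, ← Finset.add_sum_erase _ _ huU,
        ← Finset.add_sum_erase (U \ e.erase u) (fun v => (lam - S v) * x v ^ k) huU,
        Function.update_self, Multiset.map_add, Multiset.sum_add]
      have : ∑ v ∈ (U \ e.erase u).erase u,
          (lam - ((Function.update Λ u (Λ u + Y) v).map σ).sum) * x v ^ k =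
          ∑ v ∈ (U \ e.erase u).erase u, (lam - S v) * x v ^ k :=
        Finset.sum_congr rfl fun v hv => by rw [Function.update_of_ne (Finset.ne_of_mem_erase hv)]
      rw [this]
      simp only [hS]
      ring
    have hform : ∀ x : V → ℝ, alphaForm k a E x =
        edgeForm k a e x + alphaForm k a (E.erase e) x := fun x => by
      rw [alphaForm, alphaForm, Finset.add_sum_erase _ (fun f => edgeForm k a f x) hp.1]
    refine ⟨fun x hx => ?_, ?_⟩
    · rw [hform, ← hsplit x]
      exact add_le_add (edgeForm_le (h.tree.card_eq e hp.1) hk ha1 hp.2.1 hA hS0 hz hD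
        fun v _ => hx v) (ih1 x hx)
    · rintro ⟨x, hx, heq⟩ ⟨B, hB⟩
      have h1 := edgeForm_le (h.tree.card_eq e hp.1) hk ha1 hp.2.1 hA hS0 hz hD
        fun v _ => (hx v).le
      have h2 := ih1 x fun v => (hx v).le
      rw [hform, ← hsplit x] at heq
      -- Equality makes the inequality for `e` tight, which excludes two legs: at one vertex they
      -- leave slack in the load step, at two vertices in the product inequality.
      have hXc : X.card < 2 := by
        by_contra hc
        refine absurd (edgeForm_lt (h.tree.card_eq e hp.1) hk ha1 hp.2.1 hA hS0 hz hD ?_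
          fun v _ => hx v) (by linarith)
        rcases hrem.strict (not_lt.1 hc) with hlt | ⟨v, hv, w, hw, hvw, hv0, hw0⟩
        · exact Or.inl (hDlt (not_lt.1 hc) hlt)
        · exact Or.inr ⟨v, hv, w, hw, hvw, hSpos v hv hv0, hSpos w hw hw0⟩
      obtain ⟨l, hXl, rfl⟩ := hY1 hXc
      exact ih2 ⟨x, hx, by linarith⟩ (hB.peel h hn hp hX.symm hXl)

end Comparison

open Hypergraph

/-! ### Spiders and their positive eigenvectors -/

section Spider

variable {k t : ℕ} {len : Fin t → ℕ}

/-- The common vertex, or the vertex that the `j`-th edge of the `i`-th path shares with the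
previous one. -/
def spiderTop (o : Fin (k - 1)) (i : Fin t) (j : Fin (len i)) : SpiderVertex k t len :=
  if (j : ℕ) = 0 then none else some ⟨i, ⟨j - 1, lt_of_le_of_lt (Nat.sub_le _ _) j.2⟩, o⟩

/-- The `j`-th edge of the `i`-th path of a spider, as a finite set. -/
def spiderFinEdge (o : Fin (k - 1)) (p : (i : Fin t) × Fin (len i)) :
    Finset (SpiderVertex k t len) :=
  insert (spiderTop o p.1 p.2) (Finset.univ.image fun a => some ⟨p.1, p.2, a⟩)

/-- The edge set of a spider, as a finite family of finite sets. -/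
def spiderFamily (o : Fin (k - 1)) (len : Fin t → ℕ) : Finset (Finset (SpiderVertex k t len)) :=
  Finset.univ.image (spiderFinEdge o)

variable {o : Fin (k - 1)}

theorem some_mem_spiderFinEdge {i i' : Fin t} {j : Fin (len i)} {j' : Fin (len i')}
    {a : Fin (k - 1)} :
    (some ⟨i, j, a⟩ : SpiderVertex k t len) ∈ spiderFinEdge o ⟨i', j'⟩ ↔
      i = i' ∧ ((j : ℕ) = j' ∨ (j : ℕ) + 1 = j' ∧ a = o) := by
  unfold spiderFinEdge spiderTop
  rw [Finset.mem_insert, Finset.mem_image]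
  constructor
  · rintro (h | ⟨b, -, h⟩)
    · split_ifs at h with h0
      simp only [Option.some.injEq, Sigma.mk.injEq] at h
      obtain ⟨rfl, h⟩ := h
      simp only [heq_eq_eq, Prod.mk.injEq] at h
      obtain ⟨rfl, rfl⟩ := h
      exact ⟨rfl, Or.inr ⟨Nat.sub_add_cancel (Nat.pos_of_ne_zero h0), rfl⟩⟩
    · simp only [Option.some.injEq, Sigma.mk.injEq] at h
      obtain ⟨rfl, h⟩ := h
      simp only [heq_eq_eq, Prod.mk.injEq] at h
      obtain ⟨rfl, rfl⟩ := h
      exact ⟨rfl, Or.inl rfl⟩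
  · rintro ⟨rfl, h | ⟨h, rfl⟩⟩
    · obtain rfl := Fin.ext h
      exact Or.inr ⟨a, Finset.mem_univ _, rfl⟩
    · refine Or.inl ?_
      rw [if_neg (show (j' : ℕ) ≠ 0 by omega)]
      obtain rfl : j = ⟨(j' : ℕ) - 1, lt_of_le_of_lt (Nat.sub_le _ _) j'.2⟩ :=
        Fin.ext (Nat.eq_sub_of_add_eq h)
      rfl

theorem none_mem_spiderFinEdge {i : Fin t} {j : Fin (len i)} :
    (none : SpiderVertex k t len) ∈ spiderFinEdge o ⟨i, j⟩ ↔ (j : ℕ) = 0 := by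
  unfold spiderFinEdge spiderTop
  simp

theorem spiderTop_notMem (i : Fin t) (j : Fin (len i)) :
    (spiderTop o i j : SpiderVertex k t len) ∉
      Finset.univ.image fun a => (some ⟨i, j, a⟩ : SpiderVertex k t len) := by
  unfold spiderTop
  rw [Finset.mem_image]
  rintro ⟨b, -, h⟩
  split_ifs at h with h0
  simp only [Option.some.injEq, Sigma.mk.injEq, heq_eq_eq, true_and, Prod.mk.injEq] at h
  have := congrArg Fin.val h.1
  simp only at this
  omega

theorem own_injective (i : Fin t) (j : Fin (len i)) :
    Function.Injective fun a => (some ⟨i, j, a⟩ : SpiderVertex k t len) := by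
  intro a b h
  simpa using h

theorem spiderFinEdge_injective :
    Function.Injective (spiderFinEdge o : (i : Fin t) × Fin (len i) → _) := by
  rintro ⟨i, j⟩ ⟨i', j'⟩ h
  have h1 : (some ⟨i, j, o⟩ : SpiderVertex k t len) ∈ spiderFinEdge o ⟨i', j'⟩ := by
    rw [← h, some_mem_spiderFinEdge]; exact ⟨rfl, Or.inl rfl⟩
  have h2 : (some ⟨i', j', o⟩ : SpiderVertex k t len) ∈ spiderFinEdge o ⟨i, j⟩ := by
    rw [h, some_mem_spiderFinEdge]; exact ⟨rfl, Or.inl rfl⟩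
  rw [some_mem_spiderFinEdge] at h1 h2
  obtain ⟨rfl, h1⟩ := h1
  have : j = j' := Fin.ext (by omega)
  rw [this]

theorem coe_spiderFinEdge (ho : (o : ℕ) = 0) (i : Fin t) (j : Fin (len i)) :
    (spiderFinEdge o ⟨i, j⟩ : Set (SpiderVertex k t len)) = spiderEdge k t len i j := by
  ext w
  rw [Finset.mem_coe]
  change _ ↔ _ ∨ _
  rcases w with _ | ⟨i', j', a⟩
  · rw [none_mem_spiderFinEdge]; simp
  · rw [some_mem_spiderFinEdge]
    constructor
    · rintro ⟨rfl, h⟩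
      refine Or.inr ⟨j', a, rfl, h.imp Fin.ext fun h => ⟨h.1, ?_⟩⟩
      rw [h.2, ho]
    · rintro (h | ⟨j'', b, h, h2⟩)
      · simp at h
      · simp only [Option.some.injEq, Sigma.mk.injEq] at h
        obtain ⟨rfl, h⟩ := h
        simp only [heq_eq_eq, Prod.mk.injEq] at h
        obtain ⟨rfl, rfl⟩ := h
        refine ⟨rfl, h2.imp (fun h => congrArg Fin.val h) fun h => ⟨h.1, Fin.ext ?_⟩⟩
        rw [h.2, ho]

theorem card_spiderFinEdge (p : (i : Fin t) × Fin (len i)) :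
    (spiderFinEdge o p).card = k := by
  have := o.2
  rw [spiderFinEdge, Finset.card_insert_of_notMem (spiderTop_notMem p.1 p.2),
    Finset.card_image_of_injective _ (own_injective p.1 p.2), Finset.card_univ, Fintype.card_fin]
  omega

theorem card_spiderFamily : (spiderFamily o len).card = ∑ i, len i := by
  rw [spiderFamily, Finset.card_image_of_injective _ spiderFinEdge_injective, Finset.card_univ,
    Fintype.card_sigma]
  simp

theorem prod_spiderFinEdge {M : Type*} [CommMonoid M] (x : SpiderVertex k t len → M) (i : Fin t)
    (j : Fin (len i)) :
    ∏ v ∈ spiderFinEdge o ⟨i, j⟩, x v = x (spiderTop o i j) * ∏ a, x (some ⟨i, j, a⟩) := by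
  rw [spiderFinEdge, Finset.prod_insert (spiderTop_notMem i j),
    Finset.prod_image (own_injective i j).injOn]

theorem filter_mem_own {i : Fin t} {j : Fin (len i)} {a : Fin (k - 1)} (ha : a ≠ o ∨ j + 1 = len i) :
    ((spiderFamily o len).filter fun f => some ⟨i, j, a⟩ ∈ f) = {spiderFinEdge o ⟨i, j⟩} := by
  ext f
  rw [Finset.mem_filter, Finset.mem_singleton, spiderFamily, Finset.mem_image]
  constructor
  · rintro ⟨⟨⟨i', j'⟩, -, rfl⟩, h⟩
    rw [some_mem_spiderFinEdge] at h
    obtain ⟨rfl, h | ⟨h, h'⟩⟩ := h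
    · rw [Fin.ext h]
    · rcases ha with ha | ha
      · exact absurd h' ha
      · have := j'.2; omega
  · rintro rfl
    exact ⟨⟨_, Finset.mem_univ _, rfl⟩, some_mem_spiderFinEdge.2 ⟨rfl, Or.inl rfl⟩⟩

theorem filter_mem_joint {i : Fin t} {j : Fin (len i)} (hj : (j : ℕ) + 1 < len i) :
    ((spiderFamily o len).filter fun f => some ⟨i, j, o⟩ ∈ f) =
      {spiderFinEdge o ⟨i, j⟩, spiderFinEdge o ⟨i, ⟨j + 1, hj⟩⟩} := by
  ext f
  rw [Finset.mem_filter, Finset.mem_insert, Finset.mem_singleton, spiderFamily, Finset.mem_image]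
  constructor
  · rintro ⟨⟨⟨i', j'⟩, -, rfl⟩, h⟩
    rw [some_mem_spiderFinEdge] at h
    obtain ⟨rfl, h | ⟨h, h'⟩⟩ := h
    · obtain rfl := Fin.ext h
      exact Or.inl rfl
    · right
      congr 2
      exact Fin.ext h.symm
  · rintro (rfl | rfl)
    · exact ⟨⟨_, Finset.mem_univ _, rfl⟩, some_mem_spiderFinEdge.2 ⟨rfl, Or.inl rfl⟩⟩
    · exact ⟨⟨_, Finset.mem_univ _, rfl⟩, some_mem_spiderFinEdge.2 ⟨rfl, Or.inr ⟨rfl, rfl⟩⟩⟩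

theorem filter_mem_none (hlen : ∀ i, 0 < len i) :
    ((spiderFamily o len).filter fun f => none ∈ f) =
      Finset.univ.image fun i => spiderFinEdge o ⟨i, ⟨0, hlen i⟩⟩ := by
  ext f
  rw [Finset.mem_filter, spiderFamily, Finset.mem_image, Finset.mem_image]
  constructor
  · rintro ⟨⟨⟨i, j⟩, -, rfl⟩, h⟩
    rw [none_mem_spiderFinEdge] at h
    exact ⟨i, Finset.mem_univ _, by congr 2; exact Fin.ext h.symm⟩
  · rintro ⟨i, -, rfl⟩
    exact ⟨⟨_, Finset.mem_univ _, rfl⟩, none_mem_spiderFinEdge.2 rfl⟩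

theorem firstEdge_injective (hlen : ∀ i, 0 < len i) :
    Function.Injective fun i => (spiderFinEdge o ⟨i, ⟨0, hlen i⟩⟩ :
      Finset (SpiderVertex k t len)) := by
  intro i i' h
  exact congrArg Sigma.fst (spiderFinEdge_injective h)

theorem two_le_legDegree_spiderTop (ht : 2 ≤ t) (hlen : ∀ i, 0 < len i) (i : Fin t)
    (j : Fin (len i)) :
    2 ≤ legDegree (spiderFamily o len) (fun _ => 0) (spiderTop o i j) := by
  unfold legDegree spiderTop
  rw [Multiset.card_zero, add_zero]
  split_ifs with hj
  · rw [filter_mem_none hlen, Finset.card_image_of_injective _ (firstEdge_injective hlen),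
      Finset.card_univ, Fintype.card_fin]
    exact ht
  · have hj' := j.2
    have h1 : ((⟨j - 1, lt_of_le_of_lt (Nat.sub_le _ _) j.2⟩ : Fin (len i)) : ℕ) + 1 < len i := by
      simp only
      omega
    rw [filter_mem_joint h1, Finset.card_pair]
    intro h
    have := spiderFinEdge_injective h
    simp [Fin.ext_iff] at this

theorem card_pendantEdges_spider (ht : 2 ≤ t) (hlen : ∀ i, 0 < len i) :
    (pendantEdges (spiderFamily o len) fun _ => 0).card = t := by
  have hlast : ∀ i, len i - 1 < len i := fun i => by have := hlen i; omega
  have : pendantEdges (spiderFamily o len) (fun _ => 0) =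
      Finset.univ.image fun i => spiderFinEdge o ⟨i, ⟨len i - 1, hlast i⟩⟩ := by
    ext f
    rw [pendantEdges, Finset.mem_filter, Finset.mem_image]
    constructor
    · rintro ⟨hf, hcard⟩
      rw [spiderFamily, Finset.mem_image] at hf
      obtain ⟨⟨i, j⟩, -, rfl⟩ := hf
      refine ⟨i, Finset.mem_univ _, ?_⟩
      have hj := j.2
      by_cases hj1 : (j : ℕ) + 1 < len i
      -- An edge that is not the last one of its path has two vertices of degree at least two, its
      -- top and the joint with the next edge.
      · exfalso
        obtain ⟨w, hw⟩ := Finset.card_eq_one.1 hcard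
        have h1 : spiderTop o i j ∈ ({w} : Finset (SpiderVertex k t len)) := by
          rw [← hw]
          exact Finset.mem_filter.2
            ⟨Finset.mem_insert_self _ _, two_le_legDegree_spiderTop ht hlen i j⟩
        have h2 : (some ⟨i, j, o⟩ : SpiderVertex k t len) ∈
            ({w} : Finset (SpiderVertex k t len)) := by
          rw [← hw]
          refine Finset.mem_filter.2 ⟨some_mem_spiderFinEdge.2 ⟨rfl, Or.inl rfl⟩, ?_⟩
          have := two_le_legDegree_spiderTop (o := o) ht hlen i ⟨j + 1, hj1⟩
          simpa [spiderTop] using this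
        rw [Finset.mem_singleton] at h1 h2
        refine spiderTop_notMem (o := o) i j (Finset.mem_image.2 ⟨o, Finset.mem_univ _, ?_⟩)
        rw [h1, h2]
      · congr 2
        exact Fin.ext (by simp only; omega)
    · rintro ⟨i, -, rfl⟩
      refine ⟨Finset.mem_image_of_mem _ (Finset.mem_univ _), ?_⟩
      rw [Finset.card_eq_one]
      refine ⟨spiderTop o i ⟨len i - 1, hlast i⟩, ?_⟩
      refine Finset.eq_singleton_iff_unique_mem.2 ⟨Finset.mem_filter.2
        ⟨Finset.mem_insert_self _ _, two_le_legDegree_spiderTop ht hlen i _⟩, fun v hv => ?_⟩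
      obtain ⟨hv1, hv2⟩ := Finset.mem_filter.1 hv
      refine (Finset.mem_insert.1 hv1).resolve_right fun h => ?_
      obtain ⟨a, -, rfl⟩ := Finset.mem_image.1 h
      rw [legDegree, filter_mem_own (Or.inr (by have := hlen i; simp only; omega))] at hv2
      simp at hv2
  rw [this, Finset.card_image_of_injective, Finset.card_univ, Fintype.card_fin]
  intro i i' h
  exact congrArg Sigma.fst (spiderFinEdge_injective h)

theorem adj_spiderTop (i : Fin t) (j : Fin (len i)) (a : Fin (k - 1)) :
    Adj (spiderFamily o len) (spiderTop o i j) (some ⟨i, j, a⟩) :=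
  ⟨spiderFinEdge o ⟨i, j⟩, Finset.mem_image_of_mem _ (Finset.mem_univ _),
    Finset.mem_insert_self _ _, some_mem_spiderFinEdge.2 ⟨rfl, Or.inl rfl⟩⟩

theorem Adj.symm {V : Type*} {E : Finset (Finset V)} {u w : V} (h : Adj E u w) : Adj E w u := by
  obtain ⟨e, he, h1, h2⟩ := h
  exact ⟨e, he, h2, h1⟩

theorem spider_connected (u w : SpiderVertex k t len) :
    Relation.ReflTransGen (Adj (spiderFamily o len)) u w := by
  have key : ∀ u : SpiderVertex k t len, Relation.ReflTransGen (Adj (spiderFamily o len)) none u := by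
    rintro (_ | ⟨i, ⟨j, hj⟩, a⟩)
    · exact Relation.ReflTransGen.refl
    · induction j generalizing a with
      | zero =>
        have := adj_spiderTop (o := o) i ⟨0, hj⟩ a
        exact Relation.ReflTransGen.single (by simpa [spiderTop] using this)
      | succ j ih =>
        refine (ih o (by omega)).tail ?_
        have := adj_spiderTop (o := o) i ⟨j + 1, hj⟩ a
        simpa [spiderTop] using this
  have : Std.Symm (Adj (spiderFamily o len)) := ⟨fun _ _ h => h.symm⟩
  exact ((Relation.ReflTransGen.stdSymm).symm _ _ (key u)).trans (key w)

variable {a lam : ℝ} {x : SpiderVertex k t len → ℝ}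

/-- After multiplication by `x v` each edge contributes its full product, the same quantity at all
of its vertices. -/
theorem tensorApply_mul_eq {V : Type*} [DecidableEq V] [Fintype V] {E : Finset (Finset V)}
    {x : V → ℝ} {v : V} (hk : 0 < k) (h : tensorApply k a E x v = lam * x v ^ (k - 1)) :
    ∑ e ∈ E with v ∈ e, (a * x v ^ k + (1 - a) * ∏ w ∈ e, x w) = lam * x v ^ k := by
  have hpow : x v ^ k = x v ^ (k - 1) * x v := by rw [← pow_succ]; congr 1; omega
  have h' := congrArg (· * x v) h
  simp only [mul_assoc, ← hpow] at h'
  rw [← h', tensorApply, Finset.sum_mul]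
  refine Finset.sum_congr rfl fun e he => ?_
  rw [← Finset.mul_prod_erase e x (Finset.mem_filter.1 he).2, hpow]
  ring

/-- Multiply the equations of the `k - 1` own vertices of the edge: all right sides equal `Q`, so `Q
^ (k - 1)` is known in terms of `P`. Comparison with `Q ^ k`, expanded from the definition of `Q`,
eliminates `P` and expresses `Q` by the value at the top. Here `z` is the load of the rest of the
path on the joint. -/
theorem edge_value_step (hk : 2 ≤ k) (ha1 : a < 1) (hx : ∀ v, 0 < x v) (hA : 0 < lam - a)
    (i : Fin t) (j : Fin (len i)) {z : ℝ}
    (hown : ∀ b, b ≠ o → (lam - a) * x (some ⟨i, j, b⟩) ^ k =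
      (1 - a) * ∏ v ∈ spiderFinEdge o ⟨i, j⟩, x v)
    (hjoint : (lam - a - z) * x (some ⟨i, j, o⟩) ^ k =
      (1 - a) * ∏ v ∈ spiderFinEdge o ⟨i, j⟩, x v) :
    z < lam - a ∧
      a * x (spiderTop o i j) ^ k + (1 - a) * ∏ v ∈ spiderFinEdge o ⟨i, j⟩, x v =
        (a + (1 - a) ^ k / (lam - a) ^ (k - 2) / (lam - a - z)) * x (spiderTop o i j) ^ k := by
  set Q := (1 - a) * ∏ v ∈ spiderFinEdge o ⟨i, j⟩, x v with hQ
  have hQ0 : 0 < Q := mul_pos (by linarith) (Finset.prod_pos fun v _ => hx v)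
  have hz : 0 < lam - a - z := by
    rw [← hjoint] at hQ0
    exact pos_of_mul_pos_left hQ0 (pow_pos (hx _) k).le
  refine ⟨by linarith, ?_⟩
  set P := ∏ b, x (some ⟨i, j, b⟩) ^ k with hP
  have hP0 : 0 < P := Finset.prod_pos fun b _ => pow_pos (hx _) k
  have h1 : Q ^ (k - 1) = (lam - a) ^ (k - 2) * (lam - a - z) * P := by
    have e1 : ∏ _b : Fin (k - 1), Q = Q ^ (k - 1) := by simp
    rw [← e1, hP, ← Finset.mul_prod_erase _ _ (Finset.mem_univ o),
      ← Finset.mul_prod_erase _ (fun b => x (some ⟨i, j, b⟩) ^ k) (Finset.mem_univ o), ← hjoint]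
    have e2 : ∏ _b ∈ Finset.univ.erase o, (lam - a - z) * x (some ⟨i, j, o⟩) ^ k =
        ∏ b ∈ Finset.univ.erase o, (lam - a) * x (some ⟨i, j, b⟩) ^ k :=
      Finset.prod_congr rfl fun b hb => by rw [hown b (Finset.ne_of_mem_erase hb), hjoint]
    have e3 : (Finset.univ.erase o).card = k - 2 := by
      rw [Finset.card_erase_of_mem (Finset.mem_univ o), Finset.card_univ, Fintype.card_fin]
      omega
    rw [e2, Finset.prod_mul_distrib, Finset.prod_const, e3]
    ring
  have h2 : Q ^ k = (1 - a) ^ k * (x (spiderTop o i j) ^ k * P) := by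
    rw [hQ, mul_pow, prod_spiderFinEdge, mul_pow, ← Finset.prod_pow]
  have h3 : Q ^ k = Q * Q ^ (k - 1) := by rw [← pow_succ']; congr 1; omega
  have h4 : Q * ((lam - a) ^ (k - 2) * (lam - a - z)) = (1 - a) ^ k * x (spiderTop o i j) ^ k := by
    refine mul_right_cancel₀ hP0.ne' ?_
    rw [h3, h1] at h2
    linarith
  have h5 : Q = (1 - a) ^ k / (lam - a) ^ (k - 2) / (lam - a - z) * x (spiderTop o i j) ^ k := by
    have : (lam - a) ^ (k - 2) ≠ 0 := (pow_pos hA _).ne'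
    rw [div_div, div_mul_eq_mul_div, eq_div_iff (by positivity), h4]
  rw [add_mul, ← h5]

/-- The values of a positive eigenvector of a spider along one of its paths. -/
theorem spider_edge_value (hk : 2 ≤ k) (ha1 : a < 1) (hx : ∀ v, 0 < x v)
    (heig : ∀ v, tensorApply k a (spiderFamily o len) x v = lam * x v ^ (k - 1))
    (hA : 0 < lam - a) (i : Fin t) (s : ℕ) (j : Fin (len i)) (hj : (j : ℕ) + s + 1 = len i) :
    pathLoad a ((1 - a) ^ k / (lam - a) ^ (k - 2)) lam s < lam - a ∧
      a * x (spiderTop o i j) ^ k + (1 - a) * ∏ v ∈ spiderFinEdge o ⟨i, j⟩, x v =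
        pathLoad a ((1 - a) ^ k / (lam - a) ^ (k - 2)) lam (s + 1) * x (spiderTop o i j) ^ k := by
  have hown : ∀ (j : Fin (len i)) (b : Fin (k - 1)), b ≠ o ∨ (j : ℕ) + 1 = len i →
      (lam - a) * x (some ⟨i, j, b⟩) ^ k = (1 - a) * ∏ v ∈ spiderFinEdge o ⟨i, j⟩, x v := by
    intro j b hb
    have := tensorApply_mul_eq (by omega) (heig (some ⟨i, j, b⟩))
    rw [filter_mem_own hb, Finset.sum_singleton] at this
    linarith
  -- The induction runs from the free end towards the centre; `s` counts the edges beyond the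
  -- `j`-th.
  induction s generalizing j with
  | zero =>
    refine edge_value_step hk ha1 hx hA i j (fun b hb => hown j b (Or.inl hb)) ?_
    rw [pathLoad, sub_zero]
    exact hown j o (Or.inr hj)
  | succ s ih =>
    have hj1 : (j : ℕ) + 1 < len i := by omega
    have h1 := (ih ⟨j + 1, hj1⟩ (by simp only; omega)).2
    have htop : spiderTop o i ⟨j + 1, hj1⟩ = (some ⟨i, j, o⟩ : SpiderVertex k t len) := by
      simp [spiderTop]
    rw [htop] at h1
    refine edge_value_step hk ha1 hx hA i j (fun b hb => hown j b (Or.inl hb)) ?_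
    have h2 := tensorApply_mul_eq (by omega) (heig (some ⟨i, j, o⟩))
    rw [filter_mem_joint hj1, Finset.sum_pair, h1] at h2
    · linarith
    · intro h
      have := spiderFinEdge_injective h
      simp [Fin.ext_iff] at this

/-- The eigenvalue of a positive eigenvector of a spider is the sum of the loads of its paths. -/
theorem spider_eigenvalue (hk : 2 ≤ k) (ha1 : a < 1) (ht : 0 < t) (hlen : ∀ i, 0 < len i)
    (hx : ∀ v, 0 < x v)
    (heig : ∀ v, tensorApply k a (spiderFamily o len) x v = lam * x v ^ (k - 1)) :
    0 < lam - a ∧ (∀ i, ∀ s < len i,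
      pathLoad a ((1 - a) ^ k / (lam - a) ^ (k - 2)) lam s < lam - a) ∧
    ∑ i, pathLoad a ((1 - a) ^ k / (lam - a) ^ (k - 2)) lam (len i) = lam := by
  -- An end vertex of a path lies in one edge only, so `lam - a` times a positive power equals a
  -- positive product.
  have hA : 0 < lam - a := by
    have hl := hlen ⟨0, ht⟩
    have := tensorApply_mul_eq (by omega)
      (heig (some ⟨⟨0, ht⟩, ⟨len ⟨0, ht⟩ - 1, by omega⟩, o⟩))
    rw [filter_mem_own (Or.inr (by simp only; omega)), Finset.sum_singleton] at this
    have h1 : 0 < (1 - a) * ∏ v ∈ spiderFinEdge o ⟨⟨0, ht⟩, ⟨len ⟨0, ht⟩ - 1, by omega⟩⟩, x v :=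
      mul_pos (by linarith) (Finset.prod_pos fun v _ => hx v)
    refine pos_of_mul_pos_left (b := x (some ⟨⟨0, ht⟩, ⟨len ⟨0, ht⟩ - 1, by omega⟩, o⟩) ^ k) ?_
      (pow_pos (hx _) k).le
    linarith
  refine ⟨hA, fun i s hs => ?_, ?_⟩
  · exact (spider_edge_value hk ha1 hx heig hA i s ⟨len i - 1 - s, by omega⟩
      (by simp only; omega)).1
  · have h := tensorApply_mul_eq (by omega) (heig none)
    rw [filter_mem_none hlen, Finset.sum_image (firstEdge_injective hlen).injOn] at h
    have h2 : ∀ i, a * x none ^ k + (1 - a) * ∏ v ∈ spiderFinEdge o ⟨i, ⟨0, hlen i⟩⟩, x v =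
        pathLoad a ((1 - a) ^ k / (lam - a) ^ (k - 2)) lam (len i) * x none ^ k := by
      intro i
      have h3 := (spider_edge_value hk ha1 hx heig hA i (len i - 1) ⟨0, hlen i⟩
        (by have := hlen i; simp only; omega)).2
      rw [Nat.sub_add_cancel (hlen i)] at h3
      simpa [spiderTop] using h3
    simp only [h2, ← Finset.sum_mul] at h
    exact mul_right_cancel₀ (pow_pos (hx none) k).ne' h

end Spider

/-! ### From a realized balanced spider to an isomorphism -/

section Isomorphism

variable {V : Type*}

/-- This matches the unordered paths of a realization with the numbered paths of the spider, by
their lengths. The default element of `β` serves indices outside `S`. -/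
theorem exists_indexing {ι β : Type*} [DecidableEq ι] [DecidableEq β] [Nonempty β] (f : β → ℕ)
    (g : ι → ℕ) (S : Finset ι) {B : Multiset β} (h : B.map f = S.val.map g) :
    ∃ l : ι → β, B = S.val.map l ∧ ∀ i ∈ S, f (l i) = g i := by
  induction S using Finset.induction_on generalizing B with
  | empty =>
    refine ⟨fun _ => Classical.arbitrary β, ?_, by simp⟩
    simpa using h
  | insert i S hi ih =>
    rw [Finset.insert_val_of_notMem hi, Multiset.map_cons, ← Multiset.map_eq_cons] at h
    obtain ⟨b, hb, hfb, hrest⟩ := h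
    obtain ⟨l, hl, hfl⟩ := ih hrest
    have hne : ∀ j ∈ S, j ≠ i := fun j hj hji => hi (hji ▸ hj)
    refine ⟨Function.update l i b, ?_, fun j hj => ?_⟩
    · rw [Finset.insert_val_of_notMem hi, Multiset.map_cons, Function.update_self,
        ← Multiset.cons_erase hb, hl]
      congr 1
      exact Multiset.map_congr rfl fun j hj => by rw [Function.update_of_ne (hne j hj)]
    · rcases Finset.mem_insert.1 hj with rfl | hj
      · rw [Function.update_self, hfb]
      · rw [Function.update_of_ne (hne j hj), hfl j hj]

theorem mem_legVerts {n : ℕ} {l : List (Fin n → V)} {v : V} :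
    v ∈ legVerts l ↔ ∃ (j : Fin l.length) (b : Fin n), v = l[j] b := by
  induction l with
  | nil => simp [legVerts]
  | cons τ l ih =>
    rw [legVerts, Multiset.mem_add, ih, Multiset.mem_map]
    constructor
    · rintro (⟨b, -, rfl⟩ | ⟨j, b, rfl⟩)
      · exact ⟨⟨0, by simp⟩, b, rfl⟩
      · exact ⟨j.succ, b, rfl⟩
    · rintro ⟨j, b, rfl⟩
      refine Fin.cases (Or.inl ⟨b, Finset.mem_univ b, rfl⟩) (fun j => Or.inr ⟨j, b, rfl⟩) j

theorem card_legVerts {n : ℕ} (l : List (Fin n → V)) : (legVerts l).card = l.length * n := by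
  induction l with
  | nil => simp [legVerts]
  | cons τ l ih =>
    rw [legVerts, Multiset.card_add, ih, Multiset.card_map, List.length_cons]
    simp
    ring

theorem mem_legEdges [DecidableEq V] {n : ℕ} {o : Fin n} {l : List (Fin n → V)} {v : V}
    {f : Finset V} :
    f ∈ legEdges o v l ↔ ∃ (j : ℕ) (hj : j < l.length),
      f = insert ((v :: l.map fun τ => τ o)[j]'(by simp; omega)) (Finset.univ.image l[j]) := by
  induction l generalizing v with
  | nil => simp [legEdges]
  | cons τ l ih =>
    rw [legEdges, Multiset.mem_cons, ih]
    constructor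
    · rintro (rfl | ⟨j, hj, rfl⟩)
      · exact ⟨0, by simp, rfl⟩
      · exact ⟨j + 1, by simpa using hj, rfl⟩
    · rintro ⟨j, hj, rfl⟩
      cases j with
      | zero => exact Or.inl rfl
      | succ j => exact Or.inr ⟨j, by simpa using hj, rfl⟩

variable [DecidableEq V] [Fintype V] {k m t : ℕ} {o : Fin (k - 1)}

theorem IsBalancedSpider.exists_equiv {E : Finset (Finset V)} (h : IsBalancedSpider o E m t) :
    ∃ φ : SpiderVertex k t (balancedLength m t) ≃ V,
      ∀ s, s ∈ spiderFamily o (balancedLength m t) ↔ s.map φ.toEmbedding ∈ E := by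
  obtain ⟨r, Λ, B, hB, hΛ⟩ := h
  have hfil : B.filter (fun p => p.1 = r) = B :=
    Multiset.filter_eq_self.2 fun p hp => Finset.mem_singleton.1 (hB.base p hp)
  have hleg := hB.legs r (Finset.mem_singleton_self r)
  rw [hfil, hΛ] at hleg
  have : Nonempty (V × List (Fin (k - 1) → V)) := ⟨(r, [])⟩
  obtain ⟨p, hp, hlen⟩ := exists_indexing _ _ _ hleg
  have hp1 : ∀ i, (p i).1 = r := fun i => Finset.mem_singleton.1
    (hB.base (p i) (by rw [hp]; exact Multiset.mem_map_of_mem p (Finset.mem_univ i)))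
  have hlen' : ∀ i, (p i).2.length = balancedLength m t i := fun i => hlen i (Finset.mem_univ i)
  have hverts := hB.verts
  have hedges := hB.edges
  rw [hp, Multiset.map_map] at hverts hedges
  let φ : SpiderVertex k t (balancedLength m t) → V := fun w =>
    w.elim r fun q => ((p q.1).2[(q.2.1 : ℕ)]'(by rw [hlen']; exact q.2.1.2)) q.2.2
  -- Since the paths cover `V`, `φ` is surjective; since they are disjoint, the cardinalities agree.
  have hbij : Function.Bijective φ := by
    rw [Fintype.bijective_iff_surjective_and_card]
    constructor
    · intro v
      have hv : v ∈ (Finset.univ : Finset V).val := Finset.mem_univ v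
      rw [← hverts, Multiset.mem_add, Finset.singleton_val, Multiset.mem_singleton] at hv
      rcases hv with rfl | hv
      · exact ⟨none, rfl⟩
      · obtain ⟨i, -, hi⟩ := Multiset.mem_sum.1 hv
        obtain ⟨j, b, rfl⟩ := mem_legVerts.1 hi
        exact ⟨some ⟨i, ⟨j, by rw [← hlen']; exact j.2⟩, b⟩, rfl⟩
    · have hc := congrArg Multiset.card hverts
      rw [Multiset.card_add, Finset.singleton_val, Multiset.card_singleton] at hc
      change 1 + Multiset.card (∑ i : Fin t, legVerts (p i).2) = Fintype.card V at hc
      rw [Multiset.card_sum] at hc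
      rw [← hc, Fintype.card_option, Fintype.card_sigma, add_comm]
      congr 1
      refine Finset.sum_congr rfl fun i _ => ?_
      rw [card_legVerts, hlen', Fintype.card_prod, Fintype.card_fin, Fintype.card_fin]
  have himage : ∀ i j, (spiderFinEdge o ⟨i, j⟩).image φ =
      insert ((r :: (p i).2.map fun τ => τ o)[(j : ℕ)]'(by have := j.2; simp [hlen']))
      (Finset.univ.image ((p i).2[(j : ℕ)]'(by rw [hlen']; exact j.2))) := by
    rintro i ⟨j, hj⟩
    rw [spiderFinEdge, Finset.image_insert, Finset.image_image]
    congr 1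
    cases j with
    | zero => rfl
    | succ j =>
      simp only [spiderTop, List.getElem_cons_succ, List.getElem_map]
      rfl
  refine ⟨Equiv.ofBijective φ hbij, fun s => ?_⟩
  have hmap : s.map (Equiv.ofBijective φ hbij).toEmbedding = s.image φ := by
    rw [Finset.map_eq_image]; rfl
  rw [hmap, ← Finset.mem_val (s := E), ← hedges]
  change _ ↔ _ ∈ (∅ : Finset (Finset V)).val + ∑ i : Fin t, legEdges o (p i).1 (p i).2
  rw [Finset.empty_val, zero_add, Multiset.mem_sum, spiderFamily, Finset.mem_image]
  constructor
  · rintro ⟨⟨i, j⟩, -, rfl⟩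
    refine ⟨i, Finset.mem_univ _, ?_⟩
    rw [himage, hp1, mem_legEdges]
    exact ⟨j, by rw [hlen']; exact j.2, rfl⟩
  · rintro ⟨i, -, hi⟩
    rw [hp1, mem_legEdges] at hi
    obtain ⟨j, hj, hs⟩ := hi
    refine ⟨⟨i, ⟨j, by rw [← hlen']; exact hj⟩⟩, Finset.mem_univ _, ?_⟩
    refine Finset.image_injective hbij.1 ?_
    rw [himage, hs]

end Isomorphism

open Hypergraph

/-! ### Existence of paths and acyclicity of the spider -/

section PathsAndCycles

variable {V : Type*} {E : Finset (Finset V)}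

theorem exists_pathIn {u w : V} (h : Relation.ReflTransGen (Adj E) u w) :
    ∃ s v e, PathIn E s v e ∧ v 0 = u ∧ v s = w := by
  induction h with
  | refl =>
    exact ⟨0, fun _ => u, fun _ => ∅, ⟨by simp, by simp, by simp, by simp, by simp⟩,
      rfl, rfl⟩
  | @tail b c _ hadj ih =>
    obtain ⟨s, v, e, hp, h0, hs⟩ := ih
    obtain ⟨f, hf, hbf, hcf⟩ := hadj
    by_cases hon : ∃ i ≤ s, v i = c
    · obtain ⟨i, hi, rfl⟩ := hon
      exact ⟨i, v, e, hp.take hi, h0, rfl⟩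
    push Not at hon
    -- If the path already uses `f`, it is cut just before that edge, so that `f` can be appended
    -- without repetition.
    obtain ⟨i, hi, hvi, hne⟩ : ∃ i ≤ s, v i ∈ f ∧ ∀ j < i, e j ≠ f := by
      by_cases hfe : ∃ i < s, e i = f
      · obtain ⟨i, hi, rfl⟩ := hfe
        exact ⟨i, hi.le, hp.left i hi, fun j hj hej =>
          hj.ne (hp.injE j (by omega) i hi hej)⟩
      · push Not at hfe
        exact ⟨s, le_rfl, hs ▸ hbf, hfe⟩
    refine ⟨i + 1, _, _, (hp.take hi).snoc hf hvi hcf (fun j hj => hon j (by omega)) hne, ?_, ?_⟩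
    · simpa using h0
    · simp

/-- A pendant edge lies on no cycle. -/
theorem Acyclic.of_erase [DecidableEq V] {e : Finset V} {u : V}
    (hpend : ∀ v ∈ e, v ≠ u → ∀ f ∈ E, v ∈ f → f = e) (h : Acyclic (E.erase e)) :
    Acyclic E := by
  intro s v g f hs hp hf h0 h1
  have hne : ∀ i < s, v i ≠ v (i + 1) := fun i hi hv => by
    have := hp.injV i (by omega) (i + 1) (by omega) hv
    omega
  by_cases hfe : f = e
  · subst hfe
    by_cases h0u : v 0 = u
    · have hsu : v s ≠ u := fun hsu => by
        have := hp.injV 0 (by omega) s le_rfl (h0u.trans hsu.symm)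
        omega
      refine ⟨s - 1, by omega, hpend _ h1 hsu _ (hp.mem _ (by omega)) ?_⟩
      have := hp.right (s - 1) (by omega)
      rwa [Nat.sub_add_cancel hs] at this
    · exact ⟨0, hs, hpend _ h0 h0u _ (hp.mem 0 hs) (hp.left 0 hs)⟩
  by_cases hge : ∃ i < s, g i = e
  · obtain ⟨i, hi, rfl⟩ := hge
    by_cases hiu : v i = u
    · have hu : v (i + 1) ≠ u := fun h => hne i hi (hiu.trans h.symm)
      rcases Nat.lt_or_ge (i + 1) s with h2 | h2
      · have := hp.injE _ h2 _ hi
          (hpend _ (hp.right i hi) hu _ (hp.mem _ h2) (hp.left _ h2))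
        omega
      · rw [show s = i + 1 by omega] at h1
        exact ⟨i, hi, (hpend _ (hp.right i hi) hu f hf h1).symm⟩
    · rcases Nat.eq_zero_or_pos i with rfl | hi0
      · exact ⟨0, hi, (hpend _ (hp.left 0 hi) hiu f hf h0).symm⟩
      · have hr := hp.right (i - 1) (by omega)
        rw [Nat.sub_add_cancel hi0] at hr
        have := hp.injE _ (by omega) _ hi
          (hpend _ (hp.left i hi) hiu _ (hp.mem (i - 1) (by omega)) hr)
        omega
  push Not at hge
  exact h s v g f hs ⟨fun i hi => Finset.mem_erase.2 ⟨hge i hi, hp.mem i hi⟩, hp.left, hp.right,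
    hp.injV, hp.injE⟩ (Finset.mem_erase.2 ⟨hfe, hf⟩) h0 h1

/-- An edge of largest rank meets other edges only in its top, so it is pendant and can be erased.
For the spider the rank is the distance from the centre. -/
theorem acyclic_of_rank [DecidableEq V] (rank : Finset V → ℕ) (top : Finset V → V)
    (h : ∀ e ∈ E, ∀ v ∈ e, v ≠ top e → ∀ f ∈ E, v ∈ f → f ≠ e → rank e < rank f) :
    Acyclic E := by
  induction hN : E.card generalizing E with
  | zero =>
    obtain rfl := Finset.card_eq_zero.1 hN
    intro s v e f _ _ hf
    simp at hf
  | succ N ih =>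
    obtain ⟨e, he, hmax⟩ := Finset.exists_max_image E rank (Finset.card_pos.1 (by omega))
    refine Acyclic.of_erase (e := e) (u := top e) (fun v hv hvt f hf hvf => ?_)
      (ih (fun e' he' v hv hvt f hf => h e' (Finset.mem_of_mem_erase he') v hv hvt f
        (Finset.mem_of_mem_erase hf)) (by rw [Finset.card_erase_of_mem he, hN]; rfl))
    by_contra hne
    exact absurd (h e he v hv hvt f hf hvf hne) (not_lt.2 (hmax f hf))

theorem spider_acyclic {k t : ℕ} {len : Fin t → ℕ} (o : Fin (k - 1)) :
    Acyclic (spiderFamily o len) := by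
  refine acyclic_of_rank
    (Function.extend (spiderFinEdge o) (fun p => (p.2 : ℕ)) 0)
    (Function.extend (spiderFinEdge o) (fun p => spiderTop o p.1 p.2) fun _ => none) ?_
  intro e he v hv hvt f hf hvf hne
  obtain ⟨⟨i, j⟩, -, rfl⟩ := Finset.mem_image.1 he
  obtain ⟨⟨i', j'⟩, -, rfl⟩ := Finset.mem_image.1 hf
  rw [spiderFinEdge_injective.extend_apply] at hvt
  rw [spiderFinEdge_injective.extend_apply, spiderFinEdge_injective.extend_apply]
  obtain ⟨b, -, rfl⟩ := Finset.mem_image.1 ((Finset.mem_insert.1 hv).resolve_left hvt)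
  obtain ⟨rfl, h | h⟩ := some_mem_spiderFinEdge.1 hvf
  · obtain rfl : j = j' := Fin.ext h
    exact absurd rfl hne
  · exact Nat.lt_of_succ_le h.1.le

end PathsAndCycles

/-! ### Translation between hypergraphs and finite families of sets -/

section Represents

variable {α V : Type*}

/-- The hypergraph `G` is the image of the family `E` under the injection `ι`. -/
structure Represents (G : Hypergraph α) (ι : V → α) (E : Finset (Finset V)) : Prop where
  injective : Function.Injective ι
  range_eq : Set.range ι = G.vertexSet
  edges : G.edgeSet = (fun e : Finset V => ι '' (e : Set V)) '' (E : Set (Finset V))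

theorem exists_represents (G : Hypergraph α) [Fintype G.vertexSet] :
    ∃ E : Finset (Finset G.vertexSet), Represents G Subtype.val E := by
  classical
  refine ⟨Finset.univ.filter fun s => Subtype.val '' (s : Set G.vertexSet) ∈ G.edgeSet,
    Subtype.val_injective, Subtype.range_val, ?_⟩
  ext f
  simp only [Set.mem_image, Finset.mem_coe, Finset.mem_filter, Finset.mem_univ, true_and]
  constructor
  · intro hf
    have hsub := G.subset_vertexSet_of_mem_edgeSet hf
    have heq : Subtype.val '' (Subtype.val ⁻¹' f : Set G.vertexSet) = f := by
      rw [Subtype.image_preimage_coe]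
      exact Set.inter_eq_right.2 hsub
    refine ⟨(Subtype.val ⁻¹' f : Set G.vertexSet).toFinset, ?_, ?_⟩
    · rw [Set.coe_toFinset, heq]; exact hf
    · rw [Set.coe_toFinset, heq]
  · rintro ⟨s, hs, rfl⟩
    exact hs

theorem represents_spider {k t : ℕ} {len : Fin t → ℕ} {o : Fin (k - 1)} (ho : (o : ℕ) = 0) :
    Represents (spider k t len) id (spiderFamily o len) := by
  refine ⟨Function.injective_id, Set.range_id, ?_⟩
  ext f
  simp only [Set.image_id, Set.mem_image, Finset.mem_coe, spiderFamily, Finset.mem_image,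
    Finset.mem_univ, true_and]
  constructor
  · rintro ⟨i, j, rfl⟩
    exact ⟨_, ⟨⟨i, j⟩, rfl⟩, coe_spiderFinEdge ho i j⟩
  · rintro ⟨_, ⟨⟨i, j⟩, rfl⟩, rfl⟩
    exact ⟨i, j, coe_spiderFinEdge ho i j⟩

theorem Represents.comp_equiv {W : Type*} {G : Hypergraph α} {κ : W → α} {F : Finset (Finset W)}
    (h : Represents G κ F) {E : Finset (Finset V)} (φ : V ≃ W)
    (hφ : ∀ s, s ∈ E ↔ s.map φ.toEmbedding ∈ F) : Represents G (κ ∘ φ) E where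
  injective := h.injective.comp φ.injective
  range_eq := by rw [φ.surjective.range_comp, h.range_eq]
  edges := by
    rw [h.edges]
    ext f
    simp only [Set.mem_image, Finset.mem_coe, Set.image_comp]
    constructor
    · rintro ⟨s, hs, rfl⟩
      have hs' : (s.map φ.symm.toEmbedding).map φ.toEmbedding = s := by
        rw [Finset.map_map]
        ext
        simp
      refine ⟨s.map φ.symm.toEmbedding, (hφ _).2 (hs'.symm ▸ hs), ?_⟩
      conv_rhs => rw [← hs']
      rw [Finset.coe_map φ.toEmbedding]
      rfl
    · rintro ⟨s, hs, rfl⟩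
      refine ⟨_, (hφ s).1 hs, ?_⟩
      rw [Finset.coe_map]
      rfl

namespace Represents

variable {G : Hypergraph α} {ι : V → α} {E : Finset (Finset V)} {k m t : ℕ}

theorem image_injective (h : Represents G ι E) :
    Function.Injective fun e : Finset V => ι '' (e : Set V) := fun _ _ hef =>
  Finset.coe_injective (h.injective.image_injective hef)

theorem mem_edgeSet (h : Represents G ι E) {f : Set α} :
    f ∈ G.edgeSet ↔ ∃ e ∈ E, ι '' (e : Set V) = f := by
  rw [h.edges]; rfl

theorem image_mem_edgeSet (h : Represents G ι E) {e : Finset V} :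
    ι '' (e : Set V) ∈ G.edgeSet ↔ e ∈ E := by
  rw [h.edges]
  exact h.image_injective.mem_set_image

theorem mem_image_iff (h : Represents G ι E) {v : V} {e : Finset V} :
    ι v ∈ ι '' (e : Set V) ↔ v ∈ e := h.injective.mem_set_image

theorem mem_vertexSet (h : Represents G ι E) (v : V) : ι v ∈ G.vertexSet := by
  rw [← h.range_eq]; exact Set.mem_range_self v

theorem exists_eq (h : Represents G ι E) {w : α} (hw : w ∈ G.vertexSet) : ∃ v, ι v = w := by
  rwa [← h.range_eq] at hw

theorem ncard_edgeSet (h : Represents G ι E) : G.edgeSet.ncard = E.card := by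
  rw [h.edges, Set.ncard_image_of_injective _ h.image_injective, Set.ncard_coe_finset]

theorem isUniform_iff (h : Represents G ι E) : G.IsUniform k ↔ ∀ e ∈ E, e.card = k := by
  have hc : ∀ e : Finset V, (ι '' (e : Set V)).ncard = e.card := fun e => by
    rw [Set.ncard_image_of_injective _ h.injective, Set.ncard_coe_finset]
  constructor
  · intro hu e he
    rw [← hc]
    exact hu _ (h.image_mem_edgeSet.2 he)
  · intro hu f hf
    obtain ⟨e, he, rfl⟩ := h.mem_edgeSet.1 hf
    rw [hc, hu e he]

theorem degree_eq [DecidableEq V] (h : Represents G ι E) (v : V) :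
    G.degree (ι v) = legDegree E (fun _ => 0) v := by
  have : {e ∈ G.edgeSet | ι v ∈ e} =
      (fun e : Finset V => ι '' (e : Set V)) '' ((E.filter fun e => v ∈ e : Finset _) : Set _) := by
    ext f
    constructor
    · rintro ⟨hf, hv⟩
      obtain ⟨e, he, rfl⟩ := h.mem_edgeSet.1 hf
      exact ⟨e, by simpa using ⟨he, h.mem_image_iff.1 hv⟩, rfl⟩
    · rintro ⟨e, he, rfl⟩
      have he' := Finset.mem_filter.1 (Finset.mem_coe.1 he)
      exact ⟨h.image_mem_edgeSet.2 he'.1, h.mem_image_iff.2 he'.2⟩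
  rw [degree, this, Set.ncard_image_of_injective _ h.image_injective, Set.ncard_coe_finset,
    legDegree, Multiset.card_zero, add_zero]

theorem one_le_degree [DecidableEq V] {e : Finset V} (he : e ∈ E) {v : V} (hv : v ∈ e) :
    1 ≤ legDegree E (fun _ => 0) v := by
  rw [legDegree, Multiset.card_zero, add_zero]
  exact Finset.card_pos.2 ⟨e, Finset.mem_filter.2 ⟨he, hv⟩⟩

theorem setOf_isPendantEdge [DecidableEq V] (h : Represents G ι E) (hk : 2 ≤ k)
    (hE : ∀ e ∈ E, e.card = k) :
    {f | G.IsPendantEdge f} = (fun e : Finset V => ι '' (e : Set V)) ''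
      (pendantEdges E fun _ => 0 : Finset _) := by
  ext f
  constructor
  · rintro ⟨v, e, ⟨-, ⟨⟨hv, he⟩, hinj, -⟩, h0, -, h1, h2⟩, rfl⟩
    obtain ⟨g, hg, hge⟩ := h.mem_edgeSet.1 (he 0).1
    obtain ⟨p, hp⟩ := h.exists_eq (hv 0)
    obtain ⟨q, hq⟩ := h.exists_eq (hv 1)
    have hmem := (he 0).2
    refine ⟨g, Finset.mem_coe.2 (Finset.mem_filter.2 ⟨hg, Finset.card_eq_one.2 ⟨p, ?_⟩⟩), hge⟩
    refine Finset.eq_singleton_iff_unique_mem.2 ⟨Finset.mem_filter.2 ⟨?_, ?_⟩, fun w hw => ?_⟩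
    · rw [← h.mem_image_iff, hge, hp]; exact hmem.1
    · rw [← h.degree_eq, hp]; exact h0
    · obtain ⟨hwg, hw2⟩ := Finset.mem_filter.1 hw
      by_contra hne
      rw [← h.degree_eq] at hw2
      by_cases hwq : w = q
      · rw [hwq, hq] at hw2
        have : G.degree (v 1) = 1 := h2
        omega
      · have := h1 0 (ι w) (by rw [← hge]; exact h.mem_image_iff.2 hwg)
          (fun hw => hne (h.injective (hw.trans hp.symm)))
          (fun hw => hwq (h.injective (hw.trans hq.symm)))
        omega
  · rintro ⟨e, he, rfl⟩
    obtain ⟨heE, hcard⟩ := Finset.mem_filter.1 (Finset.mem_coe.1 he)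
    obtain ⟨p, hp⟩ := Finset.card_eq_one.1 hcard
    have hpm := Finset.mem_filter.1 (hp ▸ Finset.mem_singleton_self p)
    have hone : ∀ w ∈ e, w ≠ p → G.degree (ι w) = 1 := by
      intro w hw hwp
      rw [h.degree_eq]
      refine le_antisymm (not_lt.1 fun h2 => hwp ?_) (one_le_degree heE hw)
      exact Finset.mem_singleton.1 (hp ▸ Finset.mem_filter.2 ⟨hw, h2⟩)
    -- A pendant path of length one also needs an endpoint; any second vertex of the edge will do.
    obtain ⟨q, hq, hqp⟩ := Finset.exists_mem_ne (show 1 < e.card by rw [hE e heE]; omega) p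
    refine ⟨![ι p, ι q], fun _ => ι '' (e : Set V), ⟨le_rfl, ⟨⟨?_, ?_⟩, ?_, ?_⟩, ?_, ?_, ?_, ?_⟩, rfl⟩
    · exact Fin.forall_fin_two.2 ⟨h.mem_vertexSet p, h.mem_vertexSet q⟩
    · refine Fin.forall_fin_one.2 ⟨h.image_mem_edgeSet.2 heE, h.mem_image_iff.2 hpm.1,
        h.mem_image_iff.2 hq, fun hpq => hqp (h.injective hpq).symm⟩
    · intro i j hij
      fin_cases i <;> fin_cases j
      · rfl
      · exact absurd (h.injective hij).symm hqp
      · exact absurd (h.injective hij) hqp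
      · rfl
    · exact fun i j _ => Subsingleton.elim i j
    · change 2 ≤ G.degree (ι p)
      rw [h.degree_eq]; exact hpm.2
    · exact Fin.forall_fin_two.2 ⟨fun h0 => absurd rfl h0, fun _ h1 => absurd rfl h1⟩
    · refine Fin.forall_fin_one.2 ?_
      rintro _ ⟨w, hw, rfl⟩ hwp _
      exact hone w hw fun hwp' => hwp (by rw [hwp']; rfl)
    · exact hone q hq hqp

theorem reflTransGen_of_isConnected (h : Represents G ι E) (hG : G.IsConnected) (u w : V) :
    Relation.ReflTransGen (Adj E) u w := by
  obtain ⟨s, v, e, ⟨⟨hv, he⟩, -, -⟩, h0, hs⟩ :=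
    hG.2 _ (h.mem_vertexSet u) _ (h.mem_vertexSet w)
  choose v' hv' using fun i => h.exists_eq (hv i)
  have key : ∀ i, Relation.ReflTransGen (Adj E) (v' 0) (v' i) := by
    intro i
    induction i using Fin.induction with
    | zero => exact Relation.ReflTransGen.refl
    | succ i ih =>
      refine ih.tail ?_
      obtain ⟨he1, he2, he3, -⟩ := he i
      obtain ⟨g, hg, hge⟩ := h.mem_edgeSet.1 he1
      rw [← hge, ← hv', h.mem_image_iff] at he2 he3
      exact ⟨g, hg, he2, he3⟩
  have := key (Fin.last s)
  rwa [h.injective ((hv' 0).trans h0), h.injective ((hv' _).trans hs)] at this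

theorem isConnected [Nonempty V] (h : Represents G ι E)
    (hconn : ∀ u w, Relation.ReflTransGen (Adj E) u w) : G.IsConnected := by
  refine ⟨⟨_, h.mem_vertexSet (Classical.arbitrary V)⟩, fun u hu w hw => ?_⟩
  obtain ⟨u, rfl⟩ := h.exists_eq hu
  obtain ⟨w, rfl⟩ := h.exists_eq hw
  obtain ⟨s, v, e, hp, rfl, rfl⟩ := exists_pathIn (hconn u w)
  refine ⟨s, fun i => ι (v i), fun i => ι '' (e i : Set V), ⟨⟨fun i => h.mem_vertexSet _,
    fun i => ⟨h.image_mem_edgeSet.2 (hp.mem i i.2), h.mem_image_iff.2 (hp.left i i.2),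
      h.mem_image_iff.2 (hp.right i i.2), fun hi => ?_⟩⟩, fun i j hij => ?_, fun i j hij => ?_⟩,
    rfl, rfl⟩
  · have h1 := i.2
    have := hp.injV i (by omega) (i + 1) (by omega) (h.injective hi)
    omega
  · exact Fin.ext (hp.injV i (by omega) j (by omega) (h.injective hij))
  · exact Fin.ext (hp.injE i i.2 j j.2 (h.image_injective hij))

/-- A path of length at least one closed by an unused edge is a cycle of length at least two. -/
theorem acyclic_of_noCycle (h : Represents G ι E)
    (hG : ∀ (s : ℕ) (v : Fin (s + 1) → α) (e : Fin s → Set α), ¬ G.IsCycle s v e) :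
    Acyclic E := by
  intro s v e f hs hp hf h0 h1
  by_contra hcon
  push Not at hcon
  let v' : ℕ → V := fun i => if i ≤ s then v i else v 0
  let e' : ℕ → Finset V := fun i => if i < s then e i else f
  have hv'le : ∀ i ≤ s, v' i = v i := fun i hi => if_pos hi
  have hv'gt : v' (s + 1) = v 0 := if_neg (by omega)
  have he'lt : ∀ i < s, e' i = e i := fun i hi => if_pos hi
  have he's : e' s = f := if_neg (lt_irrefl s)
  refine hG (s + 1) (fun i => ι (v' i)) (fun i => ι '' (e' i : Set V))
    ⟨⟨fun i => h.mem_vertexSet _, fun ⟨i, hi⟩ => ?_⟩, by omega, fun ⟨i, hi⟩ ⟨j, hj⟩ hij => ?_,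
      fun ⟨i, hi⟩ ⟨j, hj⟩ hij => ?_, ?_⟩
  · change ι '' (e' i : Set V) ∈ _ ∧ ι (v' i) ∈ ι '' (e' i : Set V) ∧
      ι (v' (i + 1)) ∈ ι '' (e' i : Set V) ∧ ι (v' i) ≠ ι (v' (i + 1))
    rw [h.image_mem_edgeSet, h.mem_image_iff, h.mem_image_iff, h.injective.ne_iff]
    rcases Nat.lt_or_ge i s with his | his
    · rw [hv'le i his.le, hv'le (i + 1) his, he'lt i his]
      refine ⟨hp.mem i his, hp.left i his, hp.right i his, fun hv => ?_⟩
      have := hp.injV i his.le (i + 1) his hv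
      omega
    · obtain rfl : i = s := by omega
      rw [hv'le i le_rfl, hv'gt, he's]
      refine ⟨hf, h1, h0, fun hv => ?_⟩
      have := hp.injV i le_rfl 0 (by omega) hv
      omega
  · have hij' := h.image_injective hij
    change e' i = e' j at hij'
    refine Fin.ext ?_
    change i = j
    rcases Nat.lt_or_ge i s with his | his <;> rcases Nat.lt_or_ge j s with hjs | hjs
    · rw [he'lt i his, he'lt j hjs] at hij'
      exact hp.injE i his j hjs hij'
    · rw [he'lt i his, show j = s by omega, he's] at hij'
      exact absurd hij' (hcon i his)
    · rw [he'lt j hjs, show i = s by omega, he's] at hij'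
      exact absurd hij'.symm (hcon j hjs)
    · omega
  · have hij' := h.injective hij
    change v' i = v' j at hij'
    rw [hv'le i (by omega), hv'le j (by omega)] at hij'
    exact Fin.ext (hp.injV i (by omega) j (by omega) hij')
  · change ι (v' 0) = ι (v' (s + 1))
    rw [hv'gt, hv'le 0 (by omega)]

/-- Cutting the last edge of a cycle leaves a path which that edge closes. `Fin.ofNat` extends the
finite sequences to all indices; the values beyond the end play no role. -/
theorem noCycle_of_acyclic (h : Represents G ι E) (hac : Acyclic E) (s : ℕ)
    (v : Fin (s + 1) → α) (e : Fin s → Set α) : ¬ G.IsCycle s v e := by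
  rintro ⟨⟨hv, he⟩, hs, hinjE, hinjV, hclose⟩
  choose v' hv' using fun i => h.exists_eq (hv i)
  choose e' heE he' using fun i => h.mem_edgeSet.1 (he i).1
  obtain ⟨r, rfl⟩ : ∃ r, s = r + 1 := ⟨s - 1, by omega⟩
  have hleft : ∀ i : Fin (r + 1), v' i.castSucc ∈ e' i := fun i => by
    rw [← h.mem_image_iff, hv', he']; exact (he i).2.1
  have hright : ∀ i : Fin (r + 1), v' i.succ ∈ e' i := fun i => by
    rw [← h.mem_image_iff, hv', he']; exact (he i).2.2.1
  have hE : ∀ i j, e' i = e' j → i = j := fun i j hij => hinjE (by rw [← he', ← he', hij])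
  obtain ⟨i, hi, hie⟩ := hac r (fun i => v' (Fin.ofNat (r + 2) i)) (fun i => e' (Fin.ofNat (r + 1) i))
    (e' (Fin.last r)) (by omega)
    { mem := fun i _ => heE _
      left := fun i hi => by
        have := hleft (Fin.ofNat (r + 1) i)
        convert this using 2
        ext
        simp [Nat.mod_eq_of_lt (show i < r + 1 by omega), Nat.mod_eq_of_lt (show i < r + 2 by omega)]
      right := fun i hi => by
        have := hright (Fin.ofNat (r + 1) i)
        convert this using 2
        ext
        simp [Nat.mod_eq_of_lt (show i < r + 1 by omega),
          Nat.mod_eq_of_lt (show i + 1 < r + 2 by omega)]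
      injV := fun i hi j hj hij => by
        have : (⟨i, by omega⟩ : Fin (r + 1)) = ⟨j, by omega⟩ := by
          apply hinjV
          simp only [← hv']
          congr 1
          convert hij using 2 <;> ext <;>
            simp [Nat.mod_eq_of_lt (show i < r + 2 by omega),
              Nat.mod_eq_of_lt (show j < r + 2 by omega)]
        exact congrArg Fin.val this
      injE := fun i hi j hj hij => by
        have := congrArg Fin.val (hE _ _ hij)
        simpa [Nat.mod_eq_of_lt (show i < r + 1 by omega),
          Nat.mod_eq_of_lt (show j < r + 1 by omega)] using this }
    (heE _)
    (by
      have h1 : v' 0 = v' (Fin.last (r + 1)) := h.injective (by rw [hv', hv', hclose])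
      have := hright (Fin.last r)
      rw [Fin.succ_last, ← h1] at this
      exact this)
    (by
      have := hleft (Fin.last r)
      convert this using 2
      ext
      simp [Nat.mod_eq_of_lt (show r < r + 2 by omega)])
  have := congrArg Fin.val (hE _ _ hie)
  simp [Nat.mod_eq_of_lt (show i < r + 1 by omega)] at this
  omega

/-- The bijection from the index set onto the vertex set. -/
noncomputable def vertexEquiv (h : Represents G ι E) : V ≃ G.vertexSet :=
  Equiv.ofBijective (fun v => ⟨ι v, h.mem_vertexSet v⟩)
    ⟨fun _ _ hvw => h.injective (congrArg Subtype.val hvw),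
      fun ⟨_, hw⟩ => (h.exists_eq hw).imp fun _ hv => Subtype.ext hv⟩

theorem coe_vertexEquiv (h : Represents G ι E) (v : V) : (h.vertexEquiv v : α) = ι v := rfl

theorem val_image_vertexEquiv (h : Represents G ι E) (s : Set V) :
    Subtype.val '' (h.vertexEquiv '' s) = ι '' s := by
  rw [Set.image_image]; rfl

theorem isomorphic {β W : Type*} {H : Hypergraph β} {κ : W → β} {F : Finset (Finset W)}
    (h : Represents G ι E) (h' : Represents H κ F) [Finite V] (φ : V ≃ W)
    (hφ : ∀ s, s ∈ E ↔ s.map φ.toEmbedding ∈ F) : G.Isomorphic H := by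
  refine ⟨h.vertexEquiv.symm.trans (φ.trans h'.vertexEquiv), fun s => ?_⟩
  obtain ⟨r, hr⟩ := (Set.toFinite (h.vertexEquiv ⁻¹' s)).exists_finset_coe
  have hs : h.vertexEquiv '' (r : Set V) = s := by
    rw [hr, Set.image_preimage_eq _ h.vertexEquiv.surjective]
  have hs' : (h.vertexEquiv.symm.trans (φ.trans h'.vertexEquiv)) '' s =
      h'.vertexEquiv '' ((r.map φ.toEmbedding : Finset W) : Set W) := by
    rw [← hs, Finset.coe_map, Set.image_image, Set.image_image]
    simp
  rw [hs', ← hs, val_image_vertexEquiv, val_image_vertexEquiv, h.image_mem_edgeSet,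
    h'.image_mem_edgeSet, hφ]

theorem exists_equiv_of_isomorphic {β W : Type*} {H : Hypergraph β} {κ : W → β}
    {F : Finset (Finset W)} (h : Represents G ι E) (h' : Represents H κ F)
    (hiso : G.Isomorphic H) : ∃ φ : V ≃ W, ∀ s, s ∈ E ↔ s.map φ.toEmbedding ∈ F := by
  obtain ⟨ψ, hψ⟩ := hiso
  refine ⟨h.vertexEquiv.trans (ψ.trans h'.vertexEquiv.symm), fun s => ?_⟩
  have h1 := hψ (h.vertexEquiv '' (s : Set V))
  rw [val_image_vertexEquiv, h.image_mem_edgeSet] at h1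
  rw [h1, ← h'.image_mem_edgeSet, ← h'.val_image_vertexEquiv, Finset.coe_map]
  simp [Set.image_image]

end Represents

end Represents

/-! ### The tensor of a hypergraph in terms of its edges -/

section Tensor

variable {V : Type*} [Fintype V] [DecidableEq V]

theorem card_filter_image_eq {n : ℕ} {c : Finset V} (hc : c.card = n) :
    (Finset.univ.filter fun j : Fin n → V => Finset.univ.image j = c).card = n.factorial := by
  have hn : (Fintype.card (Fin n ≃ c)) = n.factorial := by
    rw [Fintype.card_equiv (c.equivFinOfCardEq hc).symm, Fintype.card_fin]
  rw [← hn, ← Finset.card_univ]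
  symm
  refine Finset.card_bij (fun g _ l => (g l : V)) (fun g _ => ?_) (fun g _ g' _ h => ?_)
    fun j hj => ?_
  · refine Finset.mem_filter.2 ⟨Finset.mem_univ _, ?_⟩
    ext v
    rw [Finset.mem_image]
    constructor
    · rintro ⟨l, -, rfl⟩; exact (g l).2
    · intro hv; exact ⟨g.symm ⟨v, hv⟩, Finset.mem_univ _, by simp⟩
  · exact Equiv.ext fun l => Subtype.ext (congrFun h l)
  · have hj' := (Finset.mem_filter.1 hj).2
    have hinj : Function.Injective j := by
      rw [← Set.injOn_univ, ← Finset.coe_univ, ← Finset.card_image_iff, hj', hc, Finset.card_univ,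
        Fintype.card_fin]
    have hmem : ∀ l, j l ∈ c := fun l => hj' ▸ Finset.mem_image_of_mem j (Finset.mem_univ l)
    refine ⟨Equiv.ofBijective (fun l => ⟨j l, hmem l⟩) ⟨fun l l' h => hinj (congrArg Subtype.val h),
      fun ⟨v, hv⟩ => ?_⟩, Finset.mem_univ _, rfl⟩
    rw [← hj'] at hv
    obtain ⟨l, -, hl⟩ := Finset.mem_image.1 hv
    exact ⟨l, Subtype.ext hl⟩

/-- Index tuples with a repetition span fewer than `k` vertices and drop out. Each edge at `i`
arises from `(k - 1)!` tuples, which cancels the normalization. -/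
theorem sum_adjacency {k : ℕ} (hk : 2 ≤ k) (E : Finset (Finset V)) (hE : ∀ e ∈ E, e.card = k)
    (x : V → ℂ) (i : V) :
    ∑ j : Fin (k - 1) → V, (if insert i (Finset.univ.image j) ∈ E
      then 1 / ((k - 1).factorial : ℂ) else 0) * ∏ l, x (j l) =
      ∑ e ∈ E with i ∈ e, ∏ v ∈ e.erase i, x v := by
  have h1 : ∀ j : Fin (k - 1) → V, (if insert i (Finset.univ.image j) ∈ E
      then 1 / ((k - 1).factorial : ℂ) else 0) * ∏ l, x (j l) =
      ∑ e ∈ E with i ∈ e, if Finset.univ.image j = e.erase i then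
        1 / ((k - 1).factorial : ℂ) * ∏ v ∈ e.erase i, x v else 0 := by
    intro j
    by_cases hj : insert i (Finset.univ.image j) ∈ E
    · have hcard := hE _ hj
      have hle : (Finset.univ.image j).card ≤ k - 1 := by
        simpa using Finset.card_image_le (s := (Finset.univ : Finset (Fin (k - 1)))) (f := j)
      have hi : i ∉ Finset.univ.image j := fun hi => by
        rw [Finset.insert_eq_self.2 hi] at hcard
        omega
      rw [Finset.card_insert_of_notMem hi] at hcard
      have hinj : Function.Injective j := by
        rw [← Set.injOn_univ, ← Finset.coe_univ, ← Finset.card_image_iff, Finset.card_univ,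
          Fintype.card_fin]
        omega
      rw [if_pos hj, Finset.sum_eq_single (insert i (Finset.univ.image j))]
      · rw [Finset.erase_insert hi, if_pos rfl, Finset.prod_image hinj.injOn]
      · intro e he hne
        refine if_neg fun hj' => hne ?_
        rw [hj', Finset.insert_erase (Finset.mem_filter.1 he).2]
      · intro hcon
        exact absurd (Finset.mem_filter.2 ⟨hj, Finset.mem_insert_self i _⟩) hcon
    · rw [if_neg hj, zero_mul]
      symm
      refine Finset.sum_eq_zero fun e he => if_neg fun hj' => hj ?_
      have he' := Finset.mem_filter.1 he
      rw [hj', Finset.insert_erase he'.2]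
      exact he'.1
  rw [Finset.sum_congr rfl fun j _ => h1 j, Finset.sum_comm]
  refine Finset.sum_congr rfl fun e he => ?_
  have he' := Finset.mem_filter.1 he
  have hc : (e.erase i).card = k - 1 := by rw [Finset.card_erase_of_mem he'.2, hE e he'.1]
  rw [← Finset.sum_filter, Finset.sum_const, card_filter_image_eq hc, nsmul_eq_mul, ← mul_assoc,
    mul_one_div_cancel (Nat.cast_ne_zero.2 (Nat.factorial_ne_zero _)), one_mul]

variable {α : Type*} {G : Hypergraph α} {ι : V → α} {E : Finset (Finset V)} {k : ℕ}

theorem Represents.apply_alphaTensor [Fintype G.vertexSet] (h : Represents G ι E) (hk : 2 ≤ k)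
    (hE : ∀ e ∈ E, e.card = k) (a : ℝ) (x : G.vertexSet → ℂ) (i : V) :
    (G.alphaTensor k a).apply x (h.vertexEquiv i) =
      tensorApply k (a : ℂ) E (x ∘ h.vertexEquiv) i := by
  classical
  have hD : ∑ j : Fin (k - 1) → G.vertexSet, G.degreeTensor k (h.vertexEquiv i) j * ∏ l, x (j l) =
      (E.filter fun e => i ∈ e).card * x (h.vertexEquiv i) ^ (k - 1) := by
    rw [Finset.sum_eq_single (fun _ => h.vertexEquiv i)]
    · rw [degreeTensor, if_pos fun _ => rfl, h.coe_vertexEquiv, h.degree_eq, legDegree]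
      simp
    · intro j _ hj
      rw [degreeTensor, if_neg fun hj' => hj (funext hj'), zero_mul]
    · exact fun hcon => absurd (Finset.mem_univ _) hcon
  have hA : ∑ j : Fin (k - 1) → G.vertexSet,
      G.adjacencyTensor k (h.vertexEquiv i) j * ∏ l, x (j l) =
      ∑ e ∈ E with i ∈ e, ∏ v ∈ e.erase i, x (h.vertexEquiv v) := by
    have := sum_adjacency hk E hE (x ∘ h.vertexEquiv) i
    simp only [Function.comp_apply] at this
    rw [← this, ← Equiv.sum_comp (Equiv.arrowCongr (Equiv.refl (Fin (k - 1))) h.vertexEquiv)]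
    refine Finset.sum_congr rfl fun j _ => ?_
    have himg : insert ((h.vertexEquiv i : G.vertexSet) : α)
        (Set.range fun l => ((Equiv.arrowCongr (Equiv.refl (Fin (k - 1))) h.vertexEquiv j l :
          G.vertexSet) : α)) = ι '' ((insert i (Finset.univ.image j) : Finset V) : Set V) := by
      rw [Finset.coe_insert, Set.image_insert_eq, Finset.coe_image, Finset.coe_univ,
        Set.image_univ, ← Set.range_comp]
      rfl
    rw [adjacencyTensor, himg]
    simp only [h.image_mem_edgeSet]
    rfl
  unfold OrderTensor.apply alphaTensor tensorApply
  simp only [add_mul, mul_assoc, Finset.sum_add_distrib, ← Finset.mul_sum, hA, hD,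
    Finset.sum_const, nsmul_eq_mul, Function.comp_apply]

theorem Represents.alphaSpectralRadius_eq [Fintype G.vertexSet] (h : Represents G ι E)
    (hk : 2 ≤ k) (hE : ∀ e ∈ E, e.card = k) (a : ℝ) :
    G.alphaSpectralRadius k a = rho k a E := by
  unfold Hypergraph.alphaSpectralRadius OrderTensor.spectralRadius rho eigenModuli
  congr 1
  ext r
  refine exists_congr fun μ => and_congr_left fun _ => ?_
  constructor
  · rintro ⟨x, hx, hμ⟩
    refine ⟨x ∘ h.vertexEquiv, fun h0 => hx ?_, fun i => ?_⟩
    · funext w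
      have := congrFun h0 (h.vertexEquiv.symm w)
      simpa using this
    · rw [← h.apply_alphaTensor hk hE, hμ]; rfl
  · rintro ⟨x, hx, hμ⟩
    have hcomp : (x ∘ h.vertexEquiv.symm) ∘ h.vertexEquiv = x := by
      funext v
      simp
    refine ⟨x ∘ h.vertexEquiv.symm, fun h0 => hx ?_, fun w => ?_⟩
    · rw [← hcomp, h0]; rfl
    · obtain ⟨i, rfl⟩ := h.vertexEquiv.surjective w
      rw [h.apply_alphaTensor hk hE, hcomp, hμ]
      simp

end Tensor

open Hypergraph

/-! ### The extremal theorem for families and for hypergraphs -/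

section Comparison

variable {V : Type*} [Fintype V] [DecidableEq V] {k m t : ℕ} {a : ℝ}

/-- The loads of pendant paths at the spectral radius of the balanced spider. -/
theorem balancedSpider_legBound (o : Fin (k - 1)) (hk : 2 ≤ k) (ht : 2 ≤ t) (htm : t ≤ m)
    (ha0 : 0 ≤ a) (ha1 : a < 1) :
    ∃ (σ : ℕ → ℝ) (δ : ℝ),
      LegBound a ((1 - a) ^ k / (rho k a (spiderFamily o (balancedLength m t)) - a) ^ (k - 2))
        (rho k a (spiderFamily o (balancedLength m t))) m t σ δ := by
  have hlen : ∀ i, 0 < balancedLength m t i := fun i => by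
    have : 1 ≤ m / t := (Nat.one_le_div_iff (by omega)).2 htm
    rcases balancedLength_eq m t i with h | h <;> omega
  have hE : ∀ e ∈ spiderFamily o (balancedLength m t), e.card = k := fun e he => by
    obtain ⟨p, -, rfl⟩ := Finset.mem_image.1 he
    exact card_spiderFinEdge p
  obtain ⟨-, x, hx, heig⟩ := exists_perron k a (by omega) ha0 ha1 _ hE spider_connected
  obtain ⟨hA, h1, h2⟩ := spider_eigenvalue hk ha1 (by omega) hlen hx heig
  exact ⟨_, _, pathLoad_legBound ha0
    (div_pos (pow_pos (by linarith) _) (pow_pos hA _)) ht htm h1 h2⟩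

/-- Among hypertrees with `m` edges, `t` of them pendant, the balanced spider has the largest
spectral radius. -/
theorem TreeOn.rho_le (o : Fin (k - 1)) (hk : 2 ≤ k) (ht : 2 ≤ t) {E : Finset (Finset V)}
    (hE : TreeOn k E Finset.univ) (hm : E.card = m) (hp : (pendantEdges E fun _ => 0).card = t)
    (ha0 : 0 ≤ a) (ha1 : a < 1) :
    rho k a E ≤ rho k a (spiderFamily o (balancedLength m t)) ∧
      (rho k a E = rho k a (spiderFamily o (balancedLength m t)) → IsBalancedSpider o E m t) := by
  have htm : t ≤ m := by
    rw [← hm, ← hp]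
    exact Finset.card_le_card (Finset.filter_subset _ _)
  obtain ⟨σ, δ, hb⟩ := balancedSpider_legBound o hk ht htm ha0 ha1
  set lam := rho k a (spiderFamily o (balancedLength m t))
  have hstate : LegState k m t E Finset.univ fun _ => 0 :=
    ⟨hE, by simpa using hm, by simpa using hp, by simp, by simp⟩
  -- Without legs the comparison bounds the form by `lam * ∑ x v ^ k`; if the spectral radii agree,
  -- the Perron vector attains this bound.
  obtain ⟨h1, h2⟩ := hstate.alphaForm_le (o := o) (E₀ := E) hb (by omega) ha0 ha1 hk (by omega) ht
  simp only [Multiset.map_zero, Multiset.sum_zero, sub_zero, ← Finset.mul_sum] at h1 h2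
  have : Nonempty V := hE.nonempty.to_type
  obtain ⟨hg, x, hx, heig⟩ := exists_perron k a (by omega) ha0 ha1 E hE.card_eq
    fun u w => hE.connected u (Finset.mem_univ u) w (Finset.mem_univ w)
  refine ⟨norm_eigenvalue_le k a (by omega) ha0 ha1 E hE.card_eq h1 hg.1, fun heq => ?_⟩
  refine h2 ⟨x, hx, ?_⟩ ⟨0, by simp, by simp, by simp, by simp⟩
  rw [← sum_tensorApply_mul k a (by omega) E hE.card_eq, Finset.mul_sum]
  refine Finset.sum_congr rfl fun i _ => ?_
  rw [heig i, heq, mul_assoc, ← pow_succ, Nat.sub_add_cancel (by omega)]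

end Comparison

theorem isHypertreeWith_balancedSpider {k m t : ℕ} (hk : 2 ≤ k) (ht : 2 ≤ t) (htm : t ≤ m) :
    (balancedSpider m t k).IsHypertreeWith k m t := by
  have hlen : ∀ i, 0 < balancedLength m t i := fun i => by
    have : 1 ≤ m / t := (Nat.one_le_div_iff (by omega)).2 htm
    rcases balancedLength_eq m t i with h | h <;> omega
  let o : Fin (k - 1) := ⟨0, by omega⟩
  have h : Represents (balancedSpider m t k) id (spiderFamily o (balancedLength m t)) :=
    represents_spider rfl
  have hE : ∀ e ∈ spiderFamily o (balancedLength m t), e.card = k := fun e he => by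
    obtain ⟨p, -, rfl⟩ := Finset.mem_image.1 he
    exact card_spiderFinEdge p
  refine ⟨h.isUniform_iff.2 hE, ⟨h.isConnected spider_connected,
    h.noCycle_of_acyclic (spider_acyclic o)⟩, ?_, ?_⟩
  · rw [h.ncard_edgeSet, card_spiderFamily]
    exact balancedLength_sum m t (by omega)
  · rw [h.setOf_isPendantEdge hk hE, Set.ncard_image_of_injective _ h.image_injective,
      Set.ncard_coe_finset, card_pendantEdges_spider ht hlen]

end UniformFamily

open UniformFamily in
theorem mainTheorem3 {V : Type*} (G : Hypergraph V) [Fintype G.vertexSet] (k m t : ℕ)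
    (hk : 2 ≤ k) (ht : 2 ≤ t) (hG : G.IsHypertreeWith k m t) (a : ℝ) (ha0 : 0 ≤ a) (ha1 : a < 1) :
    (Hypergraph.balancedSpider m t k).IsHypertreeWith k m t ∧
      G.alphaSpectralRadius k a ≤ (Hypergraph.balancedSpider m t k).alphaSpectralRadius k a ∧
      (G.alphaSpectralRadius k a = (Hypergraph.balancedSpider m t k).alphaSpectralRadius k a ↔
        G.Isomorphic (Hypergraph.balancedSpider m t k)) := by
  classical
  obtain ⟨hunif, ⟨hconn, hcyc⟩, hm, hp⟩ := hG
  obtain ⟨E, h⟩ := exists_represents G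
  have hE := h.isUniform_iff.1 hunif
  rw [h.ncard_edgeSet] at hm
  rw [h.setOf_isPendantEdge hk hE, Set.ncard_image_of_injective _ h.image_injective,
    Set.ncard_coe_finset] at hp
  have htm : t ≤ m := by
    rw [← hm, ← hp]
    exact Finset.card_le_card (Finset.filter_subset _ _)
  let o : Fin (k - 1) := ⟨0, by omega⟩
  have hS : Represents (Hypergraph.balancedSpider m t k) id
      (spiderFamily o (Hypergraph.balancedLength m t)) := represents_spider rfl
  have hSE : ∀ e ∈ spiderFamily o (Hypergraph.balancedLength m t), e.card = k := fun e he => by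
    obtain ⟨p, -, rfl⟩ := Finset.mem_image.1 he
    exact card_spiderFinEdge p
  have htree : TreeOn k E Finset.univ := by
    obtain ⟨w, hw⟩ := hconn.1
    exact ⟨⟨⟨w, hw⟩, Finset.mem_univ _⟩, fun e _ => Finset.subset_univ e, hE,
      fun u _ w _ => h.reflTransGen_of_isConnected hconn u w, h.acyclic_of_noCycle hcyc⟩
  obtain ⟨hle, heq⟩ := htree.rho_le o hk ht hm hp ha0 ha1
  rw [h.alphaSpectralRadius_eq hk hE, hS.alphaSpectralRadius_eq hk hSE]
  refine ⟨isHypertreeWith_balancedSpider hk ht htm, hle, fun hrho => ?_, fun hiso => ?_⟩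
  · obtain ⟨φ, hφ⟩ := (heq hrho).exists_equiv
    refine h.isomorphic hS φ.symm fun s => ?_
    rw [hφ, Finset.map_map]
    simp
  · obtain ⟨φ, hφ⟩ := h.exists_equiv_of_isomorphic hS hiso
    -- Through the isomorphism the family `E` also represents the spider, whose spectral radius is
    -- thus computed in two ways.
    rw [← (hS.comp_equiv φ hφ).alphaSpectralRadius_eq hk hE, hS.alphaSpectralRadius_eq hk hSE]
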